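/- Let (e2) be the Dirichlet–Voronoi tiling of $\mathbb R^3$ for the body-centred cubic lattice, scaled to edge length $1$ and placed so that its cell centres are the points $(\tfrac12+2m,\tfrac12+2n,\sqrt2\,k)$ with $m,n,k\in\mathbb Z$ and $m+n+k$ odd; its cells are truncated octahedra, $0$ is a node, and its space group is $Im3m$. Consider the polyhedric tilings $M$ with smooth edges and faces in the first-order class of (e2): $M$ has the combinatorial structure and the nodes of (e2), i.e. $M$ is the image of (e2) under a homeomorphism of $\mathbb R^3$ that fixes all nodes; its edges are smooth arcs including their ends, and its faces are smooth except at the nodes. At each of its nodes an edge of $M$ has a half-tangent, the unit tangent vector pointing away from the node into the edge. Two such tilings are in the same second-order class if their systems of half-tangents agree up to a symmetry of (e2). $M$ is soft if at every node of every cell two of the edges of the cell have opposite half-tangents, and a soft tiling is standard if at every node all half-tangents are collinear. Let $\mathbf a$ be the half-tangent at $0$ of the edge from $0$ to $(1,0,0)$. Let $Pn3m<Im3m$ be the index-two subgroup (space group no. 224) in which the stabilizer of each cell is the symmetry group of a regular tetrahedron, of order $24$. Among the tilings each of whose half-tangents makes an acute angle with the vector from its node to the other node of its edge, there are exactly four second-order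 classes containing a soft tiling that is invariant under $Pn3m$ and each of whose cells has at least one planar face. They are the classes of $Pn3m$-invariant tilings with $$\text{(f2): }\mathbf a=\tfrac1{\sqrt2}(1,1,0),\quad \text{(g2): }\mathbf a=\tfrac1{\sqrt2}(1,-1,0),\quad \text{(h2): }\mathbf a=\left(\tfrac12,-\tfrac12,\tfrac1{\sqrt2}\right),\quad \text{(i2): }\mathbf a=\left(\tfrac{\sqrt3}2,\tfrac{\sqrt3}6,\tfrac1{\sqrt6}\right).$$ The classes (f2) and (h2) are standard, (g2) and (i2) are non-standard. Without the acute-angle condition the same four classes are the only ones up to reversal of all half-tangents: the half-tangents of every soft tiling $M$ in the first-order class of (e2), such that the system of half-tangents is invariant under $Pn3m$ and each cell has a face that is planar to second order (its nodes and the half-tangents of its edges lie in the directions of one plane), agree, up to a symmetry of (e2) and up to one common sign, with those of exactly one of the four. Moreover, if the system of half-tangents of $M$ is invariant under $Pn3m$, then $M$ is soft if and only if $\mathbf a$ is on one of the great circles $g_{abcd},g_{acbd},g_{adbc}$ of the unit sphere with normals $$\left(\tfrac1{\sqrt2},\tfrac1{\sqrt2},0\right),\quad\left(\tfrac12,-\tfrac12,\tfrac1{\sqrt2}\right),\quad\left(-\tfrac12,\tfrac12,\tfrac1{\sqrt2}\right),$$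 and each cell has a face that is planar to second order if and only if $\mathbf a$ is on one of the great circles $g_{quad},g_{hex1},g_{hex2}$ with normals $$(0,0,1),\quad\left(0,\tfrac2{\sqrt6},\tfrac{\sqrt2}{\sqrt6}\right),\quad\left(0,\tfrac2{\sqrt6},-\tfrac{\sqrt2}{\sqrt6}\right).$$ The intersection points of circles of the first kind with circles of the second kind are exactly the points $\pm\mathbf a$ and $\pm\mathbf a'$, where $\mathbf a$ is one of the four vectors above and $\mathbf a'$ is its mirror image in the plane $z=0$. Here (f2) is on $g_{acbd},g_{adbc},g_{quad}$; (g2) on $g_{abcd},g_{quad}$; (h2) on $g_{abcd},g_{adbc},g_{hex1}$; (i2) on $g_{adbc},g_{hex2}$. -/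

import Mathlib

open Filter Topology
open scoped ContDiff

/-- Euclidean three-space. -/
abbrev E3 : Type := EuclideanSpace ℝ (Fin 3)

/-! ### The (e2) tiling: the Dirichlet-Voronoi tiling of the bcc lattice

The coordinates are those in which the edges have length `1`, the origin is a node, and
`(1/2, 1/2, √2)` is the centre of one cell. -/

/-- The centres of the cells: a body-centred cubic lattice (up to translation), with
conventional cubic cell of side `2√2` spanned by `(2,2,0)`, `(2,-2,0)`, `(0,0,2√2)`. -/
def bcc : Set E3 :=
  {x | ∃ m n k : ℤ, Odd (m + n + k) ∧
    x = !₂[1 / 2 + 2 * (m : ℝ), 1 / 2 + 2 * (n : ℝ), √2 * (k : ℝ)]}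

/-- The Dirichlet-Voronoi cell of the centre `c`. -/
def voronoiCell (c : E3) : Set E3 :=
  {x | ∀ p ∈ bcc, dist x c ≤ dist x p}

/-- `S` is the (non-empty) common part of exactly `k` prescribed cells.  The tiling is primitive
(face-to-face, four cells at each node, any two cells that meet share a face), so `k = 2, 3, 4`
gives its faces, edges and nodes. -/
def IsStratum (k : ℕ) (S : Set E3) : Prop :=
  S.Nonempty ∧ ∃ s : Set E3, s ⊆ bcc ∧ s.ncard = k ∧ S = ⋂ c ∈ s, voronoiCell c

def IsFace (F : Set E3) : Prop := IsStratum 2 F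

def IsEdge (e : Set E3) : Prop := IsStratum 3 e

def IsNode (v : E3) : Prop := IsStratum 4 {v}

/-- The edge from the node `(0,0,0)` to the node `(1,0,0)`. -/
def baseEdge : Set E3 := segment ℝ 0 !₂[1, 0, 0]

/-! ### Symmetry groups -/

/-- `Im3m`: all isometries of space that preserve the (e2) tiling. -/
def Im3m : Set (E3 ≃ᵃⁱ[ℝ] E3) := {g | g '' bcc = bcc}

/-- Crystallographic (cubic) coordinates: the origin is the cell centre `(1/2, 1/2, √2)`, and the
unit vectors are `(2,2,0)`, `(2,-2,0)`, `(0,0,2√2)`. -/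
noncomputable def cubicCoord (x : E3) : Fin 3 → ℝ :=
  ![(x 0 + x 1 - 1) / 4, (x 0 - x 1) / 4, (x 2 - √2) / (2 * √2)]

/-- The space group `Pn3m` (no. 224, origin at a point of site symmetry `-43m`).  In cubic
coordinates its elements are the signed coordinate permutations followed by a translation, which
is integral when the signs have product `1` (these signed permutations form the symmetry group of
a regular tetrahedron), and is in `(1/2,1/2,1/2) + ℤ³` otherwise. -/
def Pn3m : Set (E3 ≃ᵃⁱ[ℝ] E3) :=
  {g | ∃ (σ : Equiv.Perm (Fin 3)) (ε : Fin 3 → ℤˣ) (m : Fin 3 → ℤ), ∀ (x : E3) (i : Fin 3),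
    cubicCoord (g x) i =
      ((ε i : ℤ) : ℝ) * cubicCoord x (σ i) + (m i : ℝ) + if ∏ j, ε j = 1 then 0 else 1 / 2}

/-! ### Polyhedric tilings in the first-order class of (e2) -/

/-- `u` is the half-tangent unit vector at `v` of the arc `A` that ends at `v`. -/
def IsHalfTangent (A : Set E3) (v u : E3) : Prop :=
  Tendsto (fun x : E3 => ‖x - v‖⁻¹ • (x - v)) (𝓝[A \ {v}] v) (𝓝 u)

/-- `A` is a smooth regular simple arc from `v` to `w`, including its ends. -/
def IsSmoothArc (v w : E3) (A : Set E3) : Prop :=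
  ∃ γ : ℝ → E3, ContDiff ℝ ∞ γ ∧ (∀ t ∈ Set.Icc (0 : ℝ) 1, deriv γ t ≠ 0) ∧
    Set.InjOn γ (Set.Icc 0 1) ∧ γ '' Set.Icc 0 1 = A ∧ γ 0 = v ∧ γ 1 = w

/-- Near the point `x` the set `S` lies in a smooth embedded surface. -/
def IsSmoothSurfaceAt (S : Set E3) (x : E3) : Prop :=
  ∃ (U : Set E3) (f : E3 → ℝ), IsOpen U ∧ x ∈ U ∧ ContDiffOn ℝ ∞ f U ∧
    (∀ y ∈ U, fderiv ℝ f y ≠ 0) ∧ ∀ y ∈ S ∩ U, f y = 0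

/-- A polyhedric tiling with smooth edges and faces that agrees to first order with (e2): it has
the same combinatorial structure (it is the image of (e2) under a homeomorphism of space) and the
same nodes.  Its cells, faces and edges are the images of those of (e2); the edges are smooth up
to and including the nodes, the faces are smooth up to and including the edges, except at
the nodes, where they have their corners. -/
structure E2Tiling where
  toHomeo : E3 ≃ₜ E3
  map_node : ∀ v, IsNode v → toHomeo v = v
  smooth_edge : ∀ e v w, IsEdge e → IsNode v → IsNode w → v ∈ e → w ∈ e → v ≠ w →
    IsSmoothArc v w (toHomeo '' e)
  smooth_face : ∀ F, IsFace F → ∀ x ∈ toHomeo '' F, ¬ IsNode x →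
    IsSmoothSurfaceAt (toHomeo '' F) x

namespace E2Tiling

/-- The cell of the tiling that corresponds to the cell of (e2) with centre `c`. -/
def cell (M : E2Tiling) (c : E3) : Set E3 := M.toHomeo '' voronoiCell c

/-- `u` is the half-tangent at the node `v` of the edge of the tiling that corresponds to the
edge `e` of (e2). -/
def HalfTangent (M : E2Tiling) (e : Set E3) (v u : E3) : Prop :=
  IsHalfTangent (M.toHomeo '' e) v u

/-- Every cell is soft: at each of its nodes two of its edges have opposite half-tangents. -/
def IsSoft (M : E2Tiling) : Prop :=
  ∀ c ∈ bcc, ∀ v ∈ voronoiCell c, IsNode v →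
    ∃ e₁ e₂ u₁ u₂, IsEdge e₁ ∧ IsEdge e₂ ∧ e₁ ⊆ voronoiCell c ∧ e₂ ⊆ voronoiCell c ∧
      v ∈ e₁ ∧ v ∈ e₂ ∧ M.HalfTangent e₁ v u₁ ∧ M.HalfTangent e₂ v u₂ ∧ inner ℝ u₁ u₂ = -1

/-- Standard: at each node all half-tangents are collinear. -/
def IsStandard (M : E2Tiling) : Prop :=
  ∀ v e₁ e₂ u₁ u₂, IsNode v → IsEdge e₁ → IsEdge e₂ → v ∈ e₁ → v ∈ e₂ →
    M.HalfTangent e₁ v u₁ → M.HalfTangent e₂ v u₂ → u₁ = u₂ ∨ u₁ = -u₂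

/-- The space group of the tiling contains `Pn3m`. -/
def HasPn3mSymmetry (M : E2Tiling) : Prop :=
  ∀ g ∈ Pn3m, ∀ c ∈ bcc, ∃ c' ∈ bcc, g '' M.cell c = M.cell c'

/-- The second-order description (the system of half-tangents) is invariant under `Pn3m`. -/
def HasSecondOrderPn3mSymmetry (M : E2Tiling) : Prop :=
  ∀ g ∈ Pn3m, ∀ e v u, IsEdge e → IsNode v → v ∈ e →
    (M.HalfTangent e v u ↔ M.HalfTangent (g '' e) (g v) (g.linearIsometryEquiv u))

/-- Every cell has at least one planar face. -/
def HasPlanarFaces (M : E2Tiling) : Prop :=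
  ∀ c ∈ bcc, ∃ F, IsFace F ∧ F ⊆ voronoiCell c ∧
    ∃ (n : E3) (d : ℝ), n ≠ 0 ∧ ∀ x ∈ M.toHomeo '' F, inner ℝ n x = d

/-- Every cell has at least one face that is planar to second order: its nodes and the
half-tangents of its edges are in one plane. -/
def HasSecondOrderPlanarFaces (M : E2Tiling) : Prop :=
  ∀ c ∈ bcc, ∃ F, IsFace F ∧ F ⊆ voronoiCell c ∧
    ∃ (n : E3) (d : ℝ), n ≠ 0 ∧ (∀ v ∈ F, IsNode v → inner ℝ n v = d) ∧
      ∀ e v u, IsEdge e → e ⊆ F → IsNode v → v ∈ e → M.HalfTangent e v u → inner ℝ n u = 0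

/-- Each half-tangent makes an acute angle with the vector from its node to the other
node of its edge. -/
def LeavesForward (M : E2Tiling) : Prop :=
  ∀ e v w u, IsEdge e → IsNode v → IsNode w → v ∈ e → w ∈ e → v ≠ w →
    M.HalfTangent e v u → 0 < inner ℝ u (w - v)

/-- Some symmetry of (e2) carries the half-tangents of `M` to `s` times those of `N`. -/
def SameHalfTangents (s : ℝ) (M N : E2Tiling) : Prop :=
  ∃ g ∈ Im3m, ∀ e v u, IsEdge e → IsNode v → v ∈ e →
    (M.HalfTangent e v u ↔ N.HalfTangent (g '' e) (g v) (s • g.linearIsometryEquiv u))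

end E2Tiling

/-! ### Second-order classes -/

theorem Im3m.symm_mem {g : E3 ≃ᵃⁱ[ℝ] E3} (hg : g ∈ Im3m) : g.symm ∈ Im3m := by
  have h : g '' bcc = bcc := hg
  change g.symm '' bcc = bcc
  conv_lhs => rw [← h]
  rw [Set.image_image]
  simp

theorem Im3m.image_voronoiCell {g : E3 ≃ᵃⁱ[ℝ] E3} (hg : g ∈ Im3m) (x c : E3) :
    g x ∈ voronoiCell (g c) ↔ x ∈ voronoiCell c := by
  have h : g '' bcc = bcc := hg
  constructor
  · intro hx p hp
    have := hx (g p) (h ▸ Set.mem_image_of_mem g hp)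
    simpa using this
  · intro hx p hp
    rw [← h] at hp
    obtain ⟨q, hq, rfl⟩ := hp
    simpa using hx q hq

theorem Im3m.image_isStratum {g : E3 ≃ᵃⁱ[ℝ] E3} (hg : g ∈ Im3m) {k : ℕ} {S : Set E3}
    (hS : IsStratum k S) : IsStratum k (g '' S) := by
  have h : g '' bcc = bcc := hg
  obtain ⟨hne, s, hs, hk, rfl⟩ := hS
  refine ⟨hne.image g, g '' s, ?_, ?_, ?_⟩
  · rw [← h]
    exact Set.image_mono hs
  · rw [Set.ncard_image_of_injective s g.injective, hk]
  · ext y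
    obtain ⟨x, rfl⟩ := g.surjective y
    simp only [Set.mem_image, EmbeddingLike.apply_eq_iff_eq, exists_eq_right, Set.mem_iInter,
      forall_exists_index, and_imp, forall_apply_eq_imp_iff₂, Im3m.image_voronoiCell hg]

theorem Im3m.image_isNode {g : E3 ≃ᵃⁱ[ℝ] E3} (hg : g ∈ Im3m) {v : E3} (hv : IsNode v) :
    IsNode (g v) := by
  have := Im3m.image_isStratum hg hv
  rwa [Set.image_singleton] at this

/-- Two tilings are equivalent when they agree to second order up to a symmetry of (e2). -/
instance E2Tiling.secondOrderSetoid : Setoid E2Tiling where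
  r M N := E2Tiling.SameHalfTangents 1 M N
  iseqv := by
    refine ⟨fun M => ?_, fun {M N} => ?_, fun {M N P} => ?_⟩
    · refine ⟨AffineIsometryEquiv.refl ℝ E3, by simp [Im3m], fun e v u _ _ _ => ?_⟩
      have h : (AffineIsometryEquiv.refl ℝ E3).linearIsometryEquiv u = u := rfl
      simp [h]
    · rintro ⟨g, hg, H⟩
      refine ⟨g.symm, Im3m.symm_mem hg, fun e v u he hv hve => ?_⟩
      have hg' := Im3m.symm_mem hg
      have := H (g.symm '' e) (g.symm v) (g.symm.linearIsometryEquiv u)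
        (Im3m.image_isStratum hg' he) (Im3m.image_isNode hg' hv) (Set.mem_image_of_mem _ hve)
      have h : g.linearIsometryEquiv (g.symm.linearIsometryEquiv u) = u :=
        g.linearIsometryEquiv.apply_symm_apply u
      rw [Set.image_image] at this
      simpa [h] using this.symm
    · rintro ⟨g, hg, H⟩ ⟨k, hk, K⟩
      refine ⟨g.trans k, ?_, fun e v u he hv hve => ?_⟩
      · have h1 : g '' bcc = bcc := hg
        have h2 : k '' bcc = bcc := hk
        change (g.trans k) '' bcc = bcc
        rw [AffineIsometryEquiv.coe_trans, Set.image_comp, h1, h2]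
      · rw [H e v u he hv hve, K (g '' e) (g v) _ (Im3m.image_isStratum hg he)
          (Im3m.image_isNode hg hv) (Set.mem_image_of_mem _ hve), Set.image_image]
        have h : (g.trans k).linearIsometryEquiv u =
          k.linearIsometryEquiv (g.linearIsometryEquiv u) := rfl
        simp [h]

/-- The second-order classes in the first-order class of (e2). -/
abbrev SecondOrderClass : Type := Quotient E2Tiling.secondOrderSetoid

/-! ### The four classes and the great circles -/

inductive CellName
  | f2 | g2 | h2 | i2

/-- The half-tangent of the base edge at the origin, for each of the four classes. -/
noncomputable def CellName.vec : CellName → E3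
  | .f2 => !₂[1 / √2, 1 / √2, 0]
  | .g2 => !₂[1 / √2, -(1 / √2), 0]
  | .h2 => !₂[1 / 2, -(1 / 2), 1 / √2]
  | .i2 => !₂[√3 / 2, √3 / 6, 1 / √6]

/-- The great circle of the unit sphere with normal `n`. -/
def greatCircle (n : E3) : Set E3 := {a | ‖a‖ = 1 ∧ inner ℝ n a = 0}

noncomputable def gAbCd : Set E3 := greatCircle !₂[1 / √2, 1 / √2, 0]

noncomputable def gAcBd : Set E3 := greatCircle !₂[1 / 2, -(1 / 2), 1 / √2]

noncomputable def gAdBc : Set E3 := greatCircle !₂[-(1 / 2), 1 / 2, 1 / √2]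

noncomputable def gQuad : Set E3 := greatCircle !₂[0, 0, 1]

/-- The great circle in the direction of the plane of the hexagon through the base edge and the
node `(-1/2, -1/2, 1/√2)`. -/
noncomputable def gHex1 : Set E3 := greatCircle !₂[0, 2 / √6, √2 / √6]

/-- The great circle in the direction of the plane of the other hexagon at the base edge, through
the node `(-1/2, -1/2, -1/√2)`. -/
noncomputable def gHex2 : Set E3 := greatCircle !₂[0, 2 / √6, -(√2 / √6)]

/-- The reflection in the plane `z = 0`, a symmetry of (e2) that fixes the base edge. -/
def mirrorZ (a : E3) : E3 := !₂[a 0, a 1, -a 2]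

/-! In coordinates in which all cell centres are integral, `Pn3m` consists of the signed
permutations whose translation part has prescribed residues modulo 4 (`mem_Pn3m_iff`), so the
questions about this infinite group reduce to checks over the 48 signed permutations. Two facts
about it carry the proof. Every pair of an edge and an end node of it is the image of the base edge
and the origin (`exists_edge_flag`). The stabilizer of the origin consists of the identity and the
half-turns about three perpendicular axes (`stabilizer_origin`). Hence an invariant system of
half-tangents is the orbit of the single unit vector a (`halfTangent_flag_iff`), and the
classification is a question about a.

A half-turn sends a to -a exactly when a is orthogonal to its axis, and for each half-turn every
cell at a node contains two edges that it interchanges; this gives the three circles of soft tilings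
(`isSoft_iff`). Up to `Pn3m` there are three faces, all at the base edge. Such a face is planar to
second order exactly when a is parallel to its plane, because the elements of `Pn3m` that put the
base edge back into that plane preserve its direction (`hasSecondOrderPlanarFaces_iff`). The nine
pairs of circles meet in the four given vectors, their mirror images in z = 0, and the negatives of
these (`exists_of_mem_inter`). The mirror fixes the base edge and normalizes `Pn3m`, so mirror
images of a describe the same class (`sameHalfTangents_of_conj`). The cosine of the angle between
half-tangent and edge is an invariant up to the common sign; together with standardness it separates
the four classes (`cellName_unique`).

For existence, (e2) is deformed near the nodes only. If Q is an orthogonal projection that commutes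
with the stabilizer of the origin, the map that multiplies the Q-component of x by a smooth
increasing function of the distance, from 0 at the node to 1 at distance 1/3, is a smooth
homeomorphism. Off the node its derivative is invertible; at the node it is 1 - Q. Spread over all
nodes by `Pn3m` (`pinch`), it turns a into the normalized vector e - Q e, where e is the direction
of the base edge. Taking for Q the projection onto one of the axes, or its complement, yields all
four classes. The selected faces stay planar because at each of their nodes the axis used lies in
their plane.

True symmetry and true planarity imply their second-order versions: nodes are fixed and determine
the cells (`eq_of_antipodal_nodes`), and chords of a planar face stay in its plane. -/

/-! ### Cubic coordinates scaled by `4` -/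

/-- Cubic coordinates scaled by `4`, in which all cell centres and nodes are integral. -/
noncomputable def coord (x : E3) : Fin 3 → ℝ := ![x 0 + x 1 - 1, x 0 - x 1, √2 * x 2 - 2]

/-- The linear part of `coord`. -/
noncomputable def lcoord (x : E3) : Fin 3 → ℝ := ![x 0 + x 1, x 0 - x 1, √2 * x 2]

/-- The point with given scaled cubic coordinates. -/
noncomputable def ofCoord (y : Fin 3 → ℝ) : E3 :=
  !₂[(y 0 + y 1 + 1) / 2, (y 0 - y 1 + 1) / 2, √2 * (y 2 + 2) / 2]

theorem sqrt_two_sq : √2 * √2 = 2 := Real.mul_self_sqrt (by norm_num)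

theorem coord_ofCoord (y : Fin 3 → ℝ) : coord (ofCoord y) = y := by
  funext i
  fin_cases i <;> simp [coord, ofCoord]
  · ring
  · ring
  · linear_combination (y 2 + 2) / 2 * sqrt_two_sq

theorem ofCoord_coord (x : E3) : ofCoord (coord x) = x := by
  ext i
  fin_cases i <;> simp [coord, ofCoord]
  · ring
  · ring
  · rw [← mul_assoc, sqrt_two_sq]
    ring

theorem coord_injective : Function.Injective coord :=
  Function.LeftInverse.injective ofCoord_coord

theorem lcoord_injective : Function.Injective lcoord := by
  intro x y h
  apply coord_injective
  funext i
  have := congrFun h i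
  fin_cases i <;> simp [coord, lcoord] at this ⊢ <;> linarith

theorem coord_eq_cubicCoord (x : E3) (i : Fin 3) : coord x i = 4 * cubicCoord x i := by
  fin_cases i <;> simp [coord, cubicCoord]
  · ring
  · ring
  · have : √2 ≠ 0 := by positivity
    field_simp
    linear_combination 2 * x 2 * sqrt_two_sq

theorem lcoord_sub (x y : E3) (i : Fin 3) : lcoord (x - y) i = coord x i - coord y i := by
  fin_cases i <;> simp [coord, lcoord] <;> ring

theorem lcoord_add (x y : E3) (i : Fin 3) : lcoord (x + y) i = lcoord x i + lcoord y i := by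
  fin_cases i <;> simp [lcoord] <;> ring

theorem lcoord_smul (r : ℝ) (y : E3) (i : Fin 3) : lcoord (r • y) i = r * lcoord y i := by
  fin_cases i <;> simp [lcoord] <;> ring

theorem lcoord_neg (y : E3) (i : Fin 3) : lcoord (-y) i = -lcoord y i := by
  fin_cases i <;> simp [lcoord] <;> ring

/-- The scaled coordinate vectors are orthogonal of length 1/√2, which accounts for the factor 1/2.
-/
theorem inner_eq_lcoord (x y : E3) : inner ℝ x y = (∑ i, lcoord x i * lcoord y i) / 2 := by
  simp [PiLp.inner_apply, Fin.sum_univ_three, lcoord]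
  linear_combination (-(x 2) * y 2 / 2) * sqrt_two_sq

theorem dist_sq_eq_coord (x y : E3) : dist x y ^ 2 = (∑ i, (coord x i - coord y i) ^ 2) / 2 := by
  rw [dist_eq_norm, ← real_inner_self_eq_norm_sq, inner_eq_lcoord]
  simp [lcoord_sub, sq]

theorem dist_le_dist_iff_coord (x c p : E3) : dist x c ≤ dist x p ↔
    ∑ i, (coord x i - coord c i) ^ 2 ≤ ∑ i, (coord x i - coord p i) ^ 2 := by
  rw [← sq_le_sq₀ dist_nonneg dist_nonneg, dist_sq_eq_coord, dist_sq_eq_coord,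
    div_le_div_iff_of_pos_right (by norm_num)]

/-- `p` has the integral coordinates `x`. -/
def HasCoord (p : E3) (x : Fin 3 → ℤ) : Prop := ∀ i, coord p i = x i

theorem HasCoord.ofCoord (x : Fin 3 → ℤ) : HasCoord (ofCoord fun i => (x i : ℝ)) x := fun i => by
  rw [coord_ofCoord]

theorem HasCoord.eq {p q : E3} {x : Fin 3 → ℤ} (hp : HasCoord p x) (hq : HasCoord q x) : p = q :=
  coord_injective (funext fun i => by rw [hp, hq])

theorem HasCoord.ne {p q : E3} {x y : Fin 3 → ℤ} (hp : HasCoord p x) (hq : HasCoord q y)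
    (h : x ≠ y) : p ≠ q := by
  rintro rfl
  exact h (funext fun i => by exact_mod_cast (hp i).symm.trans (hq i))

theorem hasCoord_zero : HasCoord 0 ![-1, 0, -2] := by
  intro i; fin_cases i <;> simp [coord]

theorem hasCoord_e1 : HasCoord !₂[1, 0, 0] ![0, 1, -2] := by
  intro i; fin_cases i <;> simp [coord]

/-- The substitution (m + n, m - n, k - 1) turns the oddness of m + n + k into equality of the three
parities. -/
theorem mem_bcc_iff (p : E3) : p ∈ bcc ↔
    ∃ k : Fin 3 → ℤ, (∀ i j, k i % 2 = k j % 2) ∧ ∀ i, coord p i = 2 * k i := by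
  constructor
  · rintro ⟨m, n, k, h, rfl⟩
    rw [Int.odd_iff] at h
    refine ⟨![m + n, m - n, k - 1], ?_, ?_⟩
    · intro i j
      fin_cases i <;> fin_cases j <;> simp <;> omega
    · intro i
      fin_cases i <;> simp [coord]
      · ring
      · ring
      · linear_combination (k : ℝ) * sqrt_two_sq
  · rintro ⟨k, hk, h⟩
    have h01 := hk 0 1
    have h12 := hk 1 2
    refine ⟨(k 0 + k 1) / 2, (k 0 - k 1) / 2, k 2 + 1, ?_, ?_⟩
    · rw [Int.odd_iff]; omega
    · apply coord_injective
      have e1 : (((k 0 + k 1) / 2 : ℤ) : ℝ) * 2 = k 0 + k 1 := by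
        norm_cast; omega
      have e2 : (((k 0 - k 1) / 2 : ℤ) : ℝ) * 2 = k 0 - k 1 := by
        norm_cast; omega
      funext i
      rw [h i]
      fin_cases i <;> simp [coord]
      · linarith
      · linarith
      · linear_combination -((k 2 : ℝ) + 1) * sqrt_two_sq

/-! ### Isometries that act as signed permutations of the coordinates -/

/-- `g` is the signed permutation `(σ, ε)` followed by the translation `t`. -/
def IsSignedPerm (g : E3 ≃ᵃⁱ[ℝ] E3) (σ : Equiv.Perm (Fin 3)) (ε : Fin 3 → ℤˣ) (t : Fin 3 → ℤ) :
    Prop :=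
  ∀ x i, coord (g x) i = ((ε i : ℤ) : ℝ) * coord x (σ i) + t i

theorem units_sq (u : ℤˣ) : ((u : ℤ) : ℝ) * ((u : ℤ) : ℝ) = 1 := by
  rcases Int.units_eq_one_or u with h | h <;> simp [h]

/-- Such a map is invertible and preserves the sum of squared coordinate differences. A surjective
isometry of a real normed space is affine, so linearity need not be checked. -/
theorem exists_isSignedPerm (σ : Equiv.Perm (Fin 3)) (ε : Fin 3 → ℤˣ) (t : Fin 3 → ℤ) :
    ∃ g, IsSignedPerm g σ ε t := by
  let f : E3 → E3 := fun x => ofCoord fun i => ((ε i : ℤ) : ℝ) * coord x (σ i) + t i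
  let f' : E3 → E3 := fun x => ofCoord fun i =>
    ((ε (σ.symm i) : ℤ) : ℝ) * (coord x (σ.symm i) - t (σ.symm i))
  have hff' : ∀ x, f (f' x) = x := by
    intro x
    apply coord_injective
    funext i
    simp only [f, f', coord_ofCoord, Equiv.symm_apply_apply]
    linear_combination (coord x i - t i) * units_sq (ε i)
  have hf : Isometry f := by
    refine Isometry.of_dist_eq fun x y => ?_
    rw [← sq_eq_sq₀ dist_nonneg dist_nonneg, dist_sq_eq_coord, dist_sq_eq_coord,
      ← Equiv.sum_comp σ (fun i => (coord x i - coord y i) ^ 2)]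
    congr 1
    refine Finset.sum_congr rfl fun i _ => ?_
    simp only [f, coord_ofCoord]
    linear_combination (coord x (σ i) - coord y (σ i)) ^ 2 * units_sq (ε i)
  refine ⟨(IsometryEquiv.mk' f f' hff' hf).toRealAffineIsometryEquiv, fun x i => ?_⟩
  change coord (f x) i = _
  simp [f, coord_ofCoord]

theorem linear_eq_sub (g : E3 ≃ᵃⁱ[ℝ] E3) (x y : E3) :
    g.linearIsometryEquiv (x - y) = g x - g y := g.map_vsub x y

namespace IsSignedPerm

variable {g h : E3 ≃ᵃⁱ[ℝ] E3} {σ τ : Equiv.Perm (Fin 3)} {ε δ : Fin 3 → ℤˣ} {t s : Fin 3 → ℤ}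

theorem lcoord (H : IsSignedPerm g σ ε t) (v : E3) (i : Fin 3) :
    lcoord (g.linearIsometryEquiv v) i = ((ε i : ℤ) : ℝ) * _root_.lcoord v (σ i) := by
  have h1 := linear_eq_sub g v 0
  rw [sub_zero] at h1
  have h2 := lcoord_sub v 0 (σ i)
  rw [sub_zero] at h2
  rw [h1, lcoord_sub, H, H, h2]
  ring

theorem trans (H : IsSignedPerm g σ ε t) (K : IsSignedPerm h τ δ s) :
    IsSignedPerm (g.trans h) (τ.trans σ) (fun i => δ i * ε (τ i))
      (fun i => δ i * t (τ i) + s i) := by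
  intro x i
  rw [AffineIsometryEquiv.coe_trans, Function.comp_apply, K, H]
  push_cast [Equiv.trans_apply]
  ring

theorem symm (H : IsSignedPerm g σ ε t) :
    IsSignedPerm g.symm σ.symm (fun i => ε (σ.symm i))
      (fun i => -(ε (σ.symm i) * t (σ.symm i))) := by
  intro x i
  have := H (g.symm x) (σ.symm i)
  rw [AffineIsometryEquiv.apply_symm_apply, Equiv.apply_symm_apply] at this
  rw [this]
  push_cast
  linear_combination -coord (g.symm x) i * units_sq (ε (σ.symm i))

theorem ext (H : IsSignedPerm g σ ε t) (K : IsSignedPerm h σ ε t) (x : E3) : g x = h x :=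
  coord_injective (funext fun i => by rw [H, K])

end IsSignedPerm

/-- The form in which `Pn3m` is used: only residues modulo 4 of the translation matter, and the
signs fix them. Statements about `Pn3m` thereby become accessible to `decide`. -/
theorem mem_Pn3m_iff (g : E3 ≃ᵃⁱ[ℝ] E3) : g ∈ Pn3m ↔ ∃ σ ε t, IsSignedPerm g σ ε t ∧
    ∀ i, t i % 4 = if ∏ j, ε j = 1 then 0 else 2 := by
  constructor
  · rintro ⟨σ, ε, m, h⟩
    refine ⟨σ, ε, fun i => 4 * m i + if ∏ j, ε j = 1 then 0 else 2, fun x i => ?_, fun i => ?_⟩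
    · rw [coord_eq_cubicCoord, h, coord_eq_cubicCoord]
      split_ifs <;> push_cast <;> ring
    · dsimp only
      split_ifs <;> omega
  · rintro ⟨σ, ε, t, H, h⟩
    refine ⟨σ, ε, fun i => t i / 4, fun x i => ?_⟩
    have h1 := H x i
    have h2 : (t i : ℝ) = 4 * ((t i / 4 : ℤ) : ℝ) + if ∏ j, ε j = 1 then 0 else 2 := by
      have := h i
      split_ifs at this ⊢ <;> norm_cast <;> omega
    rw [coord_eq_cubicCoord, coord_eq_cubicCoord, h2] at h1
    split_ifs at h1 ⊢ <;> linarith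

theorem Pn3m.trans_mem {g h : E3 ≃ᵃⁱ[ℝ] E3} (hg : g ∈ Pn3m) (hh : h ∈ Pn3m) :
    g.trans h ∈ Pn3m := by
  rw [mem_Pn3m_iff] at *
  obtain ⟨σ, ε, t, H, ht⟩ := hg
  obtain ⟨τ, δ, s, K, hs⟩ := hh
  refine ⟨_, _, _, H.trans K, fun i => ?_⟩
  have e : ∏ j, δ j * ε (τ j) = (∏ j, δ j) * ∏ j, ε j := by
    rw [Finset.prod_mul_distrib, Equiv.prod_comp τ]
  rw [e]
  have h1 := ht (τ i)
  have h2 := hs i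
  rcases Int.units_eq_one_or (∏ j, δ j) with a | a <;>
  rcases Int.units_eq_one_or (∏ j, ε j) with b | b <;>
  rcases Int.units_eq_one_or (δ i) with c | c <;>
  simp [a, b, c] at h1 h2 ⊢ <;> omega

theorem Pn3m.symm_mem {g : E3 ≃ᵃⁱ[ℝ] E3} (hg : g ∈ Pn3m) : g.symm ∈ Pn3m := by
  rw [mem_Pn3m_iff] at *
  obtain ⟨σ, ε, t, H, ht⟩ := hg
  refine ⟨_, _, _, H.symm, fun i => ?_⟩
  have e : ∏ j, ε (σ.symm j) = ∏ j, ε j := Equiv.prod_comp σ.symm _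
  rw [e]
  have h1 := ht (σ.symm i)
  rcases Int.units_eq_one_or (∏ j, ε j) with b | b <;>
  rcases Int.units_eq_one_or (ε (σ.symm i)) with c | c <;>
  simp [b, c] at h1 ⊢ <;> omega

theorem Pn3m.refl_mem : AffineIsometryEquiv.refl ℝ E3 ∈ Pn3m := by
  rw [mem_Pn3m_iff]
  exact ⟨1, 1, 0, fun x i => by simp, fun i => by simp⟩

theorem Pn3m.exists_of {σ : Equiv.Perm (Fin 3)} {ε : Fin 3 → ℤˣ} {t : Fin 3 → ℤ}
    (h : ∀ i, t i % 4 = if ∏ j, ε j = 1 then 0 else 2) : ∃ g ∈ Pn3m, IsSignedPerm g σ ε t := by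
  obtain ⟨g, hg⟩ := exists_isSignedPerm σ ε t
  exact ⟨g, (mem_Pn3m_iff g).2 ⟨σ, ε, t, hg, h⟩, hg⟩

theorem IsSignedPerm.map_bcc {g : E3 ≃ᵃⁱ[ℝ] E3} {σ : Equiv.Perm (Fin 3)} {ε : Fin 3 → ℤˣ}
    {t : Fin 3 → ℤ} (H : IsSignedPerm g σ ε t) (s : Fin 3 → ℤ)
    (hs : ∀ i, t i = 2 * s i) (hs' : ∀ i j, s i % 2 = s j % 2) {c : E3} (hc : c ∈ bcc) :
    g c ∈ bcc := by
  rw [mem_bcc_iff] at *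
  obtain ⟨k, hk, h⟩ := hc
  refine ⟨fun i => ε i * k (σ i) + s i, fun i j => ?_, fun i => ?_⟩
  · have h1 := hk (σ i) (σ j)
    have h2 := hs' i j
    dsimp only
    rcases Int.units_eq_one_or (ε i) with a | a <;>
    rcases Int.units_eq_one_or (ε j) with b | b <;> simp [a, b] <;> omega
  · rw [H, h, hs]
    push_cast
    ring

theorem Pn3m.map_bcc {g : E3 ≃ᵃⁱ[ℝ] E3} (hg : g ∈ Pn3m) {c : E3} (hc : c ∈ bcc) : g c ∈ bcc := by
  obtain ⟨σ, ε, t, H, ht⟩ := (mem_Pn3m_iff g).1 hg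
  refine H.map_bcc (fun i => t i / 2) (fun i => ?_) (fun i j => ?_) hc
  · have := ht i
    split_ifs at this <;> omega
  · have h1 := ht i
    have h2 := ht j
    split_ifs at h1 h2 <;> omega

theorem Pn3m_subset_Im3m : Pn3m ⊆ Im3m := by
  intro g hg
  change g '' bcc = bcc
  refine Set.Subset.antisymm ?_ fun c hc => ?_
  · rintro _ ⟨c, hc, rfl⟩
    exact Pn3m.map_bcc hg hc
  · exact ⟨g.symm c, Pn3m.map_bcc (Pn3m.symm_mem hg) hc, by simp⟩

/-! ### The four cells at the origin -/

/-- The base edge is common to the cells of `cA`, `cB`, `cC`; `cD` is the centre of the cell at the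
origin that does not contain it. -/
noncomputable def cA : E3 := ofCoord fun i => ((![0, 0, 0] : Fin 3 → ℤ) i : ℝ)
noncomputable def cB : E3 := ofCoord fun i => ((![0, 0, -4] : Fin 3 → ℤ) i : ℝ)
noncomputable def cC : E3 := ofCoord fun i => ((![-2, 2, -2] : Fin 3 → ℤ) i : ℝ)
noncomputable def cD : E3 := ofCoord fun i => ((![-2, -2, -2] : Fin 3 → ℤ) i : ℝ)

theorem hasCoord_cA : HasCoord cA ![0, 0, 0] := HasCoord.ofCoord _
theorem hasCoord_cB : HasCoord cB ![0, 0, -4] := HasCoord.ofCoord _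
theorem hasCoord_cC : HasCoord cC ![-2, 2, -2] := HasCoord.ofCoord _
theorem hasCoord_cD : HasCoord cD ![-2, -2, -2] := HasCoord.ofCoord _

theorem HasCoord.mem_bcc {p : E3} {x : Fin 3 → ℤ} (hp : HasCoord p x) (k : Fin 3 → ℤ)
    (h : (∀ i j, k i % 2 = k j % 2) ∧ ∀ i, x i = 2 * k i) : p ∈ bcc :=
  (mem_bcc_iff p).2 ⟨k, h.1, fun i => by rw [hp, h.2]; push_cast; rfl⟩

theorem cA_mem : cA ∈ bcc := hasCoord_cA.mem_bcc ![0, 0, 0] (by decide)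
theorem cB_mem : cB ∈ bcc := hasCoord_cB.mem_bcc ![0, 0, -2] (by decide)
theorem cC_mem : cC ∈ bcc := hasCoord_cC.mem_bcc ![-1, 1, -1] (by decide)
theorem cD_mem : cD ∈ bcc := hasCoord_cD.mem_bcc ![-1, -1, -1] (by decide)

/-- The centres of the four cells at the origin. -/
noncomputable def originCentres : Finset E3 := {cA, cB, cC, cD}

theorem mem_originCentres {c : E3} :
    c ∈ originCentres ↔ c = cA ∨ c = cB ∨ c = cC ∨ c = cD := by
  simp [originCentres]

theorem originCentres_subset {c : E3} (hc : c ∈ originCentres) : c ∈ bcc := by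
  rcases mem_originCentres.1 hc with rfl | rfl | rfl | rfl
  exacts [cA_mem, cB_mem, cC_mem, cD_mem]

theorem cA_ne_cB : cA ≠ cB := hasCoord_cA.ne hasCoord_cB (by decide)
theorem cA_ne_cC : cA ≠ cC := hasCoord_cA.ne hasCoord_cC (by decide)
theorem cA_ne_cD : cA ≠ cD := hasCoord_cA.ne hasCoord_cD (by decide)
theorem cB_ne_cC : cB ≠ cC := hasCoord_cB.ne hasCoord_cC (by decide)
theorem cB_ne_cD : cB ≠ cD := hasCoord_cB.ne hasCoord_cD (by decide)
theorem cC_ne_cD : cC ≠ cD := hasCoord_cC.ne hasCoord_cD (by decide)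

theorem card_originCentres : originCentres.card = 4 := by
  rw [originCentres, Finset.card_insert_of_notMem, Finset.card_insert_of_notMem,
    Finset.card_insert_of_notMem, Finset.card_singleton] <;>
  simp [cA_ne_cB, cA_ne_cC, cA_ne_cD, cB_ne_cC, cB_ne_cD, cC_ne_cD]

theorem IsSignedPerm.hasCoord {g : E3 ≃ᵃⁱ[ℝ] E3} {σ : Equiv.Perm (Fin 3)} {ε : Fin 3 → ℤˣ}
    {t : Fin 3 → ℤ} (H : IsSignedPerm g σ ε t) {p : E3} {x : Fin 3 → ℤ} (hp : HasCoord p x) :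
    HasCoord (g p) fun i => ε i * x (σ i) + t i := fun i => by
  rw [H, hp]; push_cast; rfl

theorem IsSignedPerm.apply_eq {g : E3 ≃ᵃⁱ[ℝ] E3} {σ : Equiv.Perm (Fin 3)} {ε : Fin 3 → ℤˣ}
    {t : Fin 3 → ℤ} (H : IsSignedPerm g σ ε t) {p q : E3} {x y : Fin 3 → ℤ} (hp : HasCoord p x)
    (hq : HasCoord q y) (h : ∀ i, ε i * x (σ i) + t i = y i) : g p = q :=
  (H.hasCoord hp).eq fun i => by rw [hq, ← h]

/-! ### The stabilizer of the origin and the flip of the base edge -/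

/-- The three half-turns about the origin. Each acts on the four cells there as a double
transposition: U as (AB)(CD), P as (AC)(BD), Q as (AD)(BC). -/
theorem exists_rotU : ∃ g ∈ Pn3m, IsSignedPerm g 1 ![1, -1, -1] ![0, 0, -4] :=
  Pn3m.exists_of (by decide)

theorem exists_rotP : ∃ g ∈ Pn3m, IsSignedPerm g (Equiv.swap 1 2) ![-1, 1, 1] ![-2, 2, -2] :=
  Pn3m.exists_of (by decide)

theorem exists_rotQ : ∃ g ∈ Pn3m, IsSignedPerm g (Equiv.swap 1 2) ![-1, -1, -1] ![-2, -2, -2] :=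
  Pn3m.exists_of (by decide)

/-- The reflection in the plane that bisects the base edge perpendicularly; it interchanges the two
ends. -/
theorem exists_flip : ∃ g ∈ Pn3m, IsSignedPerm g (Equiv.swap 0 1) ![-1, -1, 1] ![0, 0, 0] :=
  Pn3m.exists_of (by decide)

noncomputable def rotU : E3 ≃ᵃⁱ[ℝ] E3 := exists_rotU.choose
noncomputable def rotP : E3 ≃ᵃⁱ[ℝ] E3 := exists_rotP.choose
noncomputable def rotQ : E3 ≃ᵃⁱ[ℝ] E3 := exists_rotQ.choose
noncomputable def edgeFlip : E3 ≃ᵃⁱ[ℝ] E3 := exists_flip.choose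

theorem rotU_mem : rotU ∈ Pn3m := exists_rotU.choose_spec.1
theorem rotP_mem : rotP ∈ Pn3m := exists_rotP.choose_spec.1
theorem rotQ_mem : rotQ ∈ Pn3m := exists_rotQ.choose_spec.1
theorem edgeFlip_mem : edgeFlip ∈ Pn3m := exists_flip.choose_spec.1
theorem rotU_spec : IsSignedPerm rotU 1 ![1, -1, -1] ![0, 0, -4] := exists_rotU.choose_spec.2
theorem rotP_spec : IsSignedPerm rotP (Equiv.swap 1 2) ![-1, 1, 1] ![-2, 2, -2] :=
  exists_rotP.choose_spec.2
theorem rotQ_spec : IsSignedPerm rotQ (Equiv.swap 1 2) ![-1, -1, -1] ![-2, -2, -2] :=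
  exists_rotQ.choose_spec.2
theorem edgeFlip_spec : IsSignedPerm edgeFlip (Equiv.swap 0 1) ![-1, -1, 1] ![0, 0, 0] :=
  exists_flip.choose_spec.2

theorem rotU_zero : rotU 0 = 0 :=
  rotU_spec.apply_eq hasCoord_zero hasCoord_zero (by decide)
theorem rotP_zero : rotP 0 = 0 :=
  rotP_spec.apply_eq hasCoord_zero hasCoord_zero (by decide)
theorem rotQ_zero : rotQ 0 = 0 :=
  rotQ_spec.apply_eq hasCoord_zero hasCoord_zero (by decide)
theorem edgeFlip_zero : edgeFlip 0 = !₂[1, 0, 0] :=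
  edgeFlip_spec.apply_eq hasCoord_zero hasCoord_e1 (by decide)
theorem edgeFlip_e1 : edgeFlip !₂[1, 0, 0] = 0 :=
  edgeFlip_spec.apply_eq hasCoord_e1 hasCoord_zero (by decide)
theorem rotU_cA : rotU cA = cB :=
  rotU_spec.apply_eq hasCoord_cA hasCoord_cB (by decide)
theorem rotU_cB : rotU cB = cA :=
  rotU_spec.apply_eq hasCoord_cB hasCoord_cA (by decide)
theorem rotU_cC : rotU cC = cD :=
  rotU_spec.apply_eq hasCoord_cC hasCoord_cD (by decide)
theorem rotU_cD : rotU cD = cC :=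
  rotU_spec.apply_eq hasCoord_cD hasCoord_cC (by decide)
theorem rotP_cA : rotP cA = cC :=
  rotP_spec.apply_eq hasCoord_cA hasCoord_cC (by decide)
theorem rotP_cB : rotP cB = cD :=
  rotP_spec.apply_eq hasCoord_cB hasCoord_cD (by decide)
theorem rotP_cC : rotP cC = cA :=
  rotP_spec.apply_eq hasCoord_cC hasCoord_cA (by decide)
theorem rotP_cD : rotP cD = cB :=
  rotP_spec.apply_eq hasCoord_cD hasCoord_cB (by decide)
theorem rotQ_cA : rotQ cA = cD :=
  rotQ_spec.apply_eq hasCoord_cA hasCoord_cD (by decide)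
theorem rotQ_cB : rotQ cB = cC :=
  rotQ_spec.apply_eq hasCoord_cB hasCoord_cC (by decide)
theorem rotQ_cC : rotQ cC = cB :=
  rotQ_spec.apply_eq hasCoord_cC hasCoord_cB (by decide)
theorem rotQ_cD : rotQ cD = cA :=
  rotQ_spec.apply_eq hasCoord_cD hasCoord_cA (by decide)

/-! ### Reduction to a fundamental domain -/

theorem Pn3m.exists_map_eq_cA {c : E3} (hc : c ∈ bcc) : ∃ g ∈ Pn3m, g c = cA := by
  obtain ⟨k, hk, h⟩ := (mem_bcc_iff c).1 hc
  have h01 := hk 0 1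
  have h12 := hk 1 2
  have hc' : HasCoord c fun i => 2 * k i := fun i => by rw [h]; push_cast; rfl
  rcases Int.emod_two_eq_zero_or_one (k 0) with h0 | h0
  · obtain ⟨g, hg, H⟩ := Pn3m.exists_of (σ := 1) (ε := 1) (t := fun i => -2 * k i) (by
      intro i; fin_cases i <;> simp <;> omega)
    exact ⟨g, hg, H.apply_eq hc' hasCoord_cA fun i => by fin_cases i <;> simp⟩
  -- A centre of odd type differs from `cA` by a translation outside `Pn3m`. A point reflection,
  -- whose signs have product -1, requires exactly the residues 2 that are available here.
  · obtain ⟨g, hg, H⟩ := Pn3m.exists_of (σ := 1) (ε := -1) (t := fun i => 2 * k i) (by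
      have : ¬ ∏ j : Fin 3, (-1 : Fin 3 → ℤˣ) j = 1 := by decide
      intro i; rw [if_neg this]; fin_cases i <;> simp <;> omega)
    exact ⟨g, hg, H.apply_eq hc' hasCoord_cA fun i => by fin_cases i <;> simp⟩

theorem exists_sign_mul_eq_abs (r : ℝ) : ∃ s : ℤˣ, ((s : ℤ) : ℝ) * r = |r| := by
  rcases abs_choice r with h | h
  · exact ⟨1, by simp [h]⟩
  · exact ⟨-1, by simp [h]⟩

/-- Sort the coordinates by absolute value and make the first two nonnegative. The third sign is
then forced by the condition on the product, so the third coordinate is controlled only in absolute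
value. This is the fundamental chamber of the tetrahedral group. -/
theorem exists_sorted_signedPerm (y : Fin 3 → ℝ) : ∃ (σ : Equiv.Perm (Fin 3)) (ε : Fin 3 → ℤˣ),
    ∏ i, ε i = 1 ∧ ((ε 1 : ℤ) : ℝ) * y (σ 1) ≤ ((ε 0 : ℤ) : ℝ) * y (σ 0) ∧
      |((ε 2 : ℤ) : ℝ) * y (σ 2)| ≤ ((ε 1 : ℤ) : ℝ) * y (σ 1) := by
  have hm := Tuple.monotone_sort fun i => -|y i|
  set σ := Tuple.sort fun i => -|y i|
  have h01 : |y (σ 1)| ≤ |y (σ 0)| := neg_le_neg_iff.1 (hm (show (0 : Fin 3) ≤ 1 by decide))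
  have h12 : |y (σ 2)| ≤ |y (σ 1)| := neg_le_neg_iff.1 (hm (show (1 : Fin 3) ≤ 2 by decide))
  obtain ⟨s0, h0⟩ := exists_sign_mul_eq_abs (y (σ 0))
  obtain ⟨s1, h1⟩ := exists_sign_mul_eq_abs (y (σ 1))
  refine ⟨σ, ![s0, s1, s0 * s1], ?_, ?_, ?_⟩
  · rw [Fin.prod_univ_three]
    simp only [Matrix.cons_val]
    rcases Int.units_eq_one_or s0 with rfl | rfl <;>
    rcases Int.units_eq_one_or s1 with rfl | rfl <;> rfl
  · simpa [h0, h1] using h01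
  · have : |(((s0 * s1 : ℤˣ) : ℤ) : ℝ) * y (σ 2)| = |y (σ 2)| := by
      rcases Int.units_eq_one_or (s0 * s1) with h | h <;> simp [h]
    simpa only [Matrix.cons_val, this, h1] using h12

theorem Pn3m.exists_sorted (x : E3) {c : E3} (hc : c ∈ bcc) : ∃ g ∈ Pn3m, g c = cA ∧
    coord (g x) 1 ≤ coord (g x) 0 ∧ |coord (g x) 2| ≤ coord (g x) 1 := by
  obtain ⟨g, hg, hgc⟩ := Pn3m.exists_map_eq_cA hc
  obtain ⟨σ, ε, hε, h⟩ := exists_sorted_signedPerm (coord (g x))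
  obtain ⟨k, hk, K⟩ := Pn3m.exists_of (σ := σ) (ε := ε) (t := 0) (by simp [hε])
  refine ⟨g.trans k, Pn3m.trans_mem hg hk, ?_, ?_⟩
  · rw [AffineIsometryEquiv.coe_trans, Function.comp_apply, hgc]
    refine K.apply_eq hasCoord_cA hasCoord_cA fun i => ?_
    have : ∀ j, (![0, 0, 0] : Fin 3 → ℤ) j = 0 := by decide
    simp [this]
  · simpa only [AffineIsometryEquiv.coe_trans, Function.comp_apply, K _ _, Pi.zero_apply,
      Int.cast_zero, add_zero] using h

/-- The hypotheses bound the three coordinates by 2, 3/2 and 1. For an integer m and |w| ≤ B one has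
m w ≤ B m², so the second and third terms leave a positive slack unless b and c vanish; then 2a² ≤ a
x with x ≤ 2 leaves a = 0 or 1. -/
theorem even_centre_bound {a b c : ℤ} {x y z : ℝ} (hxy : y ≤ x) (hyz : |z| ≤ y) (hx : x ≤ 2)
    (hs : x + y + |z| ≤ 3) (h : 2 * ((a : ℝ) ^ 2 + b ^ 2 + c ^ 2) ≤ a * x + b * y + c * z) :
    (a = 0 ∨ a = 1) ∧ b = 0 ∧ c = 0 := by
  have key : ∀ (m : ℤ) (w B : ℝ), |w| ≤ B → (m : ℝ) * w ≤ B * (m : ℝ) ^ 2 := by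
    intro m w B hw
    have h1 : |(m : ℝ)| ≤ (m : ℝ) ^ 2 := by
      rw [← sq_abs]
      rcases eq_or_ne m 0 with rfl | hm
      · simp
      · have : (1 : ℝ) ≤ |(m : ℝ)| := by exact_mod_cast Int.one_le_abs hm
        nlinarith
    have h2 : (m : ℝ) * w ≤ |(m : ℝ)| * |w| := by rw [← abs_mul]; exact le_abs_self _
    nlinarith [abs_nonneg w, abs_nonneg (m : ℝ)]
  have hz := abs_nonneg z
  have ka := key a x 2 (abs_le.2 ⟨by linarith, hx⟩)
  have kb := key b y (3 / 2) (abs_le.2 ⟨by linarith, by linarith⟩)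
  have kc := key c z 1 (by linarith)
  have hb : (b : ℝ) ^ 2 ≤ 0 := by nlinarith [sq_nonneg (c : ℝ)]
  have hc : (c : ℝ) ^ 2 ≤ 0 := by nlinarith [sq_nonneg (b : ℝ)]
  have hb0 : (b : ℝ) = 0 := by nlinarith [sq_nonneg (b : ℝ)]
  have hc0 : (c : ℝ) = 0 := by nlinarith [sq_nonneg (c : ℝ)]
  refine ⟨?_, by exact_mod_cast hb0, by exact_mod_cast hc0⟩
  rw [hb0, hc0] at h
  by_contra! hn
  rcases lt_or_gt_of_ne hn.1 with h1 | h1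
  · have : (a : ℝ) < 0 := by exact_mod_cast h1
    nlinarith
  · have h2 : (2 : ℤ) ≤ a := by have := hn.2; omega
    have : (2 : ℝ) ≤ a := by exact_mod_cast h2
    nlinarith

/-- For odd m and 0 ≤ w ≤ 2, m² - m w - (1 - w) = (m - 1)(m + 1 - w) is nonnegative. Summing, the
hypothesis can hold only with x + y + |z| = 3 and equality in all three terms. -/
theorem odd_centre_bound {a b c : ℤ} {x y z : ℝ} (ha : a % 2 = 1) (hb : b % 2 = 1)
    (hc : c % 2 = 1) (hxy : y ≤ x) (hyz : |z| ≤ y) (hx : x ≤ 2) (hs : x + y + |z| ≤ 3)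
    (h : (a : ℝ) ^ 2 + b ^ 2 + c ^ 2 ≤ a * x + b * y + c * z) :
    a = 1 ∧ b = 1 ∧ (c = 1 ∨ c = -1) := by
  have key : ∀ (m : ℤ) (w : ℝ), m % 2 = 1 → 0 ≤ w → w ≤ 2 →
      0 ≤ (m : ℝ) ^ 2 - m * w - 1 + w ∧ ((m : ℝ) ^ 2 - m * w - 1 + w ≤ 0 → 0 < w → m = 1) := by
    intro m w hm h0 h2
    have e : (m : ℝ) ^ 2 - m * w - 1 + w = (m - 1) * (m + 1 - w) := by ring
    rw [e]
    rcases lt_trichotomy m 1 with h | h | h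
    · have h' : m ≤ -1 := by omega
      have : (m : ℝ) ≤ -1 := by exact_mod_cast h'
      constructor
      · nlinarith
      · intro h3 h4
        nlinarith
    · simp [h]
    · have h' : 2 ≤ m := by omega
      have : (2 : ℝ) ≤ m := by exact_mod_cast h'
      constructor
      · nlinarith
      · intro h3 h4
        nlinarith
  have hz := abs_nonneg z
  have ka := key a x ha (by linarith) hx
  have kb := key b y hb (by linarith) (by linarith)
  have hcz : (c : ℝ) * z ≤ |(c : ℝ)| * |z| := by rw [← abs_mul]; exact le_abs_self _
  have kc := key |c| |z| (by rcases abs_choice c with h | h <;> rw [h] <;> omega) hz (by linarith)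
  push_cast at kc
  rw [sq_abs] at kc
  have hc1 : (1 : ℝ) ≤ |(c : ℝ)| := by
    exact_mod_cast Int.one_le_abs (show c ≠ 0 by rintro rfl; simp at hc)
  refine ⟨ka.2 (by linarith [kb.1, kc.1]) (by linarith [ka.1, kb.1, kc.1]),
    kb.2 (by linarith [ka.1, kc.1]) (by linarith [ka.1, kb.1, kc.1]), ?_⟩
  by_contra! hn
  have h2 : 2 ≤ |c| := by
    rw [le_abs]
    have := hn.1
    have := hn.2
    omega
  have h3 : (2 : ℝ) ≤ |(c : ℝ)| := by exact_mod_cast h2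
  have h4 : (c : ℝ) ^ 2 = |(c : ℝ)| ^ 2 := (sq_abs _).symm
  nlinarith [ka.1, kb.1]

/-- In the fundamental chamber the cell of `cA` is cut out by a square face, x₀ ≤ 2, and two
hexagonal faces, x₀ + x₁ ± x₂ ≤ 3. Only the cells behind these faces can share a point of the
chamber with it. Centres of equal type and of opposite type are treated by the two bounds above. -/
theorem centres_of_sorted {x : E3} (h01 : coord x 1 ≤ coord x 0) (h12 : |coord x 2| ≤ coord x 1)
    (hA : x ∈ voronoiCell cA) {p : E3} (hp : p ∈ bcc) (hxp : x ∈ voronoiCell p) :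
    HasCoord p ![0, 0, 0] ∨ HasCoord p ![4, 0, 0] ∨ HasCoord p ![2, 2, 2] ∨
      HasCoord p ![2, 2, -2] := by
  obtain ⟨k, hk, h⟩ := (mem_bcc_iff p).1 hp
  have hb : ∀ y : Fin 3 → ℤ, (∃ k : Fin 3 → ℤ, (∀ i j, k i % 2 = k j % 2) ∧ ∀ i, y i = 2 * k i) →
      ∑ i, coord x i ^ 2 ≤ ∑ i, (coord x i - y i) ^ 2 := by
    rintro y ⟨k, hk⟩
    have := (dist_le_dist_iff_coord _ _ _).1 (hA _ ((HasCoord.ofCoord y).mem_bcc k hk))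
    have e : ∀ j, (![0, 0, 0] : Fin 3 → ℤ) j = 0 := by decide
    simpa only [hasCoord_cA _, HasCoord.ofCoord y _, e, Int.cast_zero, sub_zero] using this
  have b1 := hb ![4, 0, 0] ⟨![2, 0, 0], by decide⟩
  have b2 := hb ![2, 2, 2] ⟨![1, 1, 1], by decide⟩
  have b3 := hb ![2, 2, -2] ⟨![1, 1, -1], by decide⟩
  have b4 := (dist_le_dist_iff_coord _ _ _).1 (hxp _ cA_mem)
  simp only [hasCoord_cA _, h, Fin.sum_univ_three, Matrix.cons_val] at b1 b2 b3 b4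
  push_cast at b1 b2 b3 b4
  have hx : coord x 0 ≤ 2 := by nlinarith
  have hs : coord x 0 + coord x 1 + |coord x 2| ≤ 3 := by
    rcases abs_choice (coord x 2) with h | h <;> rw [h] <;> nlinarith
  have k01 := hk 0 1
  have k12 := hk 1 2
  rcases Int.emod_two_eq_zero_or_one (k 0) with h0 | h0
  · obtain ⟨a, ha⟩ : ∃ a, k 0 = 2 * a := ⟨k 0 / 2, by omega⟩
    obtain ⟨b, hb⟩ : ∃ a, k 1 = 2 * a := ⟨k 1 / 2, by omega⟩
    obtain ⟨c, hc⟩ : ∃ a, k 2 = 2 * a := ⟨k 2 / 2, by omega⟩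
    rw [ha, hb, hc] at b4
    push_cast at b4
    obtain ⟨h1, rfl, rfl⟩ := even_centre_bound (a := a) (b := b) (c := c) h01 h12 hx hs (by
      nlinarith)
    rcases h1 with rfl | rfl
    · left
      intro i
      rw [h]
      fin_cases i <;> simp [ha, hb, hc]
    · right; left
      intro i
      rw [h]
      fin_cases i <;> simp [ha, hb, hc]
      norm_num
  · obtain ⟨h1, h2, h3⟩ := odd_centre_bound (a := k 0) (b := k 1) (c := k 2) h0 (by omega)
      (by omega) h01 h12 hx hs (by nlinarith)
    right; right
    rcases h3 with h3 | h3
    · left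
      intro i
      rw [h]
      fin_cases i <;> simp [h1, h2, h3]
    · right
      intro i
      rw [h]
      fin_cases i <;> simp [h1, h2, h3]

/-- Up to `Pn3m`, cells with a common point are among the four cells at the origin. -/
theorem exists_map_mem_originCentres (x : E3) :
    ∃ g ∈ Pn3m, ∀ p ∈ bcc, x ∈ voronoiCell p → g p ∈ originCentres := by
  by_cases hx : ∃ c ∈ bcc, x ∈ voronoiCell c
  · obtain ⟨c, hc, hxc⟩ := hx
    obtain ⟨g, hg, hgc, h01, h12⟩ := Pn3m.exists_sorted x hc
    -- This element sends (x₀, x₁, x₂) to (-x₁, x₂, -x₀), which carries the centres (4,0,0),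
    -- (2,2,2), (2,2,-2) to `cB`, `cC`, `cD`.
    obtain ⟨k, hk, K⟩ := Pn3m.exists_of (σ := ⟨![1, 2, 0], ![2, 0, 1], by decide, by decide⟩)
      (ε := ![-1, 1, -1]) (t := 0) (by decide)
    have hA : g x ∈ voronoiCell cA := by
      rw [← hgc, Im3m.image_voronoiCell (Pn3m_subset_Im3m hg)]
      exact hxc
    refine ⟨g.trans k, Pn3m.trans_mem hg hk, fun p hp hxp => ?_⟩
    have hxp' := (Im3m.image_voronoiCell (Pn3m_subset_Im3m hg) x p).2 hxp
    rw [mem_originCentres, AffineIsometryEquiv.coe_trans, Function.comp_apply]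
    rcases centres_of_sorted h01 h12 hA (Pn3m.map_bcc hg hp) hxp' with h | h | h | h
    · exact Or.inl (K.apply_eq h hasCoord_cA (by decide))
    · exact Or.inr (Or.inl (K.apply_eq h hasCoord_cB (by decide)))
    · exact Or.inr (Or.inr (Or.inl (K.apply_eq h hasCoord_cC (by decide))))
    · exact Or.inr (Or.inr (Or.inr (K.apply_eq h hasCoord_cD (by decide))))
  · push Not at hx
    exact ⟨_, Pn3m.refl_mem, fun p hp h => absurd h (hx p hp)⟩

/-! ### The cells at the origin -/

theorem sq_ge_of_odd {n : ℤ} (h : n % 2 = 1) : 1 ≤ n ^ 2 := by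
  have : n ≠ 0 := by rintro rfl; simp at h
  have := sq_pos_of_ne_zero this
  omega

theorem sq_ge_four {n : ℤ} (h : n ≠ 0) : 4 ≤ (2 * n) ^ 2 := by
  have := sq_pos_of_ne_zero h
  nlinarith

theorem sq_lt_bound {n m : ℤ} (hm : 0 ≤ m) (h : n ^ 2 < m ^ 2) : -m < n ∧ n < m :=
  abs_lt.1 (abs_lt_of_sq_lt_sq h hm)

theorem five_le_coord_sq {a b c : ℤ} (h1 : a % 2 = b % 2) (h2 : b % 2 = c % 2) :
    5 ≤ (-1 - 2 * a) ^ 2 + (0 - 2 * b) ^ 2 + (-2 - 2 * c) ^ 2 := by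
  have e1 := sq_ge_of_odd (n := -1 - 2 * a) (by omega)
  by_cases hb : b = 0
  · have := sq_ge_four (n := -1 - c) (by omega)
    nlinarith [sq_nonneg (0 - 2 * b)]
  · have := sq_ge_four (n := -b) (by omega)
    nlinarith [sq_nonneg (-2 - 2 * c)]

/-- In scaled coordinates the squared distance from the origin to a centre is 5 for four centres and
at least 13 for all others. This gap confines a neighbourhood of the node to its four cells. -/
theorem near_coord {a b c : ℤ} (h1 : a % 2 = b % 2) (h2 : b % 2 = c % 2)
    (h : (-1 - 2 * a) ^ 2 + (0 - 2 * b) ^ 2 + (-2 - 2 * c) ^ 2 < 13) :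
    a = 0 ∧ b = 0 ∧ c = 0 ∨ a = 0 ∧ b = 0 ∧ c = -2 ∨ a = -1 ∧ b = 1 ∧ c = -1 ∨
      a = -1 ∧ b = -1 ∧ c = -1 := by
  have ha := sq_lt_bound (n := -1 - 2 * a) (m := 4) (by norm_num) (by nlinarith)
  have hb := sq_lt_bound (n := 0 - 2 * b) (m := 4) (by norm_num) (by nlinarith)
  have hc := sq_lt_bound (n := -2 - 2 * c) (m := 4) (by norm_num) (by nlinarith)
  have a1 : -2 ≤ a := by omega
  have a2 : a ≤ 1 := by omega
  have b1 : -1 ≤ b := by omega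
  have b2 : b ≤ 1 := by omega
  have c1 : -2 ≤ c := by omega
  have c2 : c ≤ 0 := by omega
  interval_cases a <;> interval_cases b <;> interval_cases c <;> simp at h1 h2 h ⊢

theorem dist_zero_sq_of_bcc {p : E3} {k : Fin 3 → ℤ} (h : ∀ i, coord p i = 2 * k i) :
    dist 0 p ^ 2 =
      (((-1 - 2 * k 0) ^ 2 + (0 - 2 * k 1) ^ 2 + (-2 - 2 * k 2) ^ 2 : ℤ) : ℝ) / 2 := by
  rw [dist_sq_eq_coord]
  simp only [hasCoord_zero _, h, Fin.sum_univ_three, Matrix.cons_val]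
  push_cast
  ring

theorem dist_zero_sq_originCentres {c : E3} (hc : c ∈ originCentres) : dist 0 c ^ 2 = 5 / 2 := by
  rw [dist_sq_eq_coord]
  rcases mem_originCentres.1 hc with rfl | rfl | rfl | rfl <;>
  simp only [hasCoord_zero _, hasCoord_cA _, hasCoord_cB _, hasCoord_cC _, hasCoord_cD _,
    Fin.sum_univ_three, Matrix.cons_val] <;> norm_num

theorem zero_mem_voronoiCell {c : E3} (hc : c ∈ originCentres) : 0 ∈ voronoiCell c := by
  intro p hp
  obtain ⟨k, hk, h⟩ := (mem_bcc_iff p).1 hp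
  rw [← sq_le_sq₀ dist_nonneg dist_nonneg, dist_zero_sq_originCentres hc, dist_zero_sq_of_bcc h]
  have := five_le_coord_sq (hk 0 1) (hk 1 2)
  have : (5 : ℝ) ≤ (((-1 - 2 * k 0) ^ 2 + (0 - 2 * k 1) ^ 2 + (-2 - 2 * k 2) ^ 2 : ℤ) : ℝ) := by
    exact_mod_cast this
  linarith

/-- Only the four cells at the origin come close to it. -/
theorem mem_originCentres_of_near {c x : E3} (hc : c ∈ bcc) (hx : x ∈ voronoiCell c)
    (hd : dist x 0 < 1 / 3) : c ∈ originCentres := by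
  obtain ⟨k, hk, h⟩ := (mem_bcc_iff c).1 hc
  have h1 := hx cA cA_mem
  have h2 := dist_triangle_left 0 c x
  have h3 := dist_triangle x 0 cA
  have hA := dist_zero_sq_originCentres (c := cA) (by simp [mem_originCentres])
  have hA' : dist 0 cA < 1.6 := by
    rw [← sq_lt_sq₀ dist_nonneg (by norm_num), hA]; norm_num
  -- The point is no farther from c than from `cA`, so the distance from 0 to c is below 2/3 + 1.6.
  -- Its scaled square is then below 13.
  have h4 : dist 0 c < 2.3 := by linarith
  have h5 : dist 0 c ^ 2 < 2.3 ^ 2 := by gcongr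
  rw [dist_zero_sq_of_bcc h] at h5
  have h6 : (-1 - 2 * k 0) ^ 2 + (0 - 2 * k 1) ^ 2 + (-2 - 2 * k 2) ^ 2 < 13 := by
    have : (((-1 - 2 * k 0) ^ 2 + (0 - 2 * k 1) ^ 2 + (-2 - 2 * k 2) ^ 2 : ℤ) : ℝ) < 13 := by
      linarith
    exact_mod_cast this
  have hc' : HasCoord c fun i => 2 * k i := fun i => by rw [h]; push_cast; rfl
  rw [mem_originCentres]
  rcases near_coord (hk 0 1) (hk 1 2) h6 with ⟨a, b, d⟩ | ⟨a, b, d⟩ | ⟨a, b, d⟩ | ⟨a, b, d⟩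
  · exact Or.inl (hc'.eq fun i => by rw [hasCoord_cA]; fin_cases i <;> simp [a, b, d])
  · exact Or.inr (Or.inl (hc'.eq fun i => by rw [hasCoord_cB]; fin_cases i <;> simp [a, b, d]))
  · exact Or.inr (Or.inr (Or.inl (hc'.eq fun i => by
      rw [hasCoord_cC]; fin_cases i <;> simp [a, b, d])))
  · exact Or.inr (Or.inr (Or.inr (hc'.eq fun i => by
      rw [hasCoord_cD]; fin_cases i <;> simp [a, b, d])))

theorem mem_originCentres_iff {c : E3} : c ∈ originCentres ↔ c ∈ bcc ∧ 0 ∈ voronoiCell c :=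
  ⟨fun h => ⟨originCentres_subset h, zero_mem_voronoiCell h⟩,
    fun h => mem_originCentres_of_near h.1 h.2 (by simp)⟩

theorem Pn3m.map_originCentres {g : E3 ≃ᵃⁱ[ℝ] E3} (hg : g ∈ Pn3m) (h0 : g 0 = 0) {c : E3}
    (hc : c ∈ originCentres) : g c ∈ originCentres := by
  rw [mem_originCentres_iff] at *
  refine ⟨Pn3m.map_bcc hg hc.1, ?_⟩
  rw [← h0, Im3m.image_voronoiCell (Pn3m_subset_Im3m hg)]
  exact hc.2

/-! ### Strata -/

theorem image_voronoiCell {g : E3 ≃ᵃⁱ[ℝ] E3} (hg : g ∈ Im3m) (c : E3) :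
    g '' voronoiCell c = voronoiCell (g c) := by
  ext y
  obtain ⟨x, rfl⟩ := g.surjective y
  simp [Im3m.image_voronoiCell hg]

theorem image_biInter_voronoiCell {g : E3 ≃ᵃⁱ[ℝ] E3} (hg : g ∈ Im3m) (s : Set E3) :
    g '' (⋂ c ∈ s, voronoiCell c) = ⋂ c ∈ g '' s, voronoiCell c := by
  ext y
  obtain ⟨x, rfl⟩ := g.surjective y
  simp only [Set.mem_image, EmbeddingLike.apply_eq_iff_eq, exists_eq_right, Set.mem_iInter,
      forall_exists_index, and_imp, forall_apply_eq_imp_iff₂, Im3m.image_voronoiCell hg]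

/-- A point of the stratum lies in all of its cells, so an element of `Pn3m` that brings the cells
of that point to the origin brings the whole stratum there. Nodes, edges and faces thus reduce to
subsets of a set of four cells. -/
theorem IsStratum.exists_map {k : ℕ} {S : Set E3} (h : IsStratum k S) :
    ∃ g ∈ Pn3m, ∃ s ⊆ (originCentres : Set E3), s.ncard = k ∧
      g '' S = ⋂ c ∈ s, voronoiCell c := by
  obtain ⟨⟨x, hx⟩, s, hs, hk, rfl⟩ := h
  obtain ⟨g, hg, H⟩ := exists_map_mem_originCentres x
  refine ⟨g, hg, g '' s, ?_, ?_, image_biInter_voronoiCell (Pn3m_subset_Im3m hg) s⟩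
  · rintro _ ⟨c, hc, rfl⟩
    exact H c (hs hc) (Set.mem_iInter₂.1 hx c hc)
  · rw [Set.ncard_image_of_injective s g.injective, hk]

theorem biInter_originCentres : ⋂ c ∈ (originCentres : Set E3), voronoiCell c = {0} := by
  ext x
  simp only [Set.mem_iInter, Finset.mem_coe, Set.mem_singleton_iff]
  constructor
  · intro h
    have hA := h cA (by simp [mem_originCentres])
    have hB := h cB (by simp [mem_originCentres])
    have hC := h cC (by simp [mem_originCentres])
    have hD := h cD (by simp [mem_originCentres])
    have h1 := (dist_le_dist_iff_coord _ _ _).1 (hA _ cB_mem)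
    have h2 := (dist_le_dist_iff_coord _ _ _).1 (hA _ cC_mem)
    have h3 := (dist_le_dist_iff_coord _ _ _).1 (hA _ cD_mem)
    have h4 := (dist_le_dist_iff_coord _ _ _).1 (hB _ cA_mem)
    have h5 := (dist_le_dist_iff_coord _ _ _).1 (hC _ cA_mem)
    have h6 := (dist_le_dist_iff_coord _ _ _).1 (hD _ cA_mem)
    simp only [hasCoord_cA _, hasCoord_cB _, hasCoord_cC _, hasCoord_cD _,
      Fin.sum_univ_three, Matrix.cons_val] at h1 h2 h3 h4 h5 h6
    push_cast at h1 h2 h3 h4 h5 h6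
    have e0 : coord x 0 = -1 := by linarith
    have e1 : coord x 1 = 0 := by linarith
    have e2 : coord x 2 = -2 := by linarith
    refine HasCoord.eq (x := ![-1, 0, -2]) (fun i => ?_) hasCoord_zero
    fin_cases i <;> simp [e0, e1, e2]
  · rintro rfl c hc
    exact zero_mem_voronoiCell hc

theorem isNode_zero : IsNode 0 :=
  ⟨Set.singleton_nonempty 0, originCentres, fun _ h => originCentres_subset h,
    by rw [Set.ncard_coe_finset, card_originCentres], biInter_originCentres.symm⟩

theorem isNode_iff {v : E3} : IsNode v ↔ ∃ g ∈ Pn3m, g 0 = v := by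
  constructor
  · intro h
    obtain ⟨g, hg, s, hs, hk, he⟩ := IsStratum.exists_map h
    have hs' : s = originCentres := by
      refine Set.eq_of_subset_of_ncard_le hs ?_ (Finset.finite_toSet _)
      rw [hk, Set.ncard_coe_finset, card_originCentres]
    rw [hs', biInter_originCentres, Set.image_singleton, Set.singleton_eq_singleton_iff] at he
    exact ⟨g.symm, Pn3m.symm_mem hg, by rw [← he]; simp⟩
  · rintro ⟨g, hg, rfl⟩
    exact Im3m.image_isNode (Pn3m_subset_Im3m hg) isNode_zero

/-- The rotations about the origin in `Pn3m` are transitive on the four cells at the origin. -/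
theorem exists_rot_cD {c : E3} (hc : c ∈ originCentres) : ∃ g ∈ Pn3m, g 0 = 0 ∧ g cD = c := by
  rcases mem_originCentres.1 hc with rfl | rfl | rfl | rfl
  · exact ⟨_, rotQ_mem, rotQ_zero, rotQ_cD⟩
  · exact ⟨_, rotP_mem, rotP_zero, rotP_cD⟩
  · exact ⟨_, rotU_mem, rotU_zero, rotU_cD⟩
  · exact ⟨_, Pn3m.refl_mem, rfl, rfl⟩

theorem exists_cell_flag {c v : E3} (hc : c ∈ bcc) (hv : IsNode v) (h : v ∈ voronoiCell c) :
    ∃ g ∈ Pn3m, g 0 = v ∧ g cD = c := by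
  obtain ⟨g, hg, rfl⟩ := isNode_iff.1 hv
  have hg' := Pn3m.symm_mem hg
  have : g.symm c ∈ originCentres := by
    rw [mem_originCentres_iff]
    refine ⟨Pn3m.map_bcc hg' hc, ?_⟩
    rw [← Im3m.image_voronoiCell (Pn3m_subset_Im3m hg)]
    simpa using h
  obtain ⟨k, hk, h0, hD⟩ := exists_rot_cD this
  exact ⟨k.trans g, Pn3m.trans_mem hk hg, by simp [h0], by simp [hD]⟩

/-! ### The base edge and the flags of a node and an edge -/

theorem coord_smul_e1 (t : ℝ) : coord (t • !₂[1, 0, 0]) = ![t - 1, t, -2] := by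
  funext i; fin_cases i <;> simp [coord]

theorem mem_baseEdge_iff (x : E3) : x ∈ baseEdge ↔ ∃ t ∈ Set.Icc (0 : ℝ) 1, x = t • !₂[1, 0, 0] := by
  rw [baseEdge, segment_eq_image]
  simp only [smul_zero, zero_add, Set.mem_image]
  exact ⟨fun ⟨t, h, e⟩ => ⟨t, h, e.symm⟩, fun ⟨t, h, e⟩ => ⟨t, h, e.symm⟩⟩

theorem convex_voronoiCell (c : E3) : Convex ℝ (voronoiCell c) := by
  have e : voronoiCell c = ⋂ p ∈ bcc, {x | inner ℝ (p - c) x ≤ (‖p‖ ^ 2 - ‖c‖ ^ 2) / 2} := by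
    ext x
    simp only [voronoiCell, Set.mem_ofPred_eq, Set.mem_iInter]
    refine forall₂_congr fun p _ => ?_
    rw [← sq_le_sq₀ dist_nonneg dist_nonneg, dist_eq_norm, dist_eq_norm, norm_sub_sq_real,
      norm_sub_sq_real, inner_sub_left, real_inner_comm p x, real_inner_comm c x]
    constructor <;> intro h <;> linarith
  rw [e]
  exact convex_iInter₂ fun p _ => convex_halfSpace_le (innerₗ E3 (p - c)).isLinear _

theorem edgeFlip_cA : edgeFlip cA = cA :=
  edgeFlip_spec.apply_eq hasCoord_cA hasCoord_cA (by decide)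
theorem edgeFlip_cB : edgeFlip cB = cB :=
  edgeFlip_spec.apply_eq hasCoord_cB hasCoord_cB (by decide)
theorem edgeFlip_cC : edgeFlip cC = cC :=
  edgeFlip_spec.apply_eq hasCoord_cC hasCoord_cC (by decide)

/-- Equidistance from the three centres cuts out the line of the base edge, and one further cell at
each end bounds it. Conversely the cells are convex, and both ends lie in them: the origin does, and
`edgeFlip`, which fixes the three centres, carries it to the other end. -/
theorem biInter_baseEdge : ⋂ c ∈ ({cA, cB, cC} : Set E3), voronoiCell c = baseEdge := by
  ext x
  simp only [Set.mem_iInter, Set.mem_insert_iff, Set.mem_singleton_iff, forall_eq_or_imp,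
    forall_eq]
  constructor
  · rintro ⟨hA, hB, hC⟩
    -- The fourth cell at the end (1,0,0) is centred at (2,2,-2); it gives t ≤ 1, as `cD` gives t ≥
    -- 0.
    have hE : HasCoord (ofCoord fun i => ((![2, 2, -2] : Fin 3 → ℤ) i : ℝ)) ![2, 2, -2] :=
      HasCoord.ofCoord _
    have h1 := (dist_le_dist_iff_coord _ _ _).1 (hA _ cB_mem)
    have h2 := (dist_le_dist_iff_coord _ _ _).1 (hA _ cC_mem)
    have h3 := (dist_le_dist_iff_coord _ _ _).1 (hA _ cD_mem)
    have h4 := (dist_le_dist_iff_coord _ _ _).1 (hB _ cA_mem)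
    have h5 := (dist_le_dist_iff_coord _ _ _).1 (hC _ cA_mem)
    have h6 := (dist_le_dist_iff_coord _ _ _).1 (hA _ (hE.mem_bcc ![1, 1, -1] (by decide)))
    simp only [hasCoord_cA _, hasCoord_cB _, hasCoord_cC _, hasCoord_cD _, hE _,
      Fin.sum_univ_three, Matrix.cons_val] at h1 h2 h3 h4 h5 h6
    push_cast at h1 h2 h3 h4 h5 h6
    refine (mem_baseEdge_iff x).2 ⟨coord x 1, ⟨by linarith, by linarith⟩, coord_injective ?_⟩
    rw [coord_smul_e1]
    funext i
    fin_cases i <;> simp <;> linarith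
  · intro hx
    have key : ∀ c ∈ originCentres, edgeFlip.symm c ∈ originCentres → x ∈ voronoiCell c := by
      intro c h1 h2
      refine (convex_voronoiCell c).segment_subset (zero_mem_voronoiCell h1) ?_ hx
      have := (Im3m.image_voronoiCell (Pn3m_subset_Im3m edgeFlip_mem) 0 _).2
        (zero_mem_voronoiCell h2)
      rwa [edgeFlip_zero, AffineIsometryEquiv.apply_symm_apply] at this
    have gA : edgeFlip.symm cA = cA := by conv_lhs => rw [← edgeFlip_cA]; simp
    have gB : edgeFlip.symm cB = cB := by conv_lhs => rw [← edgeFlip_cB]; simp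
    have gC : edgeFlip.symm cC = cC := by conv_lhs => rw [← edgeFlip_cC]; simp
    refine ⟨key _ ?_ ?_, key _ ?_ ?_, key _ ?_ ?_⟩ <;> simp [mem_originCentres, gA, gB, gC]

theorem originCentres_diff_cD : (originCentres : Set E3) \ {cD} = {cA, cB, cC} := by
  ext c
  simp only [Set.mem_sdiff, Finset.mem_coe, mem_originCentres, Set.mem_singleton_iff,
    Set.mem_insert_iff]
  have := cA_ne_cD
  have := cB_ne_cD
  have := cC_ne_cD
  grind

theorem isEdge_baseEdge : IsEdge baseEdge := by
  refine ⟨⟨0, left_mem_segment _ _ _⟩, {cA, cB, cC}, ?_, ?_, biInter_baseEdge.symm⟩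
  · rintro _ (rfl | rfl | rfl)
    exacts [cA_mem, cB_mem, cC_mem]
  · rw [← originCentres_diff_cD, Set.ncard_sdiff_singleton_of_mem (by simp [mem_originCentres]),
      Set.ncard_coe_finset, card_originCentres]

/-- Three of the four cells at the origin are determined by the one left out, and a half-turn moves
`cD` to that one. -/
theorem IsEdge.exists_image_eq {e : Set E3} (he : IsEdge e) : ∃ g ∈ Pn3m, g '' baseEdge = e := by
  obtain ⟨g, hg, s, hs, hk, h⟩ := IsStratum.exists_map he
  obtain ⟨c, hc, hcs⟩ : ∃ c ∈ (originCentres : Set E3), c ∉ s := by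
    by_contra! hn
    have := Set.ncard_le_ncard hn (originCentres.finite_toSet.subset hs)
    rw [hk, Set.ncard_coe_finset, card_originCentres] at this
    omega
  have hs' : s = (originCentres : Set E3) \ {c} := by
    refine Set.eq_of_subset_of_ncard_le (fun x hx => ⟨hs hx, ?_⟩) ?_
      ((Finset.finite_toSet _).subset Set.sdiff_subset)
    · rintro rfl; exact hcs hx
    · rw [Set.ncard_sdiff_singleton_of_mem hc, Set.ncard_coe_finset, card_originCentres, hk]
  obtain ⟨k, hk', h0, hD⟩ := exists_rot_cD hc
  have hks : k '' ({cA, cB, cC} : Set E3) = s := by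
    refine Set.eq_of_subset_of_ncard_le ?_ ?_ (originCentres.finite_toSet.subset hs)
    · rw [← originCentres_diff_cD, hs']
      rintro _ ⟨x, ⟨hx, hx'⟩, rfl⟩
      refine ⟨Pn3m.map_originCentres hk' h0 hx, fun hh => hx' ?_⟩
      rw [← hD] at hh
      exact k.injective hh
    · rw [Set.ncard_image_of_injective _ k.injective, ← originCentres_diff_cD,
        Set.ncard_sdiff_singleton_of_mem (by simp [mem_originCentres]),
        Set.ncard_coe_finset, card_originCentres, hk]
  refine ⟨k.trans g.symm, Pn3m.trans_mem hk' (Pn3m.symm_mem hg), ?_⟩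
  rw [← hks, ← image_biInter_voronoiCell (Pn3m_subset_Im3m hk'), biInter_baseEdge] at h
  rw [AffineIsometryEquiv.coe_trans, Set.image_comp, ← h, Set.image_image]
  simp

theorem IsNode.exists_hasCoord {v : E3} (hv : IsNode v) : ∃ x, HasCoord v x := by
  obtain ⟨g, hg, rfl⟩ := isNode_iff.1 hv
  obtain ⟨σ, ε, t, H, -⟩ := (mem_Pn3m_iff g).1 hg
  exact ⟨_, H.hasCoord hasCoord_zero⟩

theorem isNode_e1 : IsNode !₂[1, 0, 0] := isNode_iff.2 ⟨_, edgeFlip_mem, edgeFlip_zero⟩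

/-- Nodes have integral scaled coordinates, and along the base edge the second coordinate is the
parameter t in [0, 1]. -/
theorem node_of_mem_baseEdge {v : E3} (hv : IsNode v) (h : v ∈ baseEdge) :
    v = 0 ∨ v = !₂[1, 0, 0] := by
  obtain ⟨x, hx⟩ := hv.exists_hasCoord
  obtain ⟨t, ⟨h0, h1⟩, rfl⟩ := (mem_baseEdge_iff v).1 h
  have e := hx 1
  rw [coord_smul_e1] at e
  simp only [Matrix.cons_val] at e
  rw [e] at h0 h1
  have i0 : 0 ≤ x 1 := by exact_mod_cast h0
  have i1 : x 1 ≤ 1 := by exact_mod_cast h1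
  rcases (by omega : x 1 = 0 ∨ x 1 = 1) with h | h
  · left; rw [e, h]; simp
  · right; rw [e, h]; simp

theorem edgeFlip_image_baseEdge : edgeFlip '' baseEdge = baseEdge := by
  rw [← biInter_baseEdge, image_biInter_voronoiCell (Pn3m_subset_Im3m edgeFlip_mem)]
  simp [Set.image_insert_eq, edgeFlip_cA, edgeFlip_cB, edgeFlip_cC]

/-- Transitivity on flags: edges are images of the base edge, and `edgeFlip` interchanges its ends.
This is what lets one vector describe the whole system of half-tangents. -/
theorem exists_edge_flag {e : Set E3} {v : E3} (he : IsEdge e) (hv : IsNode v) (h : v ∈ e) :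
    ∃ g ∈ Pn3m, g '' baseEdge = e ∧ g 0 = v := by
  obtain ⟨g, hg, rfl⟩ := he.exists_image_eq
  obtain ⟨y, hy, rfl⟩ := h
  have hy' : IsNode y := by
    have := Im3m.image_isNode (Im3m.symm_mem (Pn3m_subset_Im3m hg)) hv
    simpa using this
  rcases node_of_mem_baseEdge hy' hy with rfl | rfl
  · exact ⟨g, hg, rfl, rfl⟩
  · refine ⟨edgeFlip.trans g, Pn3m.trans_mem edgeFlip_mem hg, ?_, ?_⟩
    · rw [AffineIsometryEquiv.coe_trans, Set.image_comp, edgeFlip_image_baseEdge]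
    · simp [edgeFlip_zero]

theorem exists_edge_flag_of_ne {e : Set E3} {v w : E3} (he : IsEdge e) (hv : IsNode v)
    (hw : IsNode w) (h : v ∈ e) (h' : w ∈ e) (hne : v ≠ w) :
    ∃ g ∈ Pn3m, g '' baseEdge = e ∧ g 0 = v ∧ g !₂[1, 0, 0] = w := by
  obtain ⟨g, hg, rfl, rfl⟩ := exists_edge_flag he hv h
  obtain ⟨y, hy, rfl⟩ := h'
  have hy' : IsNode y := by
    have := Im3m.image_isNode (Im3m.symm_mem (Pn3m_subset_Im3m hg)) hw
    simpa using this
  rcases node_of_mem_baseEdge hy' hy with rfl | rfl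
  · exact absurd rfl hne
  · exact ⟨g, hg, rfl, rfl, rfl⟩

/-! ### Faces -/

def quadFace : Set E3 := voronoiCell cA ∩ voronoiCell cB
def hexFace₁ : Set E3 := voronoiCell cA ∩ voronoiCell cC
def hexFace₂ : Set E3 := voronoiCell cB ∩ voronoiCell cC

theorem isFace_inter {c c' : E3} (h : c ∈ originCentres) (h' : c' ∈ originCentres) (hne : c ≠ c') :
    IsFace (voronoiCell c ∩ voronoiCell c') := by
  refine ⟨⟨0, zero_mem_voronoiCell h, zero_mem_voronoiCell h'⟩, {c, c'}, ?_, Set.ncard_pair hne, ?_⟩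
  · rintro _ (rfl | rfl)
    exacts [originCentres_subset h, originCentres_subset h']
  · simp

/-- The half-turns pair the six faces at the origin as AB with CD, AC with BD, BC with AD. One
representative of each pair contains the base edge. -/
theorem IsFace.exists_image_eq {F : Set E3} (hF : IsFace F) :
    ∃ g ∈ Pn3m, ∃ F₀, (F₀ = quadFace ∨ F₀ = hexFace₁ ∨ F₀ = hexFace₂) ∧ g '' F₀ = F := by
  obtain ⟨g, hg, s, hs, hk, h⟩ := IsStratum.exists_map hF
  obtain ⟨c, c', hne, rfl⟩ := Set.ncard_eq_two.1 hk
  have e : ⋂ x ∈ ({c, c'} : Set E3), voronoiCell x = voronoiCell c ∩ voronoiCell c' := by simp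
  rw [e] at h
  have hc := mem_originCentres.1 (hs (Set.mem_insert _ _))
  have hc' := mem_originCentres.1 (hs (Set.mem_insert_of_mem _ rfl))
  suffices H : ∃ k ∈ Pn3m, ∃ F₀, (F₀ = quadFace ∨ F₀ = hexFace₁ ∨ F₀ = hexFace₂) ∧
      k '' F₀ = voronoiCell c ∩ voronoiCell c' by
    obtain ⟨k, hk, F₀, h1, h2⟩ := H
    refine ⟨k.trans g.symm, Pn3m.trans_mem hk (Pn3m.symm_mem hg), F₀, h1, ?_⟩
    rw [AffineIsometryEquiv.coe_trans, Set.image_comp, h2, ← h, Set.image_image]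
    simp
  have I : ∀ {k : E3 ≃ᵃⁱ[ℝ] E3}, k ∈ Pn3m → ∀ x y, k '' (voronoiCell x ∩ voronoiCell y) =
      voronoiCell (k x) ∩ voronoiCell (k y) := fun {k} hk x y => by
    rw [Set.image_inter k.injective, image_voronoiCell (Pn3m_subset_Im3m hk),
      image_voronoiCell (Pn3m_subset_Im3m hk)]
  have Q : ∀ k ∈ Pn3m, (k cA = c ∧ k cB = c' ∨ k cA = c' ∧ k cB = c) → ∃ k ∈ Pn3m, ∃ F₀,
      (F₀ = quadFace ∨ F₀ = hexFace₁ ∨ F₀ = hexFace₂) ∧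
      k '' F₀ = voronoiCell c ∩ voronoiCell c' := by
    rintro k hk' (⟨rfl, rfl⟩ | ⟨rfl, rfl⟩)
    · exact ⟨k, hk', _, Or.inl rfl, I hk' _ _⟩
    · exact ⟨k, hk', _, Or.inl rfl, (I hk' _ _).trans (Set.inter_comm _ _)⟩
  have H1 : ∀ k ∈ Pn3m, (k cA = c ∧ k cC = c' ∨ k cA = c' ∧ k cC = c) → ∃ k ∈ Pn3m, ∃ F₀,
      (F₀ = quadFace ∨ F₀ = hexFace₁ ∨ F₀ = hexFace₂) ∧
      k '' F₀ = voronoiCell c ∩ voronoiCell c' := by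
    rintro k hk' (⟨rfl, rfl⟩ | ⟨rfl, rfl⟩)
    · exact ⟨k, hk', _, Or.inr (Or.inl rfl), I hk' _ _⟩
    · exact ⟨k, hk', _, Or.inr (Or.inl rfl), (I hk' _ _).trans (Set.inter_comm _ _)⟩
  have H2 : ∀ k ∈ Pn3m, (k cB = c ∧ k cC = c' ∨ k cB = c' ∧ k cC = c) → ∃ k ∈ Pn3m, ∃ F₀,
      (F₀ = quadFace ∨ F₀ = hexFace₁ ∨ F₀ = hexFace₂) ∧
      k '' F₀ = voronoiCell c ∩ voronoiCell c' := by
    rintro k hk' (⟨rfl, rfl⟩ | ⟨rfl, rfl⟩)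
    · exact ⟨k, hk', _, Or.inr (Or.inr rfl), I hk' _ _⟩
    · exact ⟨k, hk', _, Or.inr (Or.inr rfl), (I hk' _ _).trans (Set.inter_comm _ _)⟩
  have R := Pn3m.refl_mem
  rcases hc with rfl | rfl | rfl | rfl <;> rcases hc' with rfl | rfl | rfl | rfl <;>
    first
    | exact absurd rfl hne
    | (refine Q _ R ?_; simp; done)
    | (refine H1 _ R ?_; simp; done)
    | (refine H2 _ R ?_; simp; done)
    | (refine Q _ rotP_mem ?_; simp [rotP_cA, rotP_cB]; done)
    | (refine H1 _ rotU_mem ?_; simp [rotU_cA, rotU_cC]; done)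
    | (refine H2 _ rotU_mem ?_; simp [rotU_cB, rotU_cC])

/-! ### Half-tangents of arcs -/

theorem map_nhdsWithin_isometry (g : E3 ≃ᵃⁱ[ℝ] E3) (A : Set E3) (v : E3) :
    𝓝[g '' A \ {g v}] (g v) = map g (𝓝[A \ {v}] v) := by
  have := g.toHomeomorph.isEmbedding.map_nhdsWithin_eq (A \ {v}) v
  rw [Set.image_sdiff g.toHomeomorph.injective, Set.image_singleton] at this
  exact this.symm

theorem IsHalfTangent.image {A : Set E3} {v u : E3} (h : IsHalfTangent A v u)
    (g : E3 ≃ᵃⁱ[ℝ] E3) : IsHalfTangent (g '' A) (g v) (g.linearIsometryEquiv u) := by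
  rw [IsHalfTangent, map_nhdsWithin_isometry, tendsto_map'_iff]
  refine ((g.linearIsometryEquiv.continuous.tendsto u).comp h).congr fun x => ?_
  simp only [Function.comp_apply, map_smul, linear_eq_sub]
  rw [← linear_eq_sub, LinearIsometryEquiv.norm_map]

theorem symm_linear_apply (g : E3 ≃ᵃⁱ[ℝ] E3) (u : E3) :
    g.symm.linearIsometryEquiv (g.linearIsometryEquiv u) = u :=
  g.linearIsometryEquiv.symm_apply_apply u

theorem linear_symm_apply (g : E3 ≃ᵃⁱ[ℝ] E3) (u : E3) :
    g.linearIsometryEquiv (g.symm.linearIsometryEquiv u) = u :=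
  g.linearIsometryEquiv.apply_symm_apply u

theorem isHalfTangent_image_iff (g : E3 ≃ᵃⁱ[ℝ] E3) {A : Set E3} {v u : E3} :
    IsHalfTangent (g '' A) (g v) (g.linearIsometryEquiv u) ↔ IsHalfTangent A v u := by
  refine ⟨fun h => ?_, fun h => h.image g⟩
  have := h.image g.symm
  rwa [symm_linear_apply, Set.image_image, g.symm_apply_apply, show
    (fun x => g.symm (g x)) '' A = A by simp] at this

/-- A continuous injection of the compact interval is an embedding, so approaching the end along the
arc is the same as letting the parameter tend to 0. This makes half-tangents unique and computable
from the derivative. -/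
theorem arc_nhdsWithin {γ : ℝ → E3} (hc : Continuous γ) (hi : Set.InjOn γ (Set.Icc 0 1)) :
    𝓝[γ '' Set.Icc 0 1 \ {γ 0}] (γ 0) =
      map (fun t : Set.Icc (0 : ℝ) 1 => γ t) (𝓝[≠] 0) := by
  have hf : IsClosedEmbedding fun t : Set.Icc (0 : ℝ) 1 => γ t :=
    (hc.comp continuous_subtype_val).isClosedEmbedding (Set.injOn_iff_injective.1 hi)
  have h := hf.isEmbedding.map_nhdsWithin_eq ({0}ᶜ) 0
  rw [h, Set.image_compl_eq_range_sdiff_image hf.injective, Set.image_singleton]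
  congr 2
  rw [Set.image_eq_range]

theorem arc_neBot {γ : ℝ → E3} (hc : Continuous γ) (hi : Set.InjOn γ (Set.Icc 0 1)) :
    (𝓝[γ '' Set.Icc 0 1 \ {γ 0}] (γ 0)).NeBot := by
  rw [arc_nhdsWithin hc hi]
  infer_instance

/-- The normalized chord is the normalized difference quotient, because t > 0. -/
theorem arc_isHalfTangent {γ : ℝ → E3} (hc : Continuous γ) (hi : Set.InjOn γ (Set.Icc 0 1))
    {d : E3} (hd : HasDerivAt γ d 0) (h0 : d ≠ 0) :
    IsHalfTangent (γ '' Set.Icc 0 1) (γ 0) (‖d‖⁻¹ • d) := by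
  rw [IsHalfTangent, arc_nhdsWithin hc hi, tendsto_map'_iff]
  have h1 : Tendsto (fun t : Set.Icc (0 : ℝ) 1 => (t : ℝ)) (𝓝[≠] 0) (𝓝[≠] 0) := by
    refine tendsto_nhdsWithin_iff.2 ⟨?_, ?_⟩
    · exact (continuous_subtype_val.tendsto (0 : Set.Icc (0 : ℝ) 1)).mono_left nhdsWithin_le_nhds
    · filter_upwards [self_mem_nhdsWithin] with t ht
      exact fun h => ht (Subtype.ext h)
  have h2 := (hasDerivAt_iff_tendsto_slope.1 hd).comp h1
  have h3 := (h2.norm.inv₀ (norm_ne_zero_iff.2 h0)).smul h2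
  refine h3.congr' ?_
  filter_upwards [self_mem_nhdsWithin] with t ht
  have ht0 : 0 < (t : ℝ) := lt_of_le_of_ne t.2.1 fun h => ht (Subtype.ext h.symm)
  simp only [Function.comp_apply, slope_def_module, sub_zero, norm_smul, norm_inv,
    Real.norm_of_nonneg ht0.le, mul_inv, inv_inv, smul_smul]
  congr 1
  field_simp

/-! ### Half-tangents of tilings -/

/-- The other end of an edge. -/
theorem exists_other_node {e : Set E3} {v : E3} (he : IsEdge e) (hv : IsNode v) (h : v ∈ e) :
    ∃ w, IsNode w ∧ w ∈ e ∧ v ≠ w := by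
  obtain ⟨g, hg, rfl, rfl⟩ := exists_edge_flag he hv h
  refine ⟨g !₂[1, 0, 0], Im3m.image_isNode (Pn3m_subset_Im3m hg) isNode_e1,
    Set.mem_image_of_mem _ (right_mem_segment _ _ _), fun hh => ?_⟩
  exact hasCoord_zero.ne hasCoord_e1 (by decide) (g.injective hh)

namespace E2Tiling

variable {M N : E2Tiling}

theorem exists_arc (M : E2Tiling) {e : Set E3} {v : E3} (he : IsEdge e) (hv : IsNode v)
    (h : v ∈ e) : (𝓝[M.toHomeo '' e \ {v}] v).NeBot ∧ ∃ u, ‖u‖ = 1 ∧ M.HalfTangent e v u := by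
  obtain ⟨w, hw, hwe, hne⟩ := exists_other_node he hv h
  obtain ⟨γ, hγ, hd, hi, hA, rfl, -⟩ := M.smooth_edge e v w he hv hw h hwe hne
  have h0 := hd 0 (by simp)
  simp only [HalfTangent, ← hA]
  refine ⟨arc_neBot hγ.continuous hi, _, ?_, arc_isHalfTangent hγ.continuous hi
    ((hγ.differentiable (by simp)).differentiableAt.hasDerivAt) h0⟩
  rw [norm_smul, norm_inv, norm_norm, inv_mul_cancel₀ (norm_ne_zero_iff.2 h0)]

theorem HalfTangent.unique {e : Set E3} {v u u' : E3} (h : M.HalfTangent e v u)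
    (h' : M.HalfTangent e v u') (he : IsEdge e) (hv : IsNode v) (hve : v ∈ e) : u = u' := by
  have := (M.exists_arc he hv hve).1
  exact tendsto_nhds_unique (f := fun x : E3 => ‖x - v‖⁻¹ • (x - v)) h h'

theorem HalfTangent.norm_eq_one {e : Set E3} {v u : E3} (h : M.HalfTangent e v u)
    (he : IsEdge e) (hv : IsNode v) (hve : v ∈ e) : ‖u‖ = 1 := by
  obtain ⟨-, u', h1, h2⟩ := M.exists_arc he hv hve
  rw [h.unique h2 he hv hve, h1]

end E2Tiling

theorem isEdge_image {g : E3 ≃ᵃⁱ[ℝ] E3} (hg : g ∈ Pn3m) : IsEdge (g '' baseEdge) :=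
  Im3m.image_isStratum (Pn3m_subset_Im3m hg) isEdge_baseEdge

theorem isNode_image_zero {g : E3 ≃ᵃⁱ[ℝ] E3} (hg : g ∈ Pn3m) : IsNode (g 0) :=
  isNode_iff.2 ⟨g, hg, rfl⟩

theorem zero_mem_baseEdge : (0 : E3) ∈ baseEdge := left_mem_segment _ _ _

theorem e1_mem_baseEdge : !₂[1, 0, 0] ∈ baseEdge := right_mem_segment _ _ _

theorem image_zero_mem (g : E3 ≃ᵃⁱ[ℝ] E3) : g 0 ∈ g '' baseEdge :=
  Set.mem_image_of_mem _ zero_mem_baseEdge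

namespace E2Tiling

variable {M : E2Tiling} {a : E3}

/-- Existence comes from invariance and uniqueness from the arcs. In particular all choices of g for
the same flag give the same vector. -/
theorem halfTangent_flag_iff (hM : M.HasSecondOrderPn3mSymmetry) (ha : M.HalfTangent baseEdge 0 a)
    {g : E3 ≃ᵃⁱ[ℝ] E3} (hg : g ∈ Pn3m) {u : E3} :
    M.HalfTangent (g '' baseEdge) (g 0) u ↔ u = g.linearIsometryEquiv a := by
  have h := (hM g hg baseEdge 0 a isEdge_baseEdge isNode_zero zero_mem_baseEdge).1 ha
  constructor
  · intro hu
    exact hu.unique h (isEdge_image hg) (isNode_image_zero hg) (image_zero_mem g)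
  · rintro rfl
    exact h

end E2Tiling

/-! ### The stabilizer of the origin -/

/-- The translation has been replaced by its residue modulo 4, so only 48 signed permutations remain
to be checked. Once the origin is fixed, the signed permutation determines the translation. -/
theorem stabilizer_origin_signs (σ : Equiv.Perm (Fin 3)) (ε : Fin 3 → ℤˣ)
    (h : ∀ i, (ε i * (![-1, 0, -2] : Fin 3 → ℤ) (σ i) + if ∏ j, ε j = 1 then 0 else 2) % 4 =
      (![-1, 0, -2] : Fin 3 → ℤ) i % 4) :
    σ = 1 ∧ ε = 1 ∨ σ = 1 ∧ ε = ![1, -1, -1] ∨ σ = Equiv.swap 1 2 ∧ ε = ![-1, 1, 1] ∨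
      σ = Equiv.swap 1 2 ∧ ε = ![-1, -1, -1] := by
  revert σ ε
  decide

theorem stabilizer_origin {g : E3 ≃ᵃⁱ[ℝ] E3} (hg : g ∈ Pn3m) (h0 : g 0 = 0) :
    g = AffineIsometryEquiv.refl ℝ E3 ∨ g = rotU ∨ g = rotP ∨ g = rotQ := by
  obtain ⟨σ, ε, t, H, ht⟩ := (mem_Pn3m_iff g).1 hg
  have ht' : ∀ i, ε i * (![-1, 0, -2] : Fin 3 → ℤ) (σ i) + t i =
      (![-1, 0, -2] : Fin 3 → ℤ) i := by
    intro i
    have h1 := H.hasCoord hasCoord_zero i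
    rw [h0, hasCoord_zero i] at h1
    exact_mod_cast h1.symm
  have hs := stabilizer_origin_signs σ ε fun i => by
    have h1 := ht i
    have h2 := ht' i
    split_ifs at h1 ⊢ <;> omega
  have key : ∀ {k : E3 ≃ᵃⁱ[ℝ] E3} {s : Fin 3 → ℤ}, IsSignedPerm k σ ε s → k 0 = 0 → g = k := by
    intro k s K hk
    have : s = t := by
      funext i
      have h1 := K.hasCoord hasCoord_zero i
      rw [hk, hasCoord_zero i] at h1
      have h2 : ε i * (![-1, 0, -2] : Fin 3 → ℤ) (σ i) + s i =
        (![-1, 0, -2] : Fin 3 → ℤ) i := by exact_mod_cast h1.symm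
      linarith [ht' i]
    subst this
    exact AffineIsometryEquiv.ext fun x => H.ext K x
  rcases hs with ⟨rfl, rfl⟩ | ⟨rfl, rfl⟩ | ⟨rfl, rfl⟩ | ⟨rfl, rfl⟩
  · exact Or.inl (key (s := 0) (fun x i => by simp) rfl)
  · exact Or.inr (Or.inl (key rotU_spec rotU_zero))
  · exact Or.inr (Or.inr (Or.inl (key rotP_spec rotP_zero)))
  · exact Or.inr (Or.inr (Or.inr (key rotQ_spec rotQ_zero)))

/-! The axes of the three rotations about the origin -/

noncomputable def axisU : E3 := !₂[1 / √2, 1 / √2, 0]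
noncomputable def axisP : E3 := !₂[1 / 2, -(1 / 2), 1 / √2]
noncomputable def axisQ : E3 := !₂[-(1 / 2), 1 / 2, 1 / √2]

theorem one_div_sqrt_two : 1 / √2 = √2 / 2 := by
  have : √2 ≠ 0 := by positivity
  field_simp
  linarith [sqrt_two_sq]

theorem lcoord_axisU : lcoord axisU = ![√2, 0, 0] := by
  funext i; fin_cases i <;> simp [lcoord, axisU]
  rw [← one_div, one_div_sqrt_two]; ring

theorem lcoord_axisP : lcoord axisP = ![0, 1, 1] := by
  funext i; fin_cases i <;> simp [lcoord, axisP]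
  norm_num

theorem lcoord_axisQ : lcoord axisQ = ![0, -1, 1] := by
  funext i; fin_cases i <;> simp [lcoord, axisQ]
  norm_num

theorem inner_axisU (v : E3) : inner ℝ axisU v = √2 / 2 * lcoord v 0 := by
  rw [inner_eq_lcoord, lcoord_axisU]
  simp [Fin.sum_univ_three]
  ring

theorem inner_axisP (v : E3) : inner ℝ axisP v = (lcoord v 1 + lcoord v 2) / 2 := by
  rw [inner_eq_lcoord, lcoord_axisP]
  simp [Fin.sum_univ_three]

theorem inner_axisQ (v : E3) : inner ℝ axisQ v = (lcoord v 2 - lcoord v 1) / 2 := by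
  rw [inner_eq_lcoord, lcoord_axisQ]
  simp [Fin.sum_univ_three]
  ring

theorem rotU_linear (v : E3) :
    rotU.linearIsometryEquiv v = (2 * inner ℝ axisU v) • axisU - v := by
  apply lcoord_injective
  funext i
  rw [rotU_spec.lcoord, sub_eq_add_neg, lcoord_add, lcoord_smul, lcoord_neg, inner_axisU,
    lcoord_axisU]
  fin_cases i <;> simp
  linear_combination -lcoord v 0 * sqrt_two_sq

theorem rotP_linear (v : E3) :
    rotP.linearIsometryEquiv v = (2 * inner ℝ axisP v) • axisP - v := by
  apply lcoord_injective
  funext i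
  rw [rotP_spec.lcoord, sub_eq_add_neg, lcoord_add, lcoord_smul, lcoord_neg, inner_axisP,
    lcoord_axisP]
  fin_cases i
  · have : (Equiv.swap 1 2 : Equiv.Perm (Fin 3)) 0 = 0 := by decide
    simp [this]
  · simp; ring
  · have : (Equiv.swap 1 2 : Equiv.Perm (Fin 3)) 2 = 1 := by decide
    simp [this]; ring

theorem rotQ_linear (v : E3) :
    rotQ.linearIsometryEquiv v = (2 * inner ℝ axisQ v) • axisQ - v := by
  apply lcoord_injective
  funext i
  rw [rotQ_spec.lcoord, sub_eq_add_neg, lcoord_add, lcoord_smul, lcoord_neg, inner_axisQ,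
    lcoord_axisQ]
  fin_cases i
  · have : (Equiv.swap 1 2 : Equiv.Perm (Fin 3)) 0 = 0 := by decide
    simp [this]
  · simp; ring
  · have : (Equiv.swap 1 2 : Equiv.Perm (Fin 3)) 2 = 1 := by decide
    simp [this]; ring

theorem axisU_ne_zero : axisU ≠ 0 := by
  intro h
  have := congrFun lcoord_axisU 0
  rw [h] at this
  simp [lcoord, eq_comm (a := (0 : ℝ))] at this

theorem axisP_ne_zero : axisP ≠ 0 := by
  intro h
  have := congrFun lcoord_axisP 1
  rw [h] at this
  simp [lcoord] at this

theorem axisQ_ne_zero : axisQ ≠ 0 := by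
  intro h
  have := congrFun lcoord_axisQ 1
  rw [h] at this
  simp [lcoord] at this

theorem reflection_eq_neg_iff {l a : E3} (hl : l ≠ 0) :
    (2 * inner ℝ l a) • l - a = -a ↔ inner ℝ l a = 0 := by
  rw [sub_eq_neg_self, smul_eq_zero, or_iff_left hl]
  simp

/-! ### Softness and standardness -/

theorem baseEdge_subset_cA : baseEdge ⊆ voronoiCell cA := by
  rw [← biInter_baseEdge]; exact Set.biInter_subset_of_mem (by simp)
theorem baseEdge_subset_cB : baseEdge ⊆ voronoiCell cB := by
  rw [← biInter_baseEdge]; exact Set.biInter_subset_of_mem (by simp)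
theorem baseEdge_subset_cC : baseEdge ⊆ voronoiCell cC := by
  rw [← biInter_baseEdge]; exact Set.biInter_subset_of_mem (by simp)

theorem image_subset_voronoiCell {g : E3 ≃ᵃⁱ[ℝ] E3} (hg : g ∈ Pn3m) {S : Set E3} {c : E3}
    (h : S ⊆ voronoiCell c) : g '' S ⊆ voronoiCell (g c) := by
  rw [← image_voronoiCell (Pn3m_subset_Im3m hg)]
  exact Set.image_mono h

theorem trans_symm_linear_apply (g k : E3 ≃ᵃⁱ[ℝ] E3) (u : E3) :
    (g.trans k.symm).linearIsometryEquiv u =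
      k.symm.linearIsometryEquiv (g.linearIsometryEquiv u) := rfl

namespace E2Tiling

variable {M : E2Tiling} {a : E3}

/-- Two half-tangents at the origin are images of a under stabilizer elements; if they are opposite,
the quotient of these elements sends a to -a. The identity cannot do so, and a half-turn does so
exactly when a is orthogonal to its axis. For the converse it suffices to find a suitable pair of
edges in the cell of `cD`, since flags of a cell and a node are also transitive. -/
theorem isSoft_iff (hM : M.HasSecondOrderPn3mSymmetry) (ha : M.HalfTangent baseEdge 0 a) :
    M.IsSoft ↔ inner ℝ axisU a = 0 ∨ inner ℝ axisP a = 0 ∨ inner ℝ axisQ a = 0 := by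
  have ha1 := ha.norm_eq_one isEdge_baseEdge isNode_zero zero_mem_baseEdge
  constructor
  · intro h
    obtain ⟨e₁, e₂, u₁, u₂, he₁, he₂, -, -, h₁, h₂, hu₁, hu₂, hi⟩ := h cA cA_mem 0
      (baseEdge_subset_cA zero_mem_baseEdge) isNode_zero
    obtain ⟨g, hg, rfl, hg0⟩ := exists_edge_flag he₁ isNode_zero h₁
    obtain ⟨k, hk, rfl, hk0⟩ := exists_edge_flag he₂ isNode_zero h₂
    nth_rw 1 [← hg0] at hu₁
    nth_rw 1 [← hk0] at hu₂
    rw [halfTangent_flag_iff hM ha hg] at hu₁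
    rw [halfTangent_flag_iff hM ha hk] at hu₂
    rw [inner_eq_neg_one_iff_of_norm_eq_one (by rw [hu₁, LinearIsometryEquiv.norm_map, ha1])
      (by rw [hu₂, LinearIsometryEquiv.norm_map, ha1]), hu₁, hu₂] at hi
    have hr : (g.trans k.symm).linearIsometryEquiv a = -a := by
      rw [trans_symm_linear_apply, hi, map_neg, symm_linear_apply]
    have hr0 : (g.trans k.symm) 0 = 0 := by
      rw [AffineIsometryEquiv.coe_trans, Function.comp_apply, hg0]
      nth_rw 1 [← hk0]
      simp
    rcases stabilizer_origin (Pn3m.trans_mem hg (Pn3m.symm_mem hk)) hr0 with e | e | e | e <;>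
      rw [e] at hr
    · exfalso
      have : a = -a := hr
      have h2 : (2 : ℝ) • a = 0 := by
        rw [two_smul]
        nth_rw 1 [this]
        simp
      rw [(smul_eq_zero.1 h2).resolve_left two_ne_zero, norm_zero] at ha1
      exact zero_ne_one ha1
    · rw [rotU_linear, reflection_eq_neg_iff axisU_ne_zero] at hr
      exact Or.inl hr
    · rw [rotP_linear, reflection_eq_neg_iff axisP_ne_zero] at hr
      exact Or.inr (Or.inl hr)
    · rw [rotQ_linear, reflection_eq_neg_iff axisQ_ne_zero] at hr
      exact Or.inr (Or.inr hr)
  · intro h c hc v hvc hv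
    obtain ⟨g, hg, rfl, rfl⟩ := exists_cell_flag hc hv hvc
    have key : ∀ {r s : E3 ≃ᵃⁱ[ℝ] E3} {x y : E3}, r ∈ Pn3m → s ∈ Pn3m → r 0 = 0 → s 0 = 0 →
        baseEdge ⊆ voronoiCell x → baseEdge ⊆ voronoiCell y → r x = cD → s y = cD →
        r.linearIsometryEquiv a = -s.linearIsometryEquiv a →
        ∃ e₁ e₂ u₁ u₂, IsEdge e₁ ∧ IsEdge e₂ ∧ e₁ ⊆ voronoiCell (g cD) ∧
          e₂ ⊆ voronoiCell (g cD) ∧ g 0 ∈ e₁ ∧ g 0 ∈ e₂ ∧ M.HalfTangent e₁ (g 0) u₁ ∧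
          M.HalfTangent e₂ (g 0) u₂ ∧ inner ℝ u₁ u₂ = -1 := by
      intro r s x y hr hs hr0 hs0 hx hy hrx hsy hrs
      have mem : ∀ {r : E3 ≃ᵃⁱ[ℝ] E3} {x : E3}, r ∈ Pn3m → r 0 = 0 → baseEdge ⊆ voronoiCell x →
          r x = cD → IsEdge (r.trans g '' baseEdge) ∧
          r.trans g '' baseEdge ⊆ voronoiCell (g cD) ∧ g 0 ∈ r.trans g '' baseEdge ∧
          M.HalfTangent (r.trans g '' baseEdge) (g 0) ((r.trans g).linearIsometryEquiv a) := by
        intro r x hr hr0 hx hrx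
        have e0 : g 0 = r.trans g 0 := by simp [hr0]
        refine ⟨isEdge_image (Pn3m.trans_mem hr hg), ?_, ?_, ?_⟩
        · have := image_subset_voronoiCell (Pn3m.trans_mem hr hg) hx
          simpa [hrx] using this
        · rw [e0]; exact image_zero_mem _
        · rw [e0]; exact (halfTangent_flag_iff hM ha (Pn3m.trans_mem hr hg)).2 rfl
      obtain ⟨p1, p2, p3, p4⟩ := mem hr hr0 hx hrx
      obtain ⟨q1, q2, q3, q4⟩ := mem hs hs0 hy hsy
      refine ⟨_, _, _, _, p1, q1, p2, q2, p3, q3, p4, q4, ?_⟩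
      change inner ℝ (g.linearIsometryEquiv (r.linearIsometryEquiv a))
        (g.linearIsometryEquiv (s.linearIsometryEquiv a)) = -1
      rw [hrs, map_neg, inner_neg_left, real_inner_self_eq_norm_sq, LinearIsometryEquiv.norm_map,
        LinearIsometryEquiv.norm_map, ha1]
      norm_num
    rcases h with h | h | h
    -- The base edge itself is not in the cell of `cD`, so the pair is formed by its images under
    -- the two other half-turns; these images are interchanged by the half-turn U. The next two
    -- cases are analogous.
    · refine key rotP_mem rotQ_mem rotP_zero rotQ_zero baseEdge_subset_cB baseEdge_subset_cA
        rotP_cB rotQ_cA ?_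
      rw [inner_axisU] at h
      have h : lcoord a 0 = 0 := by simpa using h
      apply lcoord_injective
      funext i
      rw [lcoord_neg, rotP_spec.lcoord, rotQ_spec.lcoord]
      have : (Equiv.swap 1 2 : Equiv.Perm (Fin 3)) 0 = 0 := by decide
      fin_cases i <;> simp [this, h]
    · refine key rotU_mem rotQ_mem rotU_zero rotQ_zero baseEdge_subset_cC baseEdge_subset_cA
        rotU_cC rotQ_cA ?_
      rw [inner_axisP] at h
      apply lcoord_injective
      funext i
      rw [lcoord_neg, rotU_spec.lcoord, rotQ_spec.lcoord]
      have e0 : (Equiv.swap 1 2 : Equiv.Perm (Fin 3)) 0 = 0 := by decide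
      have e2 : (Equiv.swap 1 2 : Equiv.Perm (Fin 3)) 2 = 1 := by decide
      fin_cases i <;> simp [e0, e2] <;> linarith
    · refine key rotU_mem rotP_mem rotU_zero rotP_zero baseEdge_subset_cC baseEdge_subset_cB
        rotU_cC rotP_cB ?_
      rw [inner_axisQ] at h
      apply lcoord_injective
      funext i
      rw [lcoord_neg, rotU_spec.lcoord, rotP_spec.lcoord]
      have e0 : (Equiv.swap 1 2 : Equiv.Perm (Fin 3)) 0 = 0 := by decide
      have e2 : (Equiv.swap 1 2 : Equiv.Perm (Fin 3)) 2 = 1 := by decide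
      fin_cases i <;> simp [e0, e2] <;> linarith

theorem isStandard_iff (hM : M.HasSecondOrderPn3mSymmetry) (ha : M.HalfTangent baseEdge 0 a) :
    M.IsStandard ↔ ∀ k ∈ Pn3m, k 0 = 0 →
      k.linearIsometryEquiv a = a ∨ k.linearIsometryEquiv a = -a := by
  constructor
  · intro h k hk hk0
    refine h 0 _ _ _ _ isNode_zero (isEdge_image hk) isEdge_baseEdge ?_ zero_mem_baseEdge ?_ ha
    · nth_rw 1 [← hk0]; exact image_zero_mem k
    · nth_rw 1 [← hk0]; exact (halfTangent_flag_iff hM ha hk).2 rfl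
  · intro h v e₁ e₂ u₁ u₂ hv he₁ he₂ h₁ h₂ hu₁ hu₂
    obtain ⟨g, hg, rfl, rfl⟩ := exists_edge_flag he₁ hv h₁
    obtain ⟨k, hk, rfl, hk0⟩ := exists_edge_flag he₂ hv h₂
    rw [← hk0] at hu₂
    rw [halfTangent_flag_iff hM ha hg] at hu₁
    rw [halfTangent_flag_iff hM ha hk] at hu₂
    have h1 := h _ (Pn3m.trans_mem hg (Pn3m.symm_mem hk)) (by simp [← hk0])
    rw [trans_symm_linear_apply] at h1
    rw [hu₁, hu₂]
    refine h1.imp (fun h => ?_) (fun h => ?_)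
    · rw [← linear_symm_apply k (g.linearIsometryEquiv a), h]
    · rw [← linear_symm_apply k (g.linearIsometryEquiv a), h, map_neg]

theorem leavesForward_iff (hM : M.HasSecondOrderPn3mSymmetry) (ha : M.HalfTangent baseEdge 0 a) :
    M.LeavesForward ↔ 0 < a 0 := by
  have e : inner ℝ a (!₂[1, 0, 0] - 0) = a 0 := by
    simp [PiLp.inner_apply, Fin.sum_univ_three]
  constructor
  · intro h
    rw [← e]
    exact h baseEdge 0 _ a isEdge_baseEdge isNode_zero isNode_e1 zero_mem_baseEdge
      e1_mem_baseEdge (hasCoord_zero.ne hasCoord_e1 (by decide)) ha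
  · intro h d v w u hd hv hw hvd hwd hne hu
    obtain ⟨g, hg, rfl, rfl, rfl⟩ := exists_edge_flag_of_ne hd hv hw hvd hwd hne
    rw [halfTangent_flag_iff hM ha hg] at hu
    rw [hu, ← linear_eq_sub, LinearIsometryEquiv.inner_map_map, e]
    exact h

end E2Tiling

/-! ### Planes of faces -/

/-- The linear form with integral coefficients `N` in the scaled cubic coordinates. -/
noncomputable def latticeForm (N : Fin 3 → ℤ) (v : E3) : ℝ := ∑ i, N i * lcoord v i

/-- The affine form with integral coefficients `N` in the scaled cubic coordinates. -/
noncomputable def latticeHeight (N : Fin 3 → ℤ) (x : E3) : ℝ := ∑ i, N i * coord x i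

theorem latticeForm_sub (N : Fin 3 → ℤ) (x y : E3) :
    latticeForm N (x - y) = latticeHeight N x - latticeHeight N y := by
  simp only [latticeForm, latticeHeight, lcoord_sub, mul_sub, Finset.sum_sub_distrib]

/-- A vector orthogonal to the planes `latticeHeight N x = d`. -/
noncomputable def latticeNormal (N : Fin 3 → ℤ) : E3 :=
  ofCoord (fun i => (N i : ℝ)) - ofCoord 0

theorem lcoord_latticeNormal (N : Fin 3 → ℤ) (i : Fin 3) : lcoord (latticeNormal N) i = N i := by
  rw [latticeNormal, lcoord_sub, coord_ofCoord, coord_ofCoord]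
  simp

theorem inner_latticeNormal (N : Fin 3 → ℤ) (v : E3) :
    inner ℝ (latticeNormal N) v = latticeForm N v / 2 := by
  rw [inner_eq_lcoord, latticeForm]
  simp only [lcoord_latticeNormal]

theorem latticeNormal_ne_zero {N : Fin 3 → ℤ} (h : N ≠ 0) : latticeNormal N ≠ 0 := by
  intro h'
  apply h
  funext i
  have := lcoord_latticeNormal N i
  rw [h'] at this
  have h0 : lcoord 0 i = 0 := by fin_cases i <;> simp [lcoord]
  rw [h0] at this
  exact_mod_cast this.symm

/-- The height of an image point modulo 4 depends only on the signed permutation. A condition on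
infinitely many group elements is thus implied by one on 48. -/
theorem IsSignedPerm.latticeHeight_mod {g : E3 ≃ᵃⁱ[ℝ] E3} {σ : Equiv.Perm (Fin 3)}
    {ε : Fin 3 → ℤˣ} {t : Fin 3 → ℤ} (H : IsSignedPerm g σ ε t)
    (ht : ∀ i, t i % 4 = if ∏ j, ε j = 1 then 0 else 2) {p : E3} {x : Fin 3 → ℤ}
    (hp : HasCoord p x) {N : Fin 3 → ℤ} {d : ℤ} (hd : latticeHeight N (g p) = d) :
    (∑ i, N i * (ε i * x (σ i) + if ∏ j, ε j = 1 then 0 else 2)) % 4 = d % 4 := by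
  have h1 : ∑ i, N i * (ε i * x (σ i) + t i) = d := by
    have := hd
    simp only [latticeHeight, H.hasCoord hp _] at this
    exact_mod_cast this
  rw [← h1]
  refine Int.ModEq.sum (n := 4) fun i _ => Int.ModEq.mul_left _ (Int.ModEq.add_left _ ?_)
  have := ht i
  simp only [Int.ModEq]
  split_ifs at this ⊢ <;> omega

/-- A lattice plane with the property that the elements of `Pn3m` that move the base edge into
the plane preserve its direction. -/
def IsFlagPlane (N : Fin 3 → ℤ) (d : ℤ) : Prop :=
  ∀ (σ : Equiv.Perm (Fin 3)) (ε : Fin 3 → ℤˣ),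
    (∑ i, N i * (ε i * (![-1, 0, -2] : Fin 3 → ℤ) (σ i) +
      if ∏ j, ε j = 1 then 0 else 2)) % 4 = d % 4 →
    (∑ i, N i * (ε i * (![0, 1, -2] : Fin 3 → ℤ) (σ i) +
      if ∏ j, ε j = 1 then 0 else 2)) % 4 = d % 4 →
    (∀ i, N i * ε i = N (σ i)) ∨ ∀ i, N i * ε i = -N (σ i)

/-- If both ends of the moved base edge have the right height, the signed permutation sends the
normal to itself or its negative, so vectors parallel to the plane stay parallel to it. -/
theorem IsFlagPlane.latticeForm {N : Fin 3 → ℤ} {d : ℤ} (hN : IsFlagPlane N d)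
    {g : E3 ≃ᵃⁱ[ℝ] E3} (hg : g ∈ Pn3m) (h0 : latticeHeight N (g 0) = d)
    (h1 : latticeHeight N (g !₂[1, 0, 0]) = d) {a : E3} (ha : latticeForm N a = 0) :
    _root_.latticeForm N (g.linearIsometryEquiv a) = 0 := by
  obtain ⟨σ, ε, t, H, ht⟩ := (mem_Pn3m_iff g).1 hg
  have e : ∑ i, (N (σ i) : ℝ) * lcoord a (σ i) = 0 := by
    rw [Equiv.sum_comp σ (fun i => (N i : ℝ) * lcoord a i)]
    exact ha
  rw [_root_.latticeForm]
  rcases hN σ ε (H.latticeHeight_mod ht hasCoord_zero h0) (H.latticeHeight_mod ht hasCoord_e1 h1)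
    with h | h
  · rw [← e]
    refine Finset.sum_congr rfl fun i _ => ?_
    rw [H.lcoord, ← mul_assoc, ← h]
    push_cast
    rfl
  · rw [← neg_eq_zero, ← e, ← Finset.sum_neg_distrib]
    refine Finset.sum_congr rfl fun i _ => ?_
    rw [H.lcoord, ← mul_assoc, ← neg_mul]
    congr 1
    have := h i
    rw [eq_neg_iff_add_eq_zero, add_comm, ← eq_neg_iff_add_eq_zero] at this
    rw [this]
    push_cast
    rfl

theorem isFlagPlane_quad : IsFlagPlane ![0, 0, 1] (-2) := by unfold IsFlagPlane; decide
theorem isFlagPlane_hex₁ : IsFlagPlane ![1, -1, 1] (-3) := by unfold IsFlagPlane; decide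
theorem isFlagPlane_hex₂ : IsFlagPlane ![1, -1, -1] 1 := by unfold IsFlagPlane; decide

/-- One of the three faces at the base edge, in the plane `latticeHeight N x = d`, and the rotation
about the origin that preserves the face. -/
structure IsBaseFace (F : Set E3) (N : Fin 3 → ℤ) (d : ℤ) (r : E3 ≃ᵃⁱ[ℝ] E3) : Prop where
  isFace : IsFace F
  exists_centre : ∃ c ∈ bcc, F ⊆ voronoiCell c
  height : ∀ x ∈ F, latticeHeight N x = d
  isFlagPlane : IsFlagPlane N d
  ne_zero : N ≠ 0
  baseEdge_subset : baseEdge ⊆ F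
  rot_mem : r ∈ Pn3m
  rot_zero : r 0 = 0
  rot_subset : r '' baseEdge ⊆ F
  exists_smul : ∀ n : E3, inner ℝ n !₂[1, 0, 0] = 0 →
    inner ℝ n (r.linearIsometryEquiv !₂[1, 0, 0]) = 0 → ∃ s : ℝ, n = s • latticeNormal N

theorem voronoiCell_inter_height {c c' x : E3} {y y' : Fin 3 → ℤ} (hc : HasCoord c y)
    (hc' : HasCoord c' y') (hm : c ∈ bcc) (hm' : c' ∈ bcc)
    (hx : x ∈ voronoiCell c ∩ voronoiCell c') :
    2 * latticeHeight (y - y') x = ∑ i, ((y i : ℝ) ^ 2 - (y' i : ℝ) ^ 2) := by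
  have h1 := (dist_le_dist_iff_coord _ _ _).1 (hx.1 _ hm')
  have h2 := (dist_le_dist_iff_coord _ _ _).1 (hx.2 _ hm)
  simp only [hc _, hc' _, Fin.sum_univ_three, latticeHeight, Pi.sub_apply, Int.cast_sub]
    at h1 h2 ⊢
  nlinarith

theorem lcoord_e1 : lcoord !₂[1, 0, 0] = ![1, 1, 0] := by
  funext i; fin_cases i <;> simp [lcoord]

theorem inner_e1 (n : E3) : inner ℝ n !₂[1, 0, 0] = (lcoord n 0 + lcoord n 1) / 2 := by
  rw [inner_eq_lcoord, lcoord_e1]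
  simp [Fin.sum_univ_three]

theorem isBaseFace_quad : IsBaseFace quadFace ![0, 0, 1] (-2) rotU where
  isFace := isFace_inter (by simp [mem_originCentres]) (by simp [mem_originCentres]) cA_ne_cB
  exists_centre := ⟨cA, cA_mem, Set.inter_subset_left⟩
  height x hx := by
    have := voronoiCell_inter_height hasCoord_cA hasCoord_cB cA_mem cB_mem hx
    simp [latticeHeight, Fin.sum_univ_three] at this ⊢
    linarith
  isFlagPlane := isFlagPlane_quad
  ne_zero := by decide
  baseEdge_subset := Set.subset_inter baseEdge_subset_cA baseEdge_subset_cB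
  rot_mem := rotU_mem
  rot_zero := rotU_zero
  rot_subset := Set.subset_inter
    (rotU_cB ▸ image_subset_voronoiCell rotU_mem baseEdge_subset_cB)
    (rotU_cA ▸ image_subset_voronoiCell rotU_mem baseEdge_subset_cA)
  exists_smul n h h' := by
    rw [rotU_linear, inner_sub_right, inner_smul_right, h, inner_axisU, real_inner_comm,
      inner_axisU, lcoord_e1] at h'
    rw [inner_e1] at h
    simp at h'
    refine ⟨lcoord n 2, lcoord_injective (funext fun i => ?_)⟩
    rw [lcoord_smul, lcoord_latticeNormal]
    fin_cases i <;> simp <;> linarith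

theorem isBaseFace_hex₁ : IsBaseFace hexFace₁ ![1, -1, 1] (-3) rotP where
  isFace := isFace_inter (by simp [mem_originCentres]) (by simp [mem_originCentres]) cA_ne_cC
  exists_centre := ⟨cA, cA_mem, Set.inter_subset_left⟩
  height x hx := by
    have := voronoiCell_inter_height hasCoord_cA hasCoord_cC cA_mem cC_mem hx
    simp [latticeHeight, Fin.sum_univ_three] at this ⊢
    linarith
  isFlagPlane := isFlagPlane_hex₁
  ne_zero := by decide
  baseEdge_subset := Set.subset_inter baseEdge_subset_cA baseEdge_subset_cC
  rot_mem := rotP_mem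
  rot_zero := rotP_zero
  rot_subset := Set.subset_inter
    (rotP_cC ▸ image_subset_voronoiCell rotP_mem baseEdge_subset_cC)
    (rotP_cA ▸ image_subset_voronoiCell rotP_mem baseEdge_subset_cA)
  exists_smul n h h' := by
    rw [rotP_linear, inner_sub_right, inner_smul_right, h, inner_axisP, real_inner_comm,
      inner_axisP, lcoord_e1] at h'
    rw [inner_e1] at h
    simp at h'
    refine ⟨lcoord n 2, lcoord_injective (funext fun i => ?_)⟩
    rw [lcoord_smul, lcoord_latticeNormal]
    fin_cases i <;> simp <;> linarith

theorem isBaseFace_hex₂ : IsBaseFace hexFace₂ ![1, -1, -1] 1 rotQ where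
  isFace := isFace_inter (by simp [mem_originCentres]) (by simp [mem_originCentres]) cB_ne_cC
  exists_centre := ⟨cB, cB_mem, Set.inter_subset_left⟩
  height x hx := by
    have := voronoiCell_inter_height hasCoord_cB hasCoord_cC cB_mem cC_mem hx
    simp [latticeHeight, Fin.sum_univ_three] at this ⊢
    linarith
  isFlagPlane := isFlagPlane_hex₂
  ne_zero := by decide
  baseEdge_subset := Set.subset_inter baseEdge_subset_cB baseEdge_subset_cC
  rot_mem := rotQ_mem
  rot_zero := rotQ_zero
  rot_subset := Set.subset_inter
    (rotQ_cC ▸ image_subset_voronoiCell rotQ_mem baseEdge_subset_cC)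
    (rotQ_cB ▸ image_subset_voronoiCell rotQ_mem baseEdge_subset_cB)
  exists_smul n h h' := by
    rw [rotQ_linear, inner_sub_right, inner_smul_right, h, inner_axisQ, real_inner_comm,
      inner_axisQ, lcoord_e1] at h'
    rw [inner_e1] at h
    simp at h'
    refine ⟨-lcoord n 2, lcoord_injective (funext fun i => ?_)⟩
    rw [lcoord_smul, lcoord_latticeNormal]
    fin_cases i <;> simp <;> linarith

theorem Pn3m.exists_map_eq {c c' : E3} (hc : c ∈ bcc) (hc' : c' ∈ bcc) : ∃ g ∈ Pn3m, g c = c' := by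
  obtain ⟨g, hg, h⟩ := Pn3m.exists_map_eq_cA hc
  obtain ⟨k, hk, h'⟩ := Pn3m.exists_map_eq_cA hc'
  exact ⟨g.trans k.symm, Pn3m.trans_mem hg (Pn3m.symm_mem hk), by simp [h, ← h']⟩

theorem IsBaseFace.exists_image {F : Set E3} {N : Fin 3 → ℤ} {d : ℤ} {r : E3 ≃ᵃⁱ[ℝ] E3}
    (hF : IsBaseFace F N d r) {c : E3} (hc : c ∈ bcc) :
    ∃ g ∈ Pn3m, IsFace (g '' F) ∧ g '' F ⊆ voronoiCell c := by
  obtain ⟨c₀, h₀, h⟩ := hF.exists_centre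
  obtain ⟨g, hg, rfl⟩ := Pn3m.exists_map_eq h₀ hc
  exact ⟨g, hg, Im3m.image_isStratum (Pn3m_subset_Im3m hg) hF.isFace,
    image_subset_voronoiCell hg h⟩

namespace E2Tiling

variable {M : E2Tiling} {a : E3}

/-- The base edge and its image under the half-turn that preserves the face are two independent
directions in the face. The nodes at their ends therefore already determine the normal up to a
factor, and the half-tangent of the base edge is orthogonal to it. -/
theorem latticeForm_eq_zero_of_planar (hM : M.HasSecondOrderPn3mSymmetry)
    (ha : M.HalfTangent baseEdge 0 a) {F : Set E3} {N : Fin 3 → ℤ} {d : ℤ} {r : E3 ≃ᵃⁱ[ℝ] E3}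
    (hF : IsBaseFace F N d r) {g : E3 ≃ᵃⁱ[ℝ] E3} (hg : g ∈ Pn3m) {n : E3} {b : ℝ} (hn : n ≠ 0)
    (h1 : ∀ v ∈ g '' F, IsNode v → inner ℝ n v = b)
    (h2 : ∀ e v u, IsEdge e → e ⊆ g '' F → IsNode v → v ∈ e → M.HalfTangent e v u →
      inner ℝ n u = 0) : latticeForm N a = 0 := by
  set m := g.symm.linearIsometryEquiv n with hm
  have hmn : n = g.linearIsometryEquiv m := by rw [hm, linear_symm_apply]
  have key : ∀ k ∈ Pn3m, k 0 = 0 → k '' baseEdge ⊆ F →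
      inner ℝ m (k.linearIsometryEquiv !₂[1, 0, 0]) = 0 := by
    intro k hk hk0 hkF
    have e1 := h1 (g (k !₂[1, 0, 0]))
      (Set.mem_image_of_mem _ (hkF (Set.mem_image_of_mem _ e1_mem_baseEdge)))
      (Im3m.image_isNode (Pn3m_subset_Im3m hg) (Im3m.image_isNode (Pn3m_subset_Im3m hk) isNode_e1))
    have e0 := h1 (g (k 0))
      (Set.mem_image_of_mem _ (hkF (image_zero_mem k)))
      (Im3m.image_isNode (Pn3m_subset_Im3m hg) (isNode_image_zero hk))
    have : inner ℝ n (g (k !₂[1, 0, 0]) - g (k 0)) = 0 := by rw [inner_sub_right, e1, e0, sub_self]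
    rwa [← linear_eq_sub, ← linear_eq_sub, sub_zero, hmn, LinearIsometryEquiv.inner_map_map] at this
  obtain ⟨s, hs⟩ := hF.exists_smul m
    (key _ Pn3m.refl_mem rfl (by simpa using hF.baseEdge_subset))
    (key _ hF.rot_mem hF.rot_zero hF.rot_subset)
  have h3 := h2 (g '' baseEdge) (g 0) _ (isEdge_image hg) (Set.image_mono hF.baseEdge_subset)
    (isNode_image_zero hg) (image_zero_mem g) ((halfTangent_flag_iff hM ha hg).2 rfl)
  rw [hmn, LinearIsometryEquiv.inner_map_map, hs, inner_smul_left, inner_latticeNormal] at h3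
  rcases mul_eq_zero.1 h3 with h | h
  · exfalso
    have h' : s = 0 := h
    rw [h', zero_smul] at hs
    rw [hs, map_zero] at hmn
    exact hn hmn
  · linarith

/-- Every edge of the face is an image of the base edge inside the same plane, and such images keep
a parallel to the plane by `IsFlagPlane.latticeForm`. -/
theorem planar_of_latticeForm_eq_zero (hM : M.HasSecondOrderPn3mSymmetry)
    (ha : M.HalfTangent baseEdge 0 a) {F : Set E3} {N : Fin 3 → ℤ} {d : ℤ} {r : E3 ≃ᵃⁱ[ℝ] E3}
    (hF : IsBaseFace F N d r) (h : latticeForm N a = 0) : M.HasSecondOrderPlanarFaces := by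
  intro c hc
  obtain ⟨g, hg, h1, h2⟩ := hF.exists_image hc
  refine ⟨g '' F, h1, h2, g.linearIsometryEquiv (latticeNormal N),
    inner ℝ (g.linearIsometryEquiv (latticeNormal N)) (g 0), ?_, ?_, ?_⟩
  · rw [Ne, LinearIsometryEquiv.map_eq_zero_iff]
    exact latticeNormal_ne_zero hF.ne_zero
  · rintro _ ⟨x, hx, rfl⟩ -
    rw [← sub_eq_zero, ← inner_sub_right, ← linear_eq_sub, LinearIsometryEquiv.inner_map_map,
      inner_latticeNormal, latticeForm_sub, hF.height x hx,
      hF.height 0 (hF.baseEdge_subset zero_mem_baseEdge)]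
    simp
  · intro e v u he heF hv hve hu
    obtain ⟨k, hk, rfl, rfl⟩ := exists_edge_flag he hv hve
    rw [halfTangent_flag_iff hM ha hk] at hu
    have hm : ∀ x ∈ baseEdge, latticeHeight N ((k.trans g.symm) x) = d := by
      intro x hx
      obtain ⟨y, hy, hyx⟩ := heF (Set.mem_image_of_mem k hx)
      rw [AffineIsometryEquiv.coe_trans, Function.comp_apply, ← hyx, g.symm_apply_apply]
      exact hF.height y hy
    have := hF.isFlagPlane.latticeForm (Pn3m.trans_mem hk (Pn3m.symm_mem hg))
      (hm 0 zero_mem_baseEdge) (hm _ e1_mem_baseEdge) h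
    rw [trans_symm_linear_apply, ← hu] at this
    rw [← linear_symm_apply g u, LinearIsometryEquiv.inner_map_map, inner_latticeNormal, this,
      zero_div]

theorem hasSecondOrderPlanarFaces_iff (hM : M.HasSecondOrderPn3mSymmetry)
    (ha : M.HalfTangent baseEdge 0 a) : M.HasSecondOrderPlanarFaces ↔
      latticeForm ![0, 0, 1] a = 0 ∨ latticeForm ![1, -1, 1] a = 0 ∨
        latticeForm ![1, -1, -1] a = 0 := by
  constructor
  · intro h
    obtain ⟨F, hF, -, n, d, hn, h1, h2⟩ := h cA cA_mem
    obtain ⟨g, hg, F₀, rfl | rfl | rfl, rfl⟩ := hF.exists_image_eq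
    · exact Or.inl (latticeForm_eq_zero_of_planar hM ha isBaseFace_quad hg hn h1 h2)
    · exact Or.inr (Or.inl (latticeForm_eq_zero_of_planar hM ha isBaseFace_hex₁ hg hn h1 h2))
    · exact Or.inr (Or.inr (latticeForm_eq_zero_of_planar hM ha isBaseFace_hex₂ hg hn h1 h2))
  · rintro (h | h | h)
    · exact planar_of_latticeForm_eq_zero hM ha isBaseFace_quad h
    · exact planar_of_latticeForm_eq_zero hM ha isBaseFace_hex₁ h
    · exact planar_of_latticeForm_eq_zero hM ha isBaseFace_hex₂ h

/-! ### Symmetry and planarity imply their second-order versions -/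

/-- Chords from a node to points of a planar face are orthogonal to its normal, and so is their
limiting direction. The nodes themselves are fixed. -/
theorem HasPlanarFaces.secondOrder (h : M.HasPlanarFaces) : M.HasSecondOrderPlanarFaces := by
  intro c hc
  obtain ⟨F, hF, hFc, n, d, hn, H⟩ := h c hc
  refine ⟨F, hF, hFc, n, d, hn, fun v hv hv' => ?_, fun e v u he heF hv hve hu => ?_⟩
  · exact H v ⟨v, hv, M.map_node v hv'⟩
  · have := (M.exists_arc he hv hve).1
    have h1 : Tendsto (fun x : E3 => inner ℝ n (‖x - v‖⁻¹ • (x - v)))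
        (𝓝[M.toHomeo '' e \ {v}] v) (𝓝 (inner ℝ n u)) :=
      ((continuous_const.inner continuous_id).tendsto u).comp hu
    refine tendsto_nhds_unique h1 (tendsto_const_nhds.congr' ?_)
    filter_upwards [self_mem_nhdsWithin] with x hx
    rw [inner_smul_right, inner_sub_right, H x (Set.image_mono heF hx.1),
      H v ⟨v, heF hve, M.map_node v hv⟩, sub_self, mul_zero]

theorem mem_cell_iff_of_isNode {v c : E3} (hv : IsNode v) : v ∈ M.cell c ↔ v ∈ voronoiCell c := by
  constructor
  · rintro ⟨x, hx, h⟩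
    rw [← M.map_node v hv] at h
    rwa [← M.toHomeo.injective h]
  · intro h
    exact ⟨v, h, M.map_node v hv⟩

/-- A node common to both cells is equidistant from c and c'. Two nodes of the cell that are
antipodal with respect to c have c as midpoint, and all distances equal to the same number force c'
= c by the parallelogram law. -/
theorem eq_of_antipodal_nodes {c c' : E3} (hc : c ∈ bcc) (hc' : c' ∈ bcc)
    (h : ∀ v, IsNode v → v ∈ voronoiCell c → v ∈ voronoiCell c') : c' = c := by
  obtain ⟨g, hg, rfl⟩ := Pn3m.exists_map_eq cA_mem hc
  obtain ⟨j, J⟩ := exists_isSignedPerm 1 (-1) 0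
  have hj : j '' bcc ⊆ bcc := by
    rintro _ ⟨c, hc, rfl⟩
    exact J.map_bcc 0 (by simp) (by simp) hc
  have hjj : ∀ x, j (j x) = x := fun x => coord_injective (funext fun i => by
    rw [J, J]; simp)
  have hj' : j ∈ Im3m := by
    refine Set.Subset.antisymm hj fun x hx => ⟨j x, hj (Set.mem_image_of_mem j hx), hjj x⟩
  have hjA : j cA = cA := J.apply_eq hasCoord_cA hasCoord_cA (by decide)
  have hsum : j 0 + 0 = cA + cA := by
    have : j 0 - cA = cA - 0 := lcoord_injective (funext fun i => by
      rw [lcoord_sub, lcoord_sub, J, hasCoord_cA, hasCoord_zero]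
      fin_cases i <;> simp [hasCoord_zero _])
    rw [sub_eq_sub_iff_add_eq_add] at this
    exact this
  have h0 : (0 : E3) ∈ voronoiCell cA := baseEdge_subset_cA zero_mem_baseEdge
  have hj0 : j 0 ∈ voronoiCell cA := by
    have := (Im3m.image_voronoiCell hj' 0 cA).2 h0
    rwa [hjA] at this
  have eqd : ∀ v, IsNode v → v ∈ voronoiCell cA → dist (g v) c' = dist v cA := by
    intro v hv hvA
    have h1 := (Im3m.image_voronoiCell (Pn3m_subset_Im3m hg) v cA).2 hvA
    have h2 := h _ (Im3m.image_isNode (Pn3m_subset_Im3m hg) hv) h1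
    rw [← g.dist_map v cA]
    exact le_antisymm (h2 _ hc) (h1 _ hc')
  have d0 := eqd 0 isNode_zero h0
  have d1 := eqd (j 0) (Im3m.image_isNode hj' isNode_zero) hj0
  have d2 : dist (j 0) cA = dist 0 cA := by
    conv_lhs => rw [← hjA]
    exact j.dist_map 0 cA
  have hmid : g (j 0) + g 0 = g cA + g cA := by
    have : g.linearIsometryEquiv (j 0 - cA) = g.linearIsometryEquiv (cA - 0) := by
      rw [eq_sub_of_add_eq hsum]
      congr 1
      abel
    rw [linear_eq_sub, linear_eq_sub, sub_eq_sub_iff_add_eq_add] at this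
    exact this
  have d3 : dist (g 0) (g cA) = dist 0 cA := g.dist_map 0 cA
  rw [d2] at d1
  rw [dist_eq_norm] at d0 d1 d3
  -- The sum and the difference of these vectors are the differences between c' and the two
  -- antipodal nodes; both have the same norm as the second vector, so the first vanishes.
  have hp := parallelogram_law_with_norm ℝ (g cA - c') (g cA - g 0)
  have e1 : g cA - c' + (g cA - g 0) = g (j 0) - c' := by
    rw [eq_sub_of_add_eq hmid]; abel
  have e2 : g cA - c' - (g cA - g 0) = g 0 - c' := by abel
  rw [e1, e2, d0, d1, norm_sub_rev (g cA) (g 0), d3] at hp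
  have : ‖g cA - c'‖ = 0 := by nlinarith [norm_nonneg (g cA - c')]
  rw [norm_eq_zero, sub_eq_zero] at this
  exact this.symm

/-- Symmetry as assumed only permutes the cells of the tiling. Since nodes are fixed, a cell of the
tiling has the nodes of its Voronoi cell, and these identify which cell the image is. -/
theorem image_cell (hM : M.HasPn3mSymmetry) {g : E3 ≃ᵃⁱ[ℝ] E3} (hg : g ∈ Pn3m) {c : E3}
    (hc : c ∈ bcc) : g '' M.cell c = M.cell (g c) := by
  obtain ⟨c', hc', h⟩ := hM g hg c hc
  rw [h]
  congr 1
  refine eq_of_antipodal_nodes (Pn3m.map_bcc hg hc) hc' fun v hv hvc => ?_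
  rw [← mem_cell_iff_of_isNode (M := M) hv, ← h]
  have hg' := Im3m.symm_mem (Pn3m_subset_Im3m hg)
  refine ⟨g.symm v, ?_, by simp⟩
  rw [mem_cell_iff_of_isNode (Im3m.image_isNode hg' hv),
    ← Im3m.image_voronoiCell (Pn3m_subset_Im3m hg)]
  simpa using hvc

theorem image_biInter_cell (hM : M.HasPn3mSymmetry) {g : E3 ≃ᵃⁱ[ℝ] E3} (hg : g ∈ Pn3m)
    {s : Set E3} (hs : s ⊆ bcc) (hne : s.Nonempty) :
    g '' (M.toHomeo '' ⋂ c ∈ s, voronoiCell c) = M.toHomeo '' (g '' ⋂ c ∈ s, voronoiCell c) := by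
  rw [image_biInter_voronoiCell (Pn3m_subset_Im3m hg), Set.biInter_image,
    Set.InjOn.image_biInter_eq hne M.toHomeo.injective.injOn,
    Set.InjOn.image_biInter_eq hne M.toHomeo.injective.injOn,
    Set.InjOn.image_biInter_eq hne g.injective.injOn]
  exact Set.iInter₂_congr fun c hc => image_cell hM hg (hs hc)

theorem HasPn3mSymmetry.secondOrder (hM : M.HasPn3mSymmetry) : M.HasSecondOrderPn3mSymmetry := by
  intro g hg e v u he hv hve
  obtain ⟨-, s, hs, hk, rfl⟩ := he
  have hne : s.Nonempty := Set.nonempty_of_ncard_ne_zero (by omega)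
  rw [HalfTangent, HalfTangent, ← image_biInter_cell hM hg hs hne, isHalfTangent_image_iff]

end E2Tiling

/-! ### Pinching a linear projection at a point -/

/-- A smooth function with `0` at `0` that increases to `1` at `1 / 9`. -/
noncomputable def profile (s : ℝ) : ℝ := Real.smoothTransition (9 * s)

theorem profile_zero : profile 0 = 0 := by simp [profile]

theorem profile_pos {s : ℝ} (hs : 0 < s) : 0 < profile s :=
  Real.smoothTransition.pos_of_pos (by positivity)

theorem profile_nonneg (s : ℝ) : 0 ≤ profile s := Real.smoothTransition.nonneg _

theorem profile_le_one (s : ℝ) : profile s ≤ 1 := Real.smoothTransition.le_one _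

theorem profile_eq_one {s : ℝ} (hs : 1 / 9 ≤ s) : profile s = 1 :=
  Real.smoothTransition.one_of_one_le (by linarith)

theorem profile_monotone : Monotone profile := fun s t h =>
  Real.smoothTransition.monotone (by linarith)

theorem profile_contDiff : ContDiff ℝ ∞ profile :=
  Real.smoothTransition.contDiff.comp (contDiff_const.mul contDiff_id)

/-- The orthogonal projections that can be the kernel direction of the derivative at the origin:
they commute with the stabilizer of the origin. -/
structure IsPinch (Q : E3 →L[ℝ] E3) : Prop where
  idem : ∀ x, Q (Q x) = Q x
  symm : ∀ x y, inner ℝ (Q x) y = inner ℝ x (Q y)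
  comm : ∀ k ∈ Pn3m, k 0 = 0 → ∀ x, Q (k.linearIsometryEquiv x) = k.linearIsometryEquiv (Q x)
  e1 : (!₂[1, 0, 0] : E3) - Q !₂[1, 0, 0] ≠ 0

/-- The map that contracts the range of `Q` near the origin and is the identity at distance
`1 / 3` from it. -/
noncomputable def pinchAt (Q : E3 →L[ℝ] E3) (x : E3) : E3 := x + (profile (‖x‖ ^ 2) - 1) • Q x

theorem pinchAt_zero (Q : E3 →L[ℝ] E3) : pinchAt Q 0 = 0 := by simp [pinchAt]

theorem pinchAt_of_le {Q : E3 →L[ℝ] E3} {x : E3} (h : 1 / 3 ≤ ‖x‖) : pinchAt Q x = x := by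
  rw [pinchAt, profile_eq_one (by nlinarith)]
  simp

theorem pinchAt_contDiff (Q : E3 →L[ℝ] E3) : ContDiff ℝ ∞ (pinchAt Q) :=
  contDiff_id.add (((profile_contDiff.comp (contDiff_norm_sq ℝ)).sub contDiff_const).smul
    Q.contDiff)

namespace IsPinch

variable {Q : E3 →L[ℝ] E3} (hQ : IsPinch Q)
include hQ

theorem norm_sq_combination (x : E3) (c : ℝ) :
    ‖(x - Q x) + c • Q x‖ ^ 2 = ‖x - Q x‖ ^ 2 + c ^ 2 * ‖Q x‖ ^ 2 := by
  have : inner ℝ (x - Q x) (Q x) = 0 := by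
    rw [← hQ.symm, map_sub, hQ.idem, sub_self, inner_zero_left]
  rw [norm_add_sq_real, inner_smul_right, this, norm_smul, mul_pow, Real.norm_eq_abs, sq_abs]
  ring

theorem norm_sq (x : E3) : ‖x‖ ^ 2 = ‖x - Q x‖ ^ 2 + ‖Q x‖ ^ 2 := by
  simpa using hQ.norm_sq_combination x 1

omit hQ in
theorem pinchAt_eq (x : E3) : pinchAt Q x = (x - Q x) + profile (‖x‖ ^ 2) • Q x := by
  rw [pinchAt, sub_smul, one_smul]; abel

theorem norm_pinchAt_le (x : E3) : ‖pinchAt Q x‖ ≤ ‖x‖ := by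
  rw [← sq_le_sq₀ (norm_nonneg _) (norm_nonneg _), pinchAt_eq, hQ.norm_sq_combination,
    hQ.norm_sq x]
  have h0 := profile_nonneg (‖x - Q x‖ ^ 2 + ‖Q x‖ ^ 2)
  have h1 := profile_le_one (‖x - Q x‖ ^ 2 + ‖Q x‖ ^ 2)
  have : profile (‖x - Q x‖ ^ 2 + ‖Q x‖ ^ 2) ^ 2 ≤ 1 := by nlinarith
  nlinarith [sq_nonneg ‖Q x‖]

theorem map_pinchAt (x : E3) : Q (pinchAt Q x) = profile (‖x‖ ^ 2) • Q x := by
  rw [pinchAt_eq, map_add, map_sub, map_smul, hQ.idem, sub_self, zero_add]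

theorem sub_map_pinchAt (x : E3) : pinchAt Q x - Q (pinchAt Q x) = x - Q x := by
  rw [hQ.map_pinchAt, pinchAt_eq]; abel

/-- The component x - Q x is preserved. For a fixed value of it, the length of the Q-component is
mapped by s ↦ profile (p² + s²) s, which is strictly increasing; the direction is kept because the
factor is positive off the origin. -/
theorem pinchAt_injective : Function.Injective (pinchAt Q) := by
  have key : ∀ p s t : ℝ, 0 ≤ s → s < t → profile (p ^ 2 + s ^ 2) * s <
      profile (p ^ 2 + t ^ 2) * t := by
    intro p s t hs hst
    have h1 : profile (p ^ 2 + s ^ 2) ≤ profile (p ^ 2 + t ^ 2) :=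
      profile_monotone (by gcongr)
    have h2 : 0 < profile (p ^ 2 + t ^ 2) := profile_pos (by nlinarith [sq_nonneg p])
    calc profile (p ^ 2 + s ^ 2) * s ≤ profile (p ^ 2 + t ^ 2) * s := by gcongr
      _ < _ := by gcongr
  intro x y h
  have h1 : x - Q x = y - Q y := by rw [← hQ.sub_map_pinchAt, h, hQ.sub_map_pinchAt]
  have h2 : profile (‖x‖ ^ 2) • Q x = profile (‖y‖ ^ 2) • Q y := by
    rw [← hQ.map_pinchAt, h, hQ.map_pinchAt]
  have h3 : ‖Q x‖ = ‖Q y‖ := by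
    have h4 := congrArg norm h2
    rw [norm_smul, norm_smul, Real.norm_of_nonneg (profile_nonneg _),
      Real.norm_of_nonneg (profile_nonneg _), hQ.norm_sq x, hQ.norm_sq y, h1] at h4
    rcases lt_trichotomy ‖Q x‖ ‖Q y‖ with h | h | h
    · exact absurd h4 (key _ _ _ (norm_nonneg _) h).ne
    · exact h
    · exact absurd h4 (key _ _ _ (norm_nonneg _) h).ne'
  have h5 : ‖x‖ ^ 2 = ‖y‖ ^ 2 := by rw [hQ.norm_sq x, hQ.norm_sq y, h1, h3]
  rw [h5] at h2
  rcases eq_or_ne y 0 with rfl | hy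
  · rw [norm_zero, zero_pow two_ne_zero, sq_eq_zero_iff, norm_eq_zero] at h5
    exact h5
  · have h6 := smul_right_injective E3 (profile_pos (s := ‖y‖ ^ 2) (by positivity)).ne' h2
    rw [h6] at h1
    exact sub_left_injective h1

/-- The preimage is sought with the same component y - Q y and a multiple s of Q y. The intermediate
value theorem provides s. -/
theorem pinchAt_surjective : Function.Surjective (pinchAt Q) := by
  intro y
  rcases eq_or_ne (Q y) 0 with h | h
  · exact ⟨y, by rw [pinchAt, h, smul_zero, add_zero]⟩
  have hq : 0 < ‖Q y‖ := norm_pos_iff.2 h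
  set φ : ℝ → ℝ := fun s => s * profile (‖y - Q y‖ ^ 2 + s ^ 2 * ‖Q y‖ ^ 2) with hφ
  have hc : Continuous φ := by
    have := profile_contDiff.continuous
    fun_prop
  -- For this s the Q-component has length 1 + ‖Q y‖, beyond the radius where the profile reaches 1,
  -- so the function equals s ≥ 1 there.
  have hS : (0 : ℝ) ≤ 1 + ‖Q y‖⁻¹ := by positivity
  have h1 : (1 : ℝ) ∈ Set.Icc (φ 0) (φ (1 + ‖Q y‖⁻¹)) := by
    refine ⟨by simp [hφ], ?_⟩
    have : (1 + ‖Q y‖⁻¹) ^ 2 * ‖Q y‖ ^ 2 = (‖Q y‖ + 1) ^ 2 := by field_simp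
    simp only [hφ]
    rw [this, profile_eq_one (by nlinarith [sq_nonneg ‖y - Q y‖]), mul_one]
    have : 0 < ‖Q y‖⁻¹ := by positivity
    linarith
  obtain ⟨s, -, hs⟩ := intermediate_value_Icc hS hc.continuousOn h1
  have hQx : Q ((y - Q y) + s • Q y) = s • Q y := by
    rw [map_add, map_sub, map_smul, hQ.idem, sub_self, zero_add]
  refine ⟨(y - Q y) + s • Q y, ?_⟩
  rw [pinchAt_eq, hQx, hQ.norm_sq_combination, smul_smul, mul_comm, add_sub_cancel_right]
  have hs' : s * profile (‖y - Q y‖ ^ 2 + s ^ 2 * ‖Q y‖ ^ 2) = 1 := hs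
  rw [hs', one_smul, sub_add_cancel]

theorem pinchAt_comm {k : E3 ≃ᵃⁱ[ℝ] E3} (hk : k ∈ Pn3m) (h0 : k 0 = 0) (x : E3) :
    pinchAt Q (k x) = k (pinchAt Q x) := by
  have e : ∀ y, k y = k.linearIsometryEquiv y := fun y => by
    have := linear_eq_sub k y 0
    rw [sub_zero, h0, sub_zero] at this
    exact this.symm
  rw [e, e, pinchAt, pinchAt, LinearIsometryEquiv.norm_map, hQ.comm k hk h0, map_add, map_smul]

omit hQ in
theorem pinchAt_hasFDerivAt (x : E3) : ∃ D : E3 →L[ℝ] E3, HasFDerivAt (pinchAt Q) D x ∧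
    ∀ v, D v = v + (profile (‖x‖ ^ 2) - 1) • Q v +
      (deriv profile (‖x‖ ^ 2) * (2 * inner ℝ x v)) • Q x := by
  have h1 : HasFDerivAt (fun y : E3 => ‖y‖ ^ 2) _ x := (hasFDerivAt_id x).norm_sq
  have h2 : HasDerivAt profile (deriv profile (‖x‖ ^ 2)) (‖x‖ ^ 2) :=
    ((profile_contDiff.differentiable (by simp)).differentiableAt).hasDerivAt
  have h3 := (h2.comp_hasFDerivAt x h1).sub_const 1
  have h4 := (hasFDerivAt_id x).add (h3.smul Q.hasFDerivAt)
  refine ⟨_, h4, fun v => ?_⟩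
  simp
  ring_nf
  abel

/-- Comparing D v = 0 with its image under Q gives v = Q v. Pairing the remaining equation with x
then gives ⟨x, v⟩ times a positive number equal to 0, because the profile is positive and
nondecreasing; what remains is a positive multiple of v. -/
theorem pinchAt_fderiv_injective {x : E3} (hx : x ≠ 0) {D : E3 →L[ℝ] E3}
    (hD : ∀ v, D v = v + (profile (‖x‖ ^ 2) - 1) • Q v +
      (deriv profile (‖x‖ ^ 2) * (2 * inner ℝ x v)) • Q x) : Function.Injective D := by
  rw [injective_iff_map_eq_zero]
  intro v hv
  have hb : 0 < profile (‖x‖ ^ 2) := profile_pos (by positivity)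
  have hb' : 0 ≤ deriv profile (‖x‖ ^ 2) := profile_monotone.deriv_nonneg
  set b := profile (‖x‖ ^ 2)
  set b' := deriv profile (‖x‖ ^ 2)
  rw [hD] at hv
  have h1 := congrArg Q hv
  rw [map_add, map_add, map_smul, map_smul, hQ.idem, hQ.idem, map_zero] at h1
  have h2 : v = Q v := by
    have e : v - Q v = 0 := by
      rw [← sub_eq_zero.2 (hv.trans h1.symm)]; abel
    exact sub_eq_zero.1 e
  have h3 : b • v + (b' * (2 * inner ℝ x v)) • Q x = 0 := by
    rw [← hv, ← h2, sub_smul, one_smul]; abel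
  have h4 := congrArg (fun w => inner ℝ x w) h3
  simp only [inner_add_right, inner_smul_right, inner_zero_right] at h4
  have h5 : inner ℝ x (Q x) = ‖Q x‖ ^ 2 := by
    rw [← real_inner_self_eq_norm_sq, hQ.symm, hQ.idem]
  rw [h5] at h4
  have h6 : inner ℝ x v * (b + 2 * b' * ‖Q x‖ ^ 2) = 0 := by linarith
  have h7 : inner ℝ x v = 0 := by
    rcases mul_eq_zero.1 h6 with h | h
    · exact h
    · exfalso
      have : 0 ≤ 2 * b' * ‖Q x‖ ^ 2 := by positivity
      linarith
  rw [h7, mul_zero, mul_zero, zero_smul, add_zero] at h3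
  exact (smul_eq_zero.1 h3).resolve_left hb.ne'

end IsPinch

/-! ### Spreading a pinch over all nodes -/

/-- The origin has exactly one odd coordinate. Signed permutations and even translations preserve
this. -/
theorem IsNode.odd_sum {v : E3} (hv : IsNode v) :
    ∃ x, HasCoord v x ∧ (x 0 + x 1 + x 2) % 2 = 1 := by
  obtain ⟨g, hg, rfl⟩ := isNode_iff.1 hv
  obtain ⟨σ, ε, t, H, ht⟩ := (mem_Pn3m_iff g).1 hg
  refine ⟨_, H.hasCoord hasCoord_zero, ?_⟩
  have h : ∀ i, (ε i * (![-1, 0, -2] : Fin 3 → ℤ) (σ i) + t i) % 2 =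
      (![1, 0, 0] : Fin 3 → ℤ) (σ i) := by
    intro i
    have h1 : t i % 2 = 0 := by
      have := ht i
      split_ifs at this <;> omega
    generalize σ i = j
    rcases Int.units_eq_one_or (ε i) with h | h <;> fin_cases j <;> simp [h] <;> omega
  have h0 := h 0
  have h1 := h 1
  have h2 := h 2
  have hs : (![1, 0, 0] : Fin 3 → ℤ) (σ 0) + (![1, 0, 0] : Fin 3 → ℤ) (σ 1) +
      (![1, 0, 0] : Fin 3 → ℤ) (σ 2) = 1 := by
    rw [← Fin.sum_univ_three (fun i => (![1, 0, 0] : Fin 3 → ℤ) (σ i)),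
      Equiv.sum_comp σ (![1, 0, 0] : Fin 3 → ℤ)]
    decide
  omega

/-- The coordinate differences have an even sum, so the sum of their squares is even; being nonzero
it is at least 2, and the scaling halves it. The balls of radius 1/2 about the nodes are therefore
disjoint. -/
theorem one_le_dist_of_isNode {v w : E3} (hv : IsNode v) (hw : IsNode w) (h : v ≠ w) :
    1 ≤ dist v w := by
  obtain ⟨x, hx, hx'⟩ := hv.odd_sum
  obtain ⟨y, hy, hy'⟩ := hw.odd_sum
  rw [← one_le_sq_iff₀ dist_nonneg, dist_sq_eq_coord]
  simp only [hx _, hy _, Fin.sum_univ_three]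
  have hne : (x 0 - y 0) ^ 2 + (x 1 - y 1) ^ 2 + (x 2 - y 2) ^ 2 ≠ 0 := by
    intro h0
    apply h
    have a0 : x 0 - y 0 = 0 := by
      rw [← sq_eq_zero_iff]
      nlinarith [sq_nonneg (x 0 - y 0), sq_nonneg (x 1 - y 1), sq_nonneg (x 2 - y 2)]
    have a1 : x 1 - y 1 = 0 := by
      rw [← sq_eq_zero_iff]
      nlinarith [sq_nonneg (x 0 - y 0), sq_nonneg (x 1 - y 1), sq_nonneg (x 2 - y 2)]
    have a2 : x 2 - y 2 = 0 := by
      rw [← sq_eq_zero_iff]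
      nlinarith [sq_nonneg (x 0 - y 0), sq_nonneg (x 1 - y 1), sq_nonneg (x 2 - y 2)]
    refine hx.eq fun i => ?_
    rw [hy]
    fin_cases i <;> simp <;> omega
  have hev : ((x 0 - y 0) ^ 2 + (x 1 - y 1) ^ 2 + (x 2 - y 2) ^ 2) % 2 = 0 := by
    have e : ∀ n : ℤ, n ^ 2 % 2 = n % 2 := by
      intro n
      rcases Int.emod_two_eq_zero_or_one n with h | h <;> simp [pow_two, Int.mul_emod, h]
    have e0 := e (x 0 - y 0)
    have e1 := e (x 1 - y 1)
    have e2 := e (x 2 - y 2)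
    omega
  have hpos : 0 ≤ (x 0 - y 0) ^ 2 + (x 1 - y 1) ^ 2 + (x 2 - y 2) ^ 2 := by positivity
  have h2 : 2 ≤ (x 0 - y 0) ^ 2 + (x 1 - y 1) ^ 2 + (x 2 - y 2) ^ 2 := by omega
  have : (2 : ℝ) ≤ ((x 0 : ℝ) - y 0) ^ 2 + ((x 1 : ℝ) - y 1) ^ 2 + ((x 2 : ℝ) - y 2) ^ 2 := by
    exact_mod_cast h2
  linarith

theorem image_zero_eq_of_near {x : E3} {g k : E3 ≃ᵃⁱ[ℝ] E3} (hg : g ∈ Pn3m) (hk : k ∈ Pn3m)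
    (h : dist x (g 0) < 1 / 2) (h' : dist x (k 0) < 1 / 2) : g 0 = k 0 := by
  by_contra hne
  have h1 := one_le_dist_of_isNode (isNode_image_zero hg) (isNode_image_zero hk) hne
  have h2 := dist_triangle_left (g 0) (k 0) x
  linarith

open Classical in
/-- The `Pn3m`-equivariant map that is `pinchAt Q` near the origin. -/
noncomputable def pinch (Q : E3 →L[ℝ] E3) (x : E3) : E3 :=
  if h : ∃ g ∈ Pn3m, dist x (g 0) < 1 / 2 then h.choose (pinchAt Q (h.choose.symm x)) else x

theorem dist_image_zero (g : E3 ≃ᵃⁱ[ℝ] E3) (x : E3) : dist x (g 0) = ‖g.symm x‖ := by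
  rw [← g.symm.dist_map x (g 0), g.symm_apply_apply, dist_zero_right]

theorem isometry_eq_linear_add (g : E3 ≃ᵃⁱ[ℝ] E3) (x : E3) :
    g x = g.linearIsometryEquiv x + g 0 := by
  have := linear_eq_sub g x 0
  rw [sub_zero] at this
  rw [this, sub_add_cancel]

theorem isometry_contDiff (g : E3 ≃ᵃⁱ[ℝ] E3) : ContDiff ℝ ∞ g := by
  have : (g : E3 → E3) = fun x => g.linearIsometryEquiv x + g 0 :=
    funext (isometry_eq_linear_add g)
  rw [this]
  exact g.linearIsometryEquiv.contDiff.add contDiff_const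

theorem isometry_hasFDerivAt (g : E3 ≃ᵃⁱ[ℝ] E3) (x : E3) :
    HasFDerivAt g (g.linearIsometryEquiv : E3 →L[ℝ] E3) x := by
  have : (g : E3 → E3) = fun x => g.linearIsometryEquiv x + g 0 :=
    funext (isometry_eq_linear_add g)
  rw [this]
  exact g.linearIsometryEquiv.toContinuousLinearEquiv.hasFDerivAt.add_const _

theorem pinch_of_far {Q : E3 →L[ℝ] E3} {x : E3} (h : ∀ g ∈ Pn3m, 1 / 3 ≤ dist x (g 0)) :
    pinch Q x = x := by
  unfold pinch
  split_ifs with hx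
  · rw [pinchAt_of_le, AffineIsometryEquiv.apply_symm_apply]
    rw [← dist_image_zero]
    exact h _ hx.choose_spec.1
  · rfl

namespace IsPinch

variable {Q : E3 →L[ℝ] E3} (hQ : IsPinch Q)
include hQ

/-- Independence of the chosen group element: two elements that move the origin to the same node
differ by a stabilizer element, with which `pinchAt` commutes. -/
theorem pinch_of_near {x : E3} {g : E3 ≃ᵃⁱ[ℝ] E3} (hg : g ∈ Pn3m) (h : dist x (g 0) < 1 / 2) :
    pinch Q x = g (pinchAt Q (g.symm x)) := by
  have hx : ∃ g ∈ Pn3m, dist x (g 0) < 1 / 2 := ⟨g, hg, h⟩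
  rw [pinch, dif_pos hx]
  obtain ⟨hk, hkx⟩ := hx.choose_spec
  set k := hx.choose
  have h0 := image_zero_eq_of_near hg hk h hkx
  have hr0 : (k.trans g.symm) 0 = 0 := by simp [← h0]
  have := hQ.pinchAt_comm (Pn3m.trans_mem hk (Pn3m.symm_mem hg)) hr0 (k.symm x)
  simp only [AffineIsometryEquiv.coe_trans, Function.comp_apply,
    AffineIsometryEquiv.apply_symm_apply] at this
  rw [this, AffineIsometryEquiv.apply_symm_apply]

theorem pinch_image {k : E3 ≃ᵃⁱ[ℝ] E3} (hk : k ∈ Pn3m) (x : E3) :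
    pinch Q (k x) = k (pinch Q x) := by
  by_cases hx : ∃ g ∈ Pn3m, dist x (g 0) < 1 / 2
  · obtain ⟨g, hg, h⟩ := hx
    rw [hQ.pinch_of_near hg h, hQ.pinch_of_near (Pn3m.trans_mem hg hk) (by simpa using h)]
    have : (g.trans k).symm (k x) = g.symm x := by
      rw [AffineIsometryEquiv.symm_apply_eq]
      simp
    rw [this]
    simp
  · push Not at hx
    rw [pinch_of_far fun g hg => (by norm_num : (1 / 3 : ℝ) ≤ 1 / 2).trans (hx g hg),
      pinch_of_far]
    intro g hg
    have := hx _ (Pn3m.trans_mem hg (Pn3m.symm_mem hk))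
    rw [← k.dist_map] at this
    simp only [AffineIsometryEquiv.coe_trans, Function.comp_apply,
      AffineIsometryEquiv.apply_symm_apply] at this
    linarith

theorem pinch_node {v : E3} (hv : IsNode v) : pinch Q v = v := by
  obtain ⟨g, hg, rfl⟩ := isNode_iff.1 hv
  rw [hQ.pinch_of_near hg (by simp), g.symm_apply_apply, pinchAt_zero]

theorem pinch_eventually_near {x : E3} {g : E3 ≃ᵃⁱ[ℝ] E3} (hg : g ∈ Pn3m)
    (h : dist x (g 0) < 1 / 2) :
    pinch Q =ᶠ[𝓝 x] fun y => g (pinchAt Q (g.symm y)) := by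
  filter_upwards [Metric.isOpen_ball.mem_nhds (Metric.mem_ball.2 h)] with y hy
  exact hQ.pinch_of_near hg hy

omit hQ in
theorem pinch_eventually_far {x : E3} (h : ∀ g ∈ Pn3m, 1 / 2 ≤ dist x (g 0)) :
    pinch Q =ᶠ[𝓝 x] fun y => y := by
  filter_upwards [Metric.ball_mem_nhds x (by norm_num : (0 : ℝ) < 1 / 6)] with y hy
  refine pinch_of_far fun g hg => ?_
  have h1 := h g hg
  have h2 := dist_triangle_left x (g 0) y
  have h3 := Metric.mem_ball.1 hy
  linarith

theorem pinch_contDiff : ContDiff ℝ ∞ (pinch Q) := by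
  rw [contDiff_iff_contDiffAt]
  intro x
  by_cases hx : ∃ g ∈ Pn3m, dist x (g 0) < 1 / 2
  · obtain ⟨g, hg, h⟩ := hx
    refine ContDiffAt.congr_of_eventuallyEq ?_ (hQ.pinch_eventually_near hg h)
    exact ((isometry_contDiff g).comp
      ((pinchAt_contDiff Q).comp (isometry_contDiff g.symm))).contDiffAt
  · push Not at hx
    exact contDiffAt_id.congr_of_eventuallyEq (pinch_eventually_far hx)

theorem dist_pinch_of_near {x : E3} {g : E3 ≃ᵃⁱ[ℝ] E3} (hg : g ∈ Pn3m)
    (h : dist x (g 0) < 1 / 2) : dist (pinch Q x) (g 0) < 1 / 2 := by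
  rw [hQ.pinch_of_near hg h, dist_image_zero, g.symm_apply_apply]
  refine (hQ.norm_pinchAt_le _).trans_lt ?_
  rwa [← dist_image_zero]

theorem pinch_injective : Function.Injective (pinch Q) := by
  have key : ∀ x y, (∃ g ∈ Pn3m, dist x (g 0) < 1 / 2) → pinch Q x = pinch Q y → x = y := by
    rintro x y ⟨g, hg, h⟩ hxy
    by_cases hy : ∃ g ∈ Pn3m, dist y (g 0) < 1 / 2
    · obtain ⟨k, hk, h'⟩ := hy
      have e := image_zero_eq_of_near hg hk (hQ.dist_pinch_of_near hg h)
        (hxy ▸ hQ.dist_pinch_of_near hk h')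
      rw [← e] at h'
      rw [hQ.pinch_of_near hg h, hQ.pinch_of_near hg h'] at hxy
      exact g.symm.injective (hQ.pinchAt_injective (g.injective hxy))
    · push Not at hy
      rw [pinch_of_far fun g hg => (by norm_num : (1 / 3 : ℝ) ≤ 1 / 2).trans (hy g hg)] at hxy
      have := hQ.dist_pinch_of_near hg h
      rw [hxy] at this
      exact absurd this (not_lt.2 (hy g hg))
  intro x y hxy
  by_cases hx : ∃ g ∈ Pn3m, dist x (g 0) < 1 / 2
  · exact key x y hx hxy
  by_cases hy : ∃ g ∈ Pn3m, dist y (g 0) < 1 / 2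
  · exact (key y x hy hxy.symm).symm
  push Not at hx hy
  rwa [pinch_of_far fun g hg => (by norm_num : (1 / 3 : ℝ) ≤ 1 / 2).trans (hy g hg),
    pinch_of_far fun g hg => (by norm_num : (1 / 3 : ℝ) ≤ 1 / 2).trans (hx g hg)] at hxy

theorem pinch_surjective : Function.Surjective (pinch Q) := by
  intro z
  by_cases hz : ∃ g ∈ Pn3m, dist z (g 0) < 1 / 2
  · obtain ⟨g, hg, h⟩ := hz
    obtain ⟨y, hy⟩ := hQ.pinchAt_surjective (g.symm z)
    have hy2 : ‖y‖ < 1 / 2 := by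
      by_contra hn
      push Not at hn
      rw [pinchAt_of_le (by linarith)] at hy
      rw [hy, ← dist_image_zero] at hn
      linarith
    refine ⟨g y, ?_⟩
    rw [hQ.pinch_of_near hg (by rwa [dist_image_zero, g.symm_apply_apply]), g.symm_apply_apply, hy,
      g.apply_symm_apply]
  · push Not at hz
    exact ⟨z, pinch_of_far fun g hg => (by norm_num : (1 / 3 : ℝ) ≤ 1 / 2).trans (hz g hg)⟩

theorem dist_pinch_le (x : E3) : dist (pinch Q x) x ≤ 1 := by
  by_cases hx : ∃ g ∈ Pn3m, dist x (g 0) < 1 / 2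
  · obtain ⟨g, hg, h⟩ := hx
    have h1 := hQ.dist_pinch_of_near hg h
    have h2 := dist_triangle_right (pinch Q x) x (g 0)
    linarith
  · push Not at hx
    rw [pinch_of_far fun g hg => (by norm_num : (1 / 3 : ℝ) ≤ 1 / 2).trans (hx g hg)]
    simp

/-- A continuous map that moves points by a bounded amount is proper. -/
theorem pinch_isClosedMap : IsClosedMap (pinch Q) := by
  refine IsProperMap.isClosedMap (isProperMap_iff_tendsto_cocompact.2
    ⟨hQ.pinch_contDiff.continuous, ?_⟩)
  rw [← Metric.cobounded_eq_cocompact, ← tendsto_norm_atTop_iff_cobounded]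
  refine tendsto_atTop_mono (fun x => ?_)
    (tendsto_atTop_add_const_right _ (-1) tendsto_norm_cobounded_atTop)
  have h1 := hQ.dist_pinch_le x
  rw [dist_comm, dist_eq_norm] at h1
  have h2 := norm_sub_norm_le x (pinch Q x)
  linarith

/-- The homeomorphism given by `pinch`. -/
noncomputable def homeo : E3 ≃ₜ E3 :=
  (Equiv.ofBijective (pinch Q) ⟨hQ.pinch_injective, hQ.pinch_surjective⟩).toHomeomorphOfContinuousClosed
    hQ.pinch_contDiff.continuous hQ.pinch_isClosedMap

theorem homeo_apply (x : E3) : hQ.homeo x = pinch Q x := rfl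

theorem pinch_hasFDerivAt_near {x : E3} {g : E3 ≃ᵃⁱ[ℝ] E3} (hg : g ∈ Pn3m)
    (h : dist x (g 0) < 1 / 2) {D : E3 →L[ℝ] E3} (hD : HasFDerivAt (pinchAt Q) D (g.symm x)) :
    HasFDerivAt (pinch Q) ((g.linearIsometryEquiv : E3 →L[ℝ] E3).comp
      (D.comp (g.symm.linearIsometryEquiv : E3 →L[ℝ] E3))) x :=
  HasFDerivAt.congr_of_eventuallyEq ((isometry_hasFDerivAt g _).comp x
    (HasFDerivAt.comp x hD (isometry_hasFDerivAt g.symm x))) (hQ.pinch_eventually_near hg h)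

theorem exists_pinch_hasFDerivAt {x : E3} (hx : ¬ IsNode x) :
    ∃ D : E3 ≃L[ℝ] E3, HasFDerivAt (pinch Q) (D : E3 →L[ℝ] E3) x := by
  suffices H : ∃ D : E3 →L[ℝ] E3, Function.Injective D ∧ HasFDerivAt (pinch Q) D x by
    obtain ⟨D, hD, h⟩ := H
    refine ⟨(LinearEquiv.ofInjectiveEndo (D : E3 →ₗ[ℝ] E3) hD).toContinuousLinearEquiv, ?_⟩
    have e : ((LinearEquiv.ofInjectiveEndo (D : E3 →ₗ[ℝ] E3) hD).toContinuousLinearEquiv :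
        E3 →L[ℝ] E3) = D := ContinuousLinearMap.ext fun v => rfl
    rwa [e]
  by_cases hx' : ∃ g ∈ Pn3m, dist x (g 0) < 1 / 2
  · obtain ⟨g, hg, h⟩ := hx'
    obtain ⟨D, hD, hDv⟩ := pinchAt_hasFDerivAt (Q := Q) (g.symm x)
    refine ⟨_, ?_, hQ.pinch_hasFDerivAt_near hg h hD⟩
    have h0 : g.symm x ≠ 0 := by
      intro h0
      apply hx
      rw [← g.apply_symm_apply x, h0]
      exact isNode_image_zero hg
    exact g.linearIsometryEquiv.injective.comp
      ((hQ.pinchAt_fderiv_injective h0 hDv).comp g.symm.linearIsometryEquiv.injective)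
  · push Not at hx'
    exact ⟨ContinuousLinearMap.id ℝ E3, Function.injective_id,
      (hasFDerivAt_id x).congr_of_eventuallyEq (pinch_eventually_far hx')⟩

/-- The inverse function theorem, available because the derivative is invertible away from the
nodes. -/
theorem homeo_symm_contDiffAt {z : E3} (hz : ¬ IsNode z) : ContDiffAt ℝ ∞ hQ.homeo.symm z := by
  have hx : ¬ IsNode (hQ.homeo.symm z) := by
    intro h
    have := hQ.pinch_node h
    rw [← hQ.homeo_apply, Homeomorph.apply_symm_apply] at this
    rw [← this] at h
    exact hz h
  obtain ⟨D, hD⟩ := hQ.exists_pinch_hasFDerivAt hx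
  exact hQ.homeo.toOpenPartialHomeomorph.contDiffAt_symm (a := z) (by simp) hD
    hQ.pinch_contDiff.contDiffAt

/-! ### Smoothness of the faces and edges of the pinched tiling -/

omit hQ in
theorem isClosed_nodes : IsClosed {v : E3 | IsNode v} :=
  Metric.isClosed_of_pairwise_le_dist one_pos fun _ hv _ hw h => one_le_dist_of_isNode hv hw h

/-- A face lies in the bisector plane of its two centres. The image lies in the zero set of that
plane's equation composed with the inverse map, which is smooth off the nodes. -/
theorem smooth_face {F : Set E3} (hF : IsFace F) {z : E3} (hz : ¬ IsNode z) :
    IsSmoothSurfaceAt (hQ.homeo '' F) z := by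
  obtain ⟨-, s, hs, hk, rfl⟩ := hF
  obtain ⟨c, c', hne, rfl⟩ := Set.ncard_eq_two.1 hk
  set f : E3 → ℝ := fun y => inner ℝ (c' - c) (hQ.homeo.symm y) - (‖c'‖ ^ 2 - ‖c‖ ^ 2) / 2 with hf
  refine ⟨{v | IsNode v}ᶜ, f, isClosed_nodes.isOpen_compl, hz, ?_, ?_, ?_⟩
  · intro y hy
    exact ((contDiffAt_const.inner ℝ (hQ.homeo_symm_contDiffAt hy)).sub
      contDiffAt_const).contDiffWithinAt
  · intro y hy h0
    have hd : HasFDerivAt f (0 : E3 →L[ℝ] ℝ) y := by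
      rw [← h0]
      exact (((contDiffAt_const.inner ℝ (hQ.homeo_symm_contDiffAt hy)).sub
        contDiffAt_const).differentiableAt (by simp)).hasFDerivAt
    set x := hQ.homeo.symm y with hx
    have hxy : hQ.homeo x = y := hQ.homeo.apply_symm_apply y
    have hH : HasFDerivAt hQ.homeo (fderiv ℝ (pinch Q) x) x :=
      ((hQ.pinch_contDiff.differentiable (by simp)) x).hasFDerivAt
    -- By the chain rule a vanishing derivative of f would make the derivative of f ∘ `pinch`
    -- vanish. That composition is the affine equation of the plane, whose derivative is nonzero on
    -- c' - c.
    rw [← hxy] at hd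
    have h1 := hd.comp x hH
    have h2 : HasFDerivAt (f ∘ hQ.homeo) (innerSL ℝ (c' - c)) x := by
      have : f ∘ hQ.homeo = fun w => innerSL ℝ (c' - c) w - (‖c'‖ ^ 2 - ‖c‖ ^ 2) / 2 := by
        funext w
        simp [hf, inner_sub_left]
      rw [this]
      exact (innerSL ℝ (c' - c)).hasFDerivAt.sub_const _
    have h3 := congrArg (fun L => L (c' - c)) (h2.unique h1)
    simp only [innerSL_apply_apply, real_inner_self_eq_norm_sq] at h3
    simp at h3
    exact hne (sub_eq_zero.1 h3).symm
  · rintro _ ⟨⟨w, hw, rfl⟩, -⟩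
    simp only [Set.mem_iInter, Set.mem_insert_iff, Set.mem_singleton_iff, forall_eq_or_imp,
      forall_eq] at hw
    have h1 := hw.1 c' (hs (by simp))
    have h2 := hw.2 c (hs (by simp))
    have h3 : dist w c ^ 2 = dist w c' ^ 2 := by rw [le_antisymm h1 h2]
    rw [dist_eq_norm, dist_eq_norm, norm_sub_sq_real, norm_sub_sq_real] at h3
    simp only [hf, Homeomorph.symm_apply_apply]
    rw [inner_sub_left, real_inner_comm w c', real_inner_comm w c]
    linarith

omit hQ in
-- At the origin the profile is 0 and the term with its derivative contains ⟨0, v⟩, so the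
-- derivative is 1 - Q.
theorem hasFDerivAt_zero : ∃ D : E3 →L[ℝ] E3, HasFDerivAt (pinchAt Q) D 0 ∧
    D !₂[1, 0, 0] = !₂[1, 0, 0] - Q !₂[1, 0, 0] := by
  obtain ⟨D, hD, hDv⟩ := pinchAt_hasFDerivAt (Q := Q) 0
  refine ⟨D, hD, ?_⟩
  rw [hDv, norm_zero, zero_pow two_ne_zero, profile_zero, inner_zero_left, mul_zero, mul_zero,
    zero_smul, add_zero, zero_sub, neg_one_smul, sub_eq_add_neg]

omit hQ in
theorem smul_e1_hasDerivAt (t : ℝ) :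
    HasDerivAt (fun s : ℝ => s • (!₂[1, 0, 0] : E3)) !₂[1, 0, 0] t := by
  simpa using (hasDerivAt_id t).smul_const (!₂[1, 0, 0] : E3)

theorem base_hasDerivAt_zero : HasDerivAt (fun s : ℝ => pinch Q (s • !₂[1, 0, 0]))
    (!₂[1, 0, 0] - Q !₂[1, 0, 0]) 0 := by
  obtain ⟨D, hD, hDv⟩ := hasFDerivAt_zero (Q := Q)
  have h0 : (0 : ℝ) • (!₂[1, 0, 0] : E3) = 0 := zero_smul _ _
  have h1 := hQ.pinch_hasFDerivAt_near (x := (0 : ℝ) • !₂[1, 0, 0]) Pn3m.refl_mem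
    (by rw [h0]; simp) (D := D) (by rw [h0]; exact hD)
  have h2 := h1.comp_hasDerivAt 0 (smul_e1_hasDerivAt 0)
  rw [← hDv]
  exact h2

theorem base_hasDerivAt_ne (t : ℝ) (ht : t ∈ Set.Icc (0 : ℝ) 1) :
    ∃ d, d ≠ 0 ∧ HasDerivAt (fun s : ℝ => pinch Q (s • !₂[1, 0, 0])) d t := by
  rcases eq_or_ne t 0 with rfl | h0
  · exact ⟨_, hQ.e1, hQ.base_hasDerivAt_zero⟩
  have e1ne : (!₂[1, 0, 0] : E3) ≠ 0 := (hasCoord_zero.ne hasCoord_e1 (by decide)).symm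
  rcases eq_or_ne t 1 with rfl | h1
  -- The end t = 1 is handled by conjugating with `edgeFlip`, which reverses the direction of the
  -- edge.
  · obtain ⟨D, hD, hDv⟩ := hasFDerivAt_zero (Q := Q)
    have h1 : (1 : ℝ) • (!₂[1, 0, 0] : E3) = !₂[1, 0, 0] := one_smul _ _
    have s1 : edgeFlip.symm !₂[1, 0, 0] = 0 := by
      rw [AffineIsometryEquiv.symm_apply_eq, edgeFlip_zero]
    have s0 : edgeFlip.symm 0 = !₂[1, 0, 0] := by
      rw [AffineIsometryEquiv.symm_apply_eq, edgeFlip_e1]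
    have h2 := hQ.pinch_hasFDerivAt_near (x := (1 : ℝ) • !₂[1, 0, 0]) edgeFlip_mem
      (by rw [h1, edgeFlip_zero]; simp) (D := D) (by rw [h1, s1]; exact hD)
    have h3 := h2.comp_hasDerivAt 1 (smul_e1_hasDerivAt 1)
    refine ⟨_, ?_, h3⟩
    have e : edgeFlip.symm.linearIsometryEquiv !₂[1, 0, 0] = -!₂[1, 0, 0] := by
      have := linear_eq_sub edgeFlip.symm !₂[1, 0, 0] 0
      rwa [s1, s0, sub_zero, zero_sub] at this
    change edgeFlip.linearIsometryEquiv (D (edgeFlip.symm.linearIsometryEquiv !₂[1, 0, 0])) ≠ 0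
    rw [e, map_neg, hDv, map_neg, neg_ne_zero, Ne, LinearIsometryEquiv.map_eq_zero_iff]
    exact hQ.e1
  · have hn : ¬ IsNode (t • !₂[1, 0, 0]) := by
      intro hn
      rcases node_of_mem_baseEdge hn ((mem_baseEdge_iff _).2 ⟨t, ht, rfl⟩) with h | h
      · exact (smul_eq_zero.1 h).elim h0 e1ne
      · have : (t - 1) • (!₂[1, 0, 0] : E3) = 0 := by rw [sub_smul, h, one_smul, sub_self]
        exact (smul_eq_zero.1 this).elim (sub_ne_zero.2 h1) e1ne
    obtain ⟨D, hD⟩ := hQ.exists_pinch_hasFDerivAt hn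
    have h3 := hD.comp_hasDerivAt t (smul_e1_hasDerivAt t)
    refine ⟨_, ?_, h3⟩
    exact (map_ne_zero_iff D D.injective).2 e1ne

omit hQ in
theorem baseEdge_eq_image : baseEdge = (fun s : ℝ => s • !₂[1, 0, 0]) '' Set.Icc 0 1 := by
  ext x
  rw [mem_baseEdge_iff]
  exact ⟨fun ⟨t, h, e⟩ => ⟨t, h, e.symm⟩, fun ⟨t, h, e⟩ => ⟨t, h, e.symm⟩⟩

omit hQ in
theorem smul_e1_injective : Function.Injective fun s : ℝ => s • (!₂[1, 0, 0] : E3) :=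
  smul_left_injective ℝ (hasCoord_zero.ne hasCoord_e1 (by decide)).symm

theorem smooth_edge {e : Set E3} {v w : E3} (he : IsEdge e) (hv : IsNode v) (hw : IsNode w)
    (hve : v ∈ e) (hwe : w ∈ e) (hne : v ≠ w) : IsSmoothArc v w (hQ.homeo '' e) := by
  obtain ⟨g, hg, rfl, rfl, rfl⟩ := exists_edge_flag_of_ne he hv hw hve hwe hne
  have hsm : ContDiff ℝ ∞ fun s : ℝ => pinch Q (s • !₂[1, 0, 0]) :=
    hQ.pinch_contDiff.comp (contDiff_id.smul contDiff_const)
  refine ⟨fun s => g (pinch Q (s • !₂[1, 0, 0])), (isometry_contDiff g).comp hsm, ?_, ?_, ?_, ?_, ?_⟩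
  · intro t ht
    obtain ⟨d, hd, h⟩ := hQ.base_hasDerivAt_ne t ht
    have := (isometry_hasFDerivAt g _).comp_hasDerivAt t h
    have h2 : deriv (fun s => g (pinch Q (s • !₂[1, 0, 0]))) t = g.linearIsometryEquiv d :=
      this.deriv
    rwa [h2, Ne, LinearIsometryEquiv.map_eq_zero_iff]
  · exact (g.injective.comp (hQ.pinch_injective.comp smul_e1_injective)).injOn
  · rw [baseEdge_eq_image, Set.image_image, Set.image_image]
    refine Set.image_congr fun t _ => ?_
    rw [homeo_apply, hQ.pinch_image hg]
  · simp only [zero_smul]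
    rw [hQ.pinch_node isNode_zero]
  · simp only [one_smul]
    rw [hQ.pinch_node isNode_e1]

/-- The tiling given by `pinch`. -/
noncomputable def tiling : E2Tiling where
  toHomeo := hQ.homeo
  map_node _ hv := hQ.pinch_node hv
  smooth_edge _ _ _ he hv hw hve hwe hne := hQ.smooth_edge he hv hw hve hwe hne
  smooth_face _ hF _ _ hx := hQ.smooth_face hF hx

theorem tiling_hasPn3mSymmetry : hQ.tiling.HasPn3mSymmetry := by
  intro g hg c hc
  refine ⟨g c, Pn3m.map_bcc hg hc, ?_⟩
  rw [E2Tiling.cell, E2Tiling.cell, ← image_voronoiCell (Pn3m_subset_Im3m hg), Set.image_image,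
    Set.image_image]
  exact Set.image_congr fun x _ => (hQ.pinch_image hg x).symm

theorem tiling_halfTangent : hQ.tiling.HalfTangent baseEdge 0
    (‖(!₂[1, 0, 0] : E3) - Q !₂[1, 0, 0]‖⁻¹ • (!₂[1, 0, 0] - Q !₂[1, 0, 0])) := by
  have h := arc_isHalfTangent (γ := fun s : ℝ => pinch Q (s • !₂[1, 0, 0]))
    (hQ.pinch_contDiff.continuous.comp (continuous_id.smul continuous_const)) (hQ.pinch_injective.comp smul_e1_injective).injOn
    hQ.base_hasDerivAt_zero hQ.e1
  have e : hQ.tiling.toHomeo '' baseEdge =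
      (fun s : ℝ => pinch Q (s • !₂[1, 0, 0])) '' Set.Icc 0 1 := by
    rw [baseEdge_eq_image, Set.image_image]
    rfl
  have e0 : pinch Q ((0 : ℝ) • !₂[1, 0, 0]) = 0 := by rw [zero_smul, hQ.pinch_node isNode_zero]
  rw [E2Tiling.HalfTangent, e]
  rwa [e0] at h

/-- The hypothesis says that at nodes in the plane the transported Q maps directions of the plane to
such directions. The pinch then moves the points of F within the plane; the other faces required
follow by equivariance. -/
theorem tiling_hasPlanarFaces {F : Set E3} {N : Fin 3 → ℤ} {d : ℤ} {r : E3 ≃ᵃⁱ[ℝ] E3}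
    (hF : IsBaseFace F N d r)
    (h : ∀ g ∈ Pn3m, latticeHeight N (g 0) = d → ∀ y, latticeForm N (g.linearIsometryEquiv y) = 0 →
      latticeForm N (g.linearIsometryEquiv (Q y)) = 0) : hQ.tiling.HasPlanarFaces := by
  have form_add : ∀ x y, latticeForm N (x + y) = latticeForm N x + latticeForm N y := by
    intro x y
    simp only [latticeForm, lcoord_add, mul_add, Finset.sum_add_distrib]
  have form_smul : ∀ (s : ℝ) y, latticeForm N (s • y) = s * latticeForm N y := by
    intro s y
    simp only [latticeForm, lcoord_smul, Finset.mul_sum]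
    exact Finset.sum_congr rfl fun i _ => by ring
  have key : ∀ x ∈ F, latticeHeight N (pinch Q x) = d := by
    intro x hx
    by_cases hn : ∃ g ∈ Pn3m, dist x (g 0) < 1 / 3
    · obtain ⟨g, hg, hd⟩ := hn
      -- A point of the face within 1/3 of a node forces that node into the face, because only the
      -- four cells at a node come so close to it. Its height is then d.
      have hgF : g 0 ∈ F := by
        obtain ⟨-, s, hs, -, rfl⟩ := hF.isFace
        refine Set.mem_iInter₂.2 fun c hc => ?_
        have h1 : g.symm x ∈ voronoiCell (g.symm c) :=
          (Im3m.image_voronoiCell (Im3m.symm_mem (Pn3m_subset_Im3m hg)) x c).2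
            (Set.mem_iInter₂.1 hx c hc)
        have h2 := mem_originCentres_of_near (Pn3m.map_bcc (Pn3m.symm_mem hg) (hs hc)) h1
          (by rwa [dist_zero_right, ← dist_image_zero])
        have h3 := (Im3m.image_voronoiCell (Pn3m_subset_Im3m hg) 0 _).2 (zero_mem_voronoiCell h2)
        rwa [g.apply_symm_apply] at h3
      have hg0 := hF.height _ hgF
      have e1 : latticeForm N (g.linearIsometryEquiv (g.symm x)) = 0 := by
        have := linear_eq_sub g (g.symm x) 0
        rw [sub_zero, g.apply_symm_apply] at this
        rw [this, latticeForm_sub, hF.height x hx, hg0, sub_self]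
      have e2 := h g hg hg0 _ e1
      rw [hQ.pinch_of_near hg (by linarith), ← hg0, ← sub_eq_zero, ← latticeForm_sub,
        ← linear_eq_sub, sub_zero, pinchAt, map_add, map_smul, form_add, form_smul, e1, e2,
        mul_zero, add_zero]
    · push Not at hn
      rw [pinch_of_far hn, hF.height x hx]
  intro c hc
  obtain ⟨g, hg, h1, h2⟩ := hF.exists_image hc
  refine ⟨g '' F, h1, h2, g.linearIsometryEquiv (latticeNormal N),
    inner ℝ (g.linearIsometryEquiv (latticeNormal N)) (g 0), ?_, ?_⟩
  · rw [Ne, LinearIsometryEquiv.map_eq_zero_iff]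
    exact latticeNormal_ne_zero hF.ne_zero
  · rintro _ ⟨_, ⟨x, hx, rfl⟩, rfl⟩
    change inner ℝ _ (pinch Q (g x)) = _
    rw [hQ.pinch_image hg, ← sub_eq_zero, ← inner_sub_right, ← linear_eq_sub,
      LinearIsometryEquiv.inner_map_map, inner_latticeNormal, latticeForm_sub, key x hx,
      hF.height 0 (hF.baseEdge_subset zero_mem_baseEdge)]
    simp

end IsPinch

/-! ### Pinches along and across an axis -/

/-- The orthogonal projection onto the line through the unit vector `l`. -/
noncomputable def alongAxis (l : E3) : E3 →L[ℝ] E3 := (innerSL ℝ l).smulRight l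

theorem alongAxis_apply (l x : E3) : alongAxis l x = inner ℝ l x • l := by
  simp [alongAxis]

/-- A unit vector on an axis of the stabilizer of the origin. -/
structure IsAxis (l : E3) : Prop where
  norm : inner ℝ l l = 1
  map_eq : ∀ k ∈ Pn3m, k 0 = 0 → k.linearIsometryEquiv l = l ∨ k.linearIsometryEquiv l = -l

theorem lcoord_rotU (v : E3) : lcoord (rotU.linearIsometryEquiv v) =
    ![lcoord v 0, -lcoord v 1, -lcoord v 2] := by
  funext i
  rw [rotU_spec.lcoord]
  fin_cases i <;> simp

theorem lcoord_rotP (v : E3) : lcoord (rotP.linearIsometryEquiv v) =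
    ![-lcoord v 0, lcoord v 2, lcoord v 1] := by
  have e0 : (Equiv.swap 1 2 : Equiv.Perm (Fin 3)) 0 = 0 := by decide
  have e2 : (Equiv.swap 1 2 : Equiv.Perm (Fin 3)) 2 = 1 := by decide
  funext i
  rw [rotP_spec.lcoord]
  fin_cases i <;> simp [e0, e2]

theorem lcoord_rotQ (v : E3) : lcoord (rotQ.linearIsometryEquiv v) =
    ![-lcoord v 0, -lcoord v 2, -lcoord v 1] := by
  have e0 : (Equiv.swap 1 2 : Equiv.Perm (Fin 3)) 0 = 0 := by decide
  have e2 : (Equiv.swap 1 2 : Equiv.Perm (Fin 3)) 2 = 1 := by decide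
  funext i
  rw [rotQ_spec.lcoord]
  fin_cases i <;> simp [e0, e2]

theorem lcoord_neg' (v : E3) : lcoord (-v) = ![-lcoord v 0, -lcoord v 1, -lcoord v 2] := by
  funext i
  rw [lcoord_neg]
  fin_cases i <;> rfl

theorem isAxis_of_lcoord {l : E3} (h1 : inner ℝ l l = 1)
    (hU : rotU.linearIsometryEquiv l = l ∨ rotU.linearIsometryEquiv l = -l)
    (hP : rotP.linearIsometryEquiv l = l ∨ rotP.linearIsometryEquiv l = -l)
    (hQ : rotQ.linearIsometryEquiv l = l ∨ rotQ.linearIsometryEquiv l = -l) : IsAxis l := by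
  refine ⟨h1, fun k hk h0 => ?_⟩
  rcases stabilizer_origin hk h0 with rfl | rfl | rfl | rfl
  exacts [Or.inl rfl, hU, hP, hQ]

theorem isAxis_axisU : IsAxis axisU := by
  refine isAxis_of_lcoord ?_ (Or.inl ?_) (Or.inr ?_) (Or.inr ?_)
  · rw [inner_axisU, lcoord_axisU]
    simp only [Matrix.cons_val]
    linarith [sqrt_two_sq]
  all_goals
    apply lcoord_injective
    simp [lcoord_rotU, lcoord_rotP, lcoord_rotQ, lcoord_neg', lcoord_axisU]

theorem isAxis_axisP : IsAxis axisP := by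
  refine isAxis_of_lcoord ?_ (Or.inr ?_) (Or.inl ?_) (Or.inr ?_)
  · rw [inner_axisP, lcoord_axisP]
    simp only [Matrix.cons_val]
    norm_num
  all_goals
    apply lcoord_injective
    simp [lcoord_rotU, lcoord_rotP, lcoord_rotQ, lcoord_neg', lcoord_axisP]

theorem isAxis_axisQ : IsAxis axisQ := by
  refine isAxis_of_lcoord ?_ (Or.inr ?_) (Or.inr ?_) (Or.inl ?_)
  · rw [inner_axisQ, lcoord_axisQ]
    simp only [Matrix.cons_val]
    norm_num
  all_goals
    apply lcoord_injective
    simp [lcoord_rotU, lcoord_rotP, lcoord_rotQ, lcoord_neg', lcoord_axisQ]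

theorem IsAxis.alongAxis_comm {l : E3} (hl : IsAxis l) {k : E3 ≃ᵃⁱ[ℝ] E3} (hk : k ∈ Pn3m)
    (h0 : k 0 = 0) (x : E3) : alongAxis l (k.linearIsometryEquiv x) =
      k.linearIsometryEquiv (alongAxis l x) := by
  rw [alongAxis_apply, alongAxis_apply, map_smul,
    ← LinearIsometryEquiv.inner_map_map k.linearIsometryEquiv l x]
  rcases hl.map_eq k hk h0 with h | h <;> rw [h]
  rw [inner_neg_left, neg_smul_neg]

theorem IsAxis.isPinch_alongAxis {l : E3} (hl : IsAxis l)
    (h : (!₂[1, 0, 0] : E3) - alongAxis l !₂[1, 0, 0] ≠ 0) : IsPinch (alongAxis l) where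
  idem x := by
    simp only [alongAxis_apply, inner_smul_right, hl.norm, mul_one]
  symm x y := by
    simp only [alongAxis_apply, inner_smul_left, inner_smul_right]
    rw [real_inner_comm x l]
    simp [mul_comm]
  comm _ hk h0 x := hl.alongAxis_comm hk h0 x
  e1 := h

theorem IsAxis.isPinch_acrossAxis {l : E3} (hl : IsAxis l)
    (h : alongAxis l !₂[1, 0, 0] ≠ 0) : IsPinch (ContinuousLinearMap.id ℝ E3 - alongAxis l) where
  idem x := by
    simp only [sub_apply, ContinuousLinearMap.id_apply, alongAxis_apply, inner_sub_right,
      inner_smul_right, hl.norm, mul_one, sub_self, zero_smul, sub_zero]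
  symm x y := by
    simp only [sub_apply, ContinuousLinearMap.id_apply, inner_sub_left,
      inner_sub_right, alongAxis_apply, inner_smul_left, inner_smul_right]
    rw [real_inner_comm x l]
    simp [mul_comm]
  comm k hk h0 x := by
    simp [hl.alongAxis_comm hk h0]
  e1 := by simpa using h

/-- The elements of `Pn3m` that move the origin into the lattice plane move the axis with integral
coordinates `l` to a direction of the plane. -/
def IsAxisPlane (N : Fin 3 → ℤ) (d : ℤ) (l : Fin 3 → ℤ) : Prop :=
  ∀ (σ : Equiv.Perm (Fin 3)) (ε : Fin 3 → ℤˣ),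
    (∑ i, N i * (ε i * (![-1, 0, -2] : Fin 3 → ℤ) (σ i) +
      if ∏ j, ε j = 1 then 0 else 2)) % 4 = d % 4 → ∑ i, N i * (ε i * l (σ i)) = 0

theorem isAxisPlane_quad : IsAxisPlane ![0, 0, 1] (-2) ![1, 0, 0] := by
  unfold IsAxisPlane; decide
theorem isAxisPlane_hex₁ : IsAxisPlane ![1, -1, 1] (-3) ![0, 1, 1] := by
  unfold IsAxisPlane; decide
theorem isAxisPlane_hex₂ : IsAxisPlane ![1, -1, -1] 1 ![0, -1, 1] := by
  unfold IsAxisPlane; decide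

theorem IsAxisPlane.latticeForm {N : Fin 3 → ℤ} {d : ℤ} {l : Fin 3 → ℤ} (h : IsAxisPlane N d l)
    {g : E3 ≃ᵃⁱ[ℝ] E3} (hg : g ∈ Pn3m) (h0 : latticeHeight N (g 0) = d) {a : E3} {s : ℝ}
    (ha : ∀ i, lcoord a i = s * l i) : latticeForm N (g.linearIsometryEquiv a) = 0 := by
  obtain ⟨σ, ε, t, H, ht⟩ := (mem_Pn3m_iff g).1 hg
  have h1 := h σ ε (H.latticeHeight_mod ht hasCoord_zero h0)
  have h2 : ∑ i, (N i : ℝ) * (((ε i : ℤ) : ℝ) * l (σ i)) = 0 := by exact_mod_cast h1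
  rw [_root_.latticeForm, ← mul_zero s, ← h2, Finset.mul_sum]
  refine Finset.sum_congr rfl fun i _ => ?_
  rw [H.lcoord, ha]
  ring

theorem latticeForm_smul (N : Fin 3 → ℤ) (s : ℝ) (y : E3) :
    latticeForm N (s • y) = s * latticeForm N y := by
  simp only [latticeForm, lcoord_smul, Finset.mul_sum]
  exact Finset.sum_congr rfl fun i _ => by ring

theorem latticeForm_sub' (N : Fin 3 → ℤ) (x y : E3) :
    latticeForm N (x - y) = latticeForm N x - latticeForm N y := by
  simp only [sub_eq_add_neg, latticeForm, lcoord_add, lcoord_neg, mul_add, mul_neg,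
    Finset.sum_add_distrib, Finset.sum_neg_distrib]

theorem alongAxis_planar {N : Fin 3 → ℤ} {l : E3} {g : E3 ≃ᵃⁱ[ℝ] E3}
    (h : latticeForm N (g.linearIsometryEquiv l) = 0) (y : E3) :
    latticeForm N (g.linearIsometryEquiv (alongAxis l y)) = 0 := by
  rw [alongAxis_apply, map_smul, latticeForm_smul, h, mul_zero]

theorem acrossAxis_planar {N : Fin 3 → ℤ} {l : E3} {g : E3 ≃ᵃⁱ[ℝ] E3}
    (h : latticeForm N (g.linearIsometryEquiv l) = 0) (y : E3)
    (hy : latticeForm N (g.linearIsometryEquiv y) = 0) :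
    latticeForm N (g.linearIsometryEquiv ((ContinuousLinearMap.id ℝ E3 - alongAxis l) y)) = 0 := by
  rw [sub_apply, ContinuousLinearMap.id_apply, map_sub, latticeForm_sub', hy,
    alongAxis_planar h, sub_zero]

/-! ### The four half-tangents -/

theorem sqrt_three_sq : √3 * √3 = 3 := Real.mul_self_sqrt (by norm_num)

theorem sqrt_six : √6 = √2 * √3 := by
  rw [← Real.sqrt_mul (by norm_num)]; norm_num

theorem sqrt_two_div_sqrt_six : √2 / √6 = √3 / 3 := by
  have h2 : √2 ≠ 0 := by positivity
  have h3 : √3 ≠ 0 := by positivity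
  rw [sqrt_six]
  field_simp
  linarith [sqrt_three_sq]

theorem lcoord_f2 : lcoord CellName.f2.vec = ![√2, 0, 0] := lcoord_axisU

theorem lcoord_g2 : lcoord CellName.g2.vec = ![0, √2, 0] := by
  funext i; fin_cases i <;> simp [lcoord, CellName.vec]
  rw [← one_div, one_div_sqrt_two]; ring

theorem lcoord_h2 : lcoord CellName.h2.vec = ![0, 1, 1] := lcoord_axisP

theorem lcoord_i2 : lcoord CellName.i2.vec = ![2 * √3 / 3, √3 / 3, √3 / 3] := by
  funext i; fin_cases i <;> simp [lcoord, CellName.vec]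
  · ring
  · ring
  · rw [← div_eq_mul_inv, sqrt_two_div_sqrt_six]

theorem norm_eq_one_iff_lcoord (v : E3) :
    ‖v‖ = 1 ↔ lcoord v 0 ^ 2 + lcoord v 1 ^ 2 + lcoord v 2 ^ 2 = 2 := by
  rw [← sq_eq_sq₀ (norm_nonneg v) zero_le_one, ← real_inner_self_eq_norm_sq, inner_eq_lcoord,
    Fin.sum_univ_three]
  constructor <;> intro h <;> linarith

theorem norm_vec (n : CellName) : ‖n.vec‖ = 1 := by
  rw [norm_eq_one_iff_lcoord]
  cases n
  · rw [lcoord_f2]; simp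
  · rw [lcoord_g2]; simp
  · rw [lcoord_h2]; simp; norm_num
  · rw [lcoord_i2]; simp only [Matrix.cons_val]; linarith [sqrt_three_sq]

/-- The kernel of the derivative at the origin of the pinch that realizes the class. -/
noncomputable def CellName.kernel : CellName → E3 →L[ℝ] E3
  | .f2 => ContinuousLinearMap.id ℝ E3 - alongAxis axisU
  | .g2 => alongAxis axisU
  | .h2 => ContinuousLinearMap.id ℝ E3 - alongAxis axisP
  | .i2 => alongAxis axisQ

theorem alongAxis_U_e1 : alongAxis axisU !₂[1, 0, 0] = (√2 / 2) • CellName.f2.vec := by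
  rw [alongAxis_apply, inner_axisU, lcoord_e1]
  simp only [Matrix.cons_val, mul_one]
  rfl

theorem alongAxis_P_e1 : alongAxis axisP !₂[1, 0, 0] = (1 / 2 : ℝ) • CellName.h2.vec := by
  rw [alongAxis_apply, inner_axisP, lcoord_e1]
  simp only [Matrix.cons_val, add_zero]
  rfl

/-- The vector of (f2) and (h2) is the normalized projection of the base edge onto an axis; that of
(g2) and (i2) is the normalized projection onto the orthogonal complement of an axis. Positivity of
c fixes the sign of the half-tangent. -/
theorem CellName.kernel_e1 (n : CellName) : ∃ c : ℝ, 0 < c ∧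
    !₂[1, 0, 0] - n.kernel !₂[1, 0, 0] = c • n.vec := by
  cases n
  · refine ⟨√2 / 2, by positivity, ?_⟩
    rw [kernel, sub_apply, ContinuousLinearMap.id_apply, sub_sub_cancel,
      alongAxis_U_e1]
  · refine ⟨√2 / 2, by positivity, ?_⟩
    rw [kernel, alongAxis_apply, inner_axisU, lcoord_e1]
    apply lcoord_injective
    funext i
    rw [sub_eq_add_neg, lcoord_add, lcoord_neg, lcoord_smul, lcoord_smul, lcoord_axisU, lcoord_g2,
      lcoord_e1]
    fin_cases i <;> simp <;> linarith [sqrt_two_sq]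
  · refine ⟨1 / 2, by positivity, ?_⟩
    rw [kernel, sub_apply, ContinuousLinearMap.id_apply, sub_sub_cancel,
      alongAxis_P_e1]
  · refine ⟨√3 / 2, by positivity, ?_⟩
    rw [kernel, alongAxis_apply, inner_axisQ, lcoord_e1]
    apply lcoord_injective
    funext i
    rw [sub_eq_add_neg, lcoord_add, lcoord_neg, lcoord_smul, lcoord_smul, lcoord_axisQ, lcoord_i2,
      lcoord_e1]
    fin_cases i <;> simp <;> linarith [sqrt_three_sq]

theorem CellName.kernel_ne (n : CellName) : (!₂[1, 0, 0] : E3) - n.kernel !₂[1, 0, 0] ≠ 0 := by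
  obtain ⟨c, hc, h⟩ := n.kernel_e1
  rw [h]
  refine smul_ne_zero hc.ne' fun h0 => ?_
  have := norm_vec n
  rw [h0, norm_zero] at this
  exact zero_ne_one this

theorem CellName.isPinch : ∀ n : CellName, IsPinch n.kernel
  | .f2 => isAxis_axisU.isPinch_acrossAxis (by simpa [kernel] using kernel_ne .f2)
  | .g2 => isAxis_axisU.isPinch_alongAxis (kernel_ne .g2)
  | .h2 => isAxis_axisP.isPinch_acrossAxis (by simpa [kernel] using kernel_ne .h2)
  | .i2 => isAxis_axisQ.isPinch_alongAxis (kernel_ne .i2)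

/-- The tiling that realizes the class. -/
noncomputable def CellName.tiling (n : CellName) : E2Tiling := n.isPinch.tiling

namespace CellName

theorem halfTangent (n : CellName) : n.tiling.HalfTangent baseEdge 0 n.vec := by
  have h := n.isPinch.tiling_halfTangent
  obtain ⟨c, hc, e⟩ := n.kernel_e1
  rwa [e, norm_smul, norm_vec, mul_one, Real.norm_of_nonneg hc.le, inv_smul_smul₀ hc.ne'] at h

theorem hasPn3mSymmetry (n : CellName) : n.tiling.HasPn3mSymmetry := n.isPinch.tiling_hasPn3mSymmetry

theorem secondOrder (n : CellName) : n.tiling.HasSecondOrderPn3mSymmetry :=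
  n.hasPn3mSymmetry.secondOrder

theorem vec_pos (n : CellName) : 0 < n.vec 0 := by
  cases n <;> simp [vec]

theorem leavesForward (n : CellName) : n.tiling.LeavesForward :=
  (E2Tiling.leavesForward_iff n.secondOrder n.halfTangent).2 n.vec_pos

theorem isSoft (n : CellName) : n.tiling.IsSoft := by
  rw [E2Tiling.isSoft_iff n.secondOrder n.halfTangent, inner_axisU, inner_axisP, inner_axisQ]
  cases n
  · right; left; rw [lcoord_f2]; simp
  · left; rw [lcoord_g2]; simp
  · left; rw [lcoord_h2]; simp
  · right; right; rw [lcoord_i2]; simp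

theorem lcoord_axis_cast : (∀ i, lcoord axisU i = √2 * (![1, 0, 0] : Fin 3 → ℤ) i) ∧
    (∀ i, lcoord axisP i = 1 * (![0, 1, 1] : Fin 3 → ℤ) i) ∧
    ∀ i, lcoord axisQ i = 1 * (![0, -1, 1] : Fin 3 → ℤ) i := by
  rw [lcoord_axisU, lcoord_axisP, lcoord_axisQ]
  refine ⟨fun i => ?_, fun i => ?_, fun i => ?_⟩ <;> fin_cases i <;> simp

theorem hasPlanarFaces (n : CellName) : n.tiling.HasPlanarFaces := by
  cases n
  · exact (isPinch .f2).tiling_hasPlanarFaces isBaseFace_quad fun g hg h0 y hy =>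
      acrossAxis_planar (isAxisPlane_quad.latticeForm hg h0 lcoord_axis_cast.1) y hy
  · exact (isPinch .g2).tiling_hasPlanarFaces isBaseFace_quad fun g hg h0 y _ =>
      alongAxis_planar (isAxisPlane_quad.latticeForm hg h0 lcoord_axis_cast.1) y
  · exact (isPinch .h2).tiling_hasPlanarFaces isBaseFace_hex₁ fun g hg h0 y hy =>
      acrossAxis_planar (isAxisPlane_hex₁.latticeForm hg h0 lcoord_axis_cast.2.1) y hy
  · exact (isPinch .i2).tiling_hasPlanarFaces isBaseFace_hex₂ fun g hg h0 y _ =>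
      alongAxis_planar (isAxisPlane_hex₂.latticeForm hg h0 lcoord_axis_cast.2.2) y

theorem isStandard_iff (n : CellName) : n.tiling.IsStandard ↔ n = f2 ∨ n = h2 := by
  rw [E2Tiling.isStandard_iff n.secondOrder n.halfTangent]
  have hs : 0 < √2 := by positivity
  have hs3 : 0 < √3 := by positivity
  cases n
  · exact iff_of_true isAxis_axisU.map_eq (Or.inl rfl)
  · simp only [reduceCtorEq, or_self, iff_false]
    intro h
    rcases h rotP rotP_mem rotP_zero with h | h <;>
    · have := congrFun (congrArg lcoord h) 1
      simp [lcoord_rotP, lcoord_neg', lcoord_g2] at this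
      try linarith
  · exact iff_of_true isAxis_axisP.map_eq (Or.inr rfl)
  · simp only [reduceCtorEq, or_self, iff_false]
    intro h
    rcases h rotP rotP_mem rotP_zero with h | h
    · have := congrFun (congrArg lcoord h) 0
      simp [lcoord_rotP, lcoord_i2] at this
      linarith
    · have := congrFun (congrArg lcoord h) 1
      simp [lcoord_rotP, lcoord_neg', lcoord_i2] at this
      linarith

end CellName

/-! ### Comparison of systems of half-tangents -/

namespace E2Tiling

variable {M N P : E2Tiling} {s t : ℝ}

theorem SameHalfTangents.symm (h : SameHalfTangents s M N) (hs : s * s = 1) :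
    SameHalfTangents s N M := by
  obtain ⟨g, hg, H⟩ := h
  have hg' := Im3m.symm_mem hg
  refine ⟨g.symm, hg', fun e v u he hv hve => ?_⟩
  have := H (g.symm '' e) (g.symm v) (s • g.symm.linearIsometryEquiv u)
    (Im3m.image_isStratum hg' he) (Im3m.image_isNode hg' hv) (Set.mem_image_of_mem _ hve)
  rw [Set.image_image, map_smul, linear_symm_apply, smul_smul, hs] at this
  simpa using this.symm

theorem SameHalfTangents.trans (h : SameHalfTangents s M N) (h' : SameHalfTangents t N P) :
    SameHalfTangents (t * s) M P := by
  obtain ⟨g, hg, H⟩ := h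
  obtain ⟨k, hk, K⟩ := h'
  refine ⟨g.trans k, ?_, fun e v u he hv hve => ?_⟩
  · have h1 : g '' bcc = bcc := hg
    have h2 : k '' bcc = bcc := hk
    change (g.trans k) '' bcc = bcc
    rw [AffineIsometryEquiv.coe_trans, Set.image_comp, h1, h2]
  · rw [H e v u he hv hve, K (g '' e) (g v) _ (Im3m.image_isStratum hg he)
      (Im3m.image_isNode hg hv) (Set.mem_image_of_mem _ hve), Set.image_image, map_smul, smul_smul]
    rfl

theorem SameHalfTangents.isStandard (h : SameHalfTangents s M N) (hs : s ≠ 0)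
    (hN : N.IsStandard) : M.IsStandard := by
  obtain ⟨g, hg, H⟩ := h
  intro v e₁ e₂ u₁ u₂ hv he₁ he₂ h₁ h₂ hu₁ hu₂
  have := hN (g v) _ _ _ _ (Im3m.image_isNode hg hv) (Im3m.image_isStratum hg he₁)
    (Im3m.image_isStratum hg he₂) (Set.mem_image_of_mem _ h₁) (Set.mem_image_of_mem _ h₂)
    ((H _ _ _ he₁ hv h₁).1 hu₁) ((H _ _ _ he₂ hv h₂).1 hu₂)
  refine this.imp (fun h => ?_) (fun h => ?_)
  · exact g.linearIsometryEquiv.injective (smul_right_injective E3 hs h)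
  · rw [← smul_neg, ← map_neg] at h
    exact g.linearIsometryEquiv.injective (smul_right_injective E3 hs h)

theorem SameHalfTangents.isStandard_iff (h : SameHalfTangents s M N) (hs : s * s = 1) :
    M.IsStandard ↔ N.IsStandard := by
  have h0 : s ≠ 0 := by rintro rfl; simp at hs
  exact ⟨(h.symm hs).isStandard h0, h.isStandard h0⟩

theorem inner_e1_eq (a : E3) : inner ℝ a (!₂[1, 0, 0] - 0) = a 0 := by
  simp [PiLp.inner_apply, Fin.sum_univ_three]

/-- Angles between edges and half-tangents are invariants of the class. -/
theorem SameHalfTangents.apply_zero (h : SameHalfTangents s M N) {a b : E3}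
    (hN : N.HasSecondOrderPn3mSymmetry) (ha : M.HalfTangent baseEdge 0 a)
    (hb : N.HalfTangent baseEdge 0 b) : b 0 = s * a 0 := by
  obtain ⟨g, hg, H⟩ := h
  have h1 := (H _ _ _ isEdge_baseEdge isNode_zero zero_mem_baseEdge).1 ha
  obtain ⟨k, hk, e1, e2, e3⟩ := exists_edge_flag_of_ne (Im3m.image_isStratum hg isEdge_baseEdge)
    (Im3m.image_isNode hg isNode_zero) (Im3m.image_isNode hg isNode_e1) (image_zero_mem g)
    (Set.mem_image_of_mem _ e1_mem_baseEdge)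
    (g.injective.ne (hasCoord_zero.ne hasCoord_e1 (by decide)))
  rw [← e1, ← e2, halfTangent_flag_iff hN hb hk] at h1
  have h2 : inner ℝ (k.linearIsometryEquiv b) (k !₂[1, 0, 0] - k 0) =
      inner ℝ (s • g.linearIsometryEquiv a) (g !₂[1, 0, 0] - g 0) := by rw [h1, e2, e3]
  rw [inner_smul_left, ← linear_eq_sub, ← linear_eq_sub, LinearIsometryEquiv.inner_map_map,
    LinearIsometryEquiv.inner_map_map, inner_e1_eq, inner_e1_eq] at h2
  simpa using h2

/-- The squared first components of the vectors are 1/2, 1/2, 1/4, 3/4, and they are invariant even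
under reversal. The two equal values belong to (f2) and (g2), of which only (f2) is standard. -/
theorem cellName_unique {n m : CellName} (hs : s * s = 1) (ht : t * t = 1)
    (h : SameHalfTangents s M n.tiling) (h' : SameHalfTangents t M m.tiling) : n = m := by
  obtain ⟨-, a, -, ha⟩ := M.exists_arc isEdge_baseEdge isNode_zero zero_mem_baseEdge
  have h1 := h.apply_zero n.secondOrder ha n.halfTangent
  have h2 := h'.apply_zero m.secondOrder ha m.halfTangent
  have h3 : n.vec 0 ^ 2 = m.vec 0 ^ 2 := by
    rw [h1, h2, mul_pow, mul_pow, sq s, sq t, hs, ht]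
  have h4 : (n = .f2 ∨ n = .h2) ↔ (m = .f2 ∨ m = .h2) := by
    rw [← n.isStandard_iff, ← m.isStandard_iff, ← h.isStandard_iff hs, ← h'.isStandard_iff ht]
  cases n <;> cases m <;> first
    | rfl
    | (simp at h4; done)
    | (exfalso; simp [CellName.vec, div_pow] at h3; norm_num at h3)

/-- As j fixes the base edge pointwise, it carries the flag of k to the flag of the conjugate j k
j⁻¹, which lies in `Pn3m` again. Both systems are orbits of one vector, so agreement at the base
edge propagates to all flags. -/
theorem sameHalfTangents_of_conj (hM : M.HasSecondOrderPn3mSymmetry)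
    (hN : N.HasSecondOrderPn3mSymmetry) {a b : E3} (ha : M.HalfTangent baseEdge 0 a)
    (hb : N.HalfTangent baseEdge 0 b) {j : E3 ≃ᵃⁱ[ℝ] E3} (hj : j ∈ Im3m)
    (hbase : ∀ x ∈ baseEdge, j x = x)
    (hconj : ∀ k ∈ Pn3m, (j.symm.trans k).trans j ∈ Pn3m) (hs : s * s = 1)
    (hab : a = s • j.symm.linearIsometryEquiv b) : SameHalfTangents s M N := by
  refine ⟨j, hj, fun e v u he hv hve => ?_⟩
  obtain ⟨k, hk, rfl, rfl⟩ := exists_edge_flag he hv hve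
  have hc : ∀ x ∈ baseEdge, ((j.symm.trans k).trans j) x = j (k x) := by
    intro x hx
    have : j.symm x = x := by rw [AffineIsometryEquiv.symm_apply_eq, hbase x hx]
    simp [this]
  have e1 : j '' (k '' baseEdge) = (j.symm.trans k).trans j '' baseEdge := by
    rw [Set.image_image]
    exact Set.image_congr fun x hx => (hc x hx).symm
  have e2 : j (k 0) = (j.symm.trans k).trans j 0 := (hc 0 zero_mem_baseEdge).symm
  rw [e1, e2, halfTangent_flag_iff hM ha hk, halfTangent_flag_iff hN hb (hconj k hk)]
  have e3 : ((j.symm.trans k).trans j).linearIsometryEquiv b =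
      j.linearIsometryEquiv (k.linearIsometryEquiv (j.symm.linearIsometryEquiv b)) := rfl
  rw [e3, ← map_smul, j.linearIsometryEquiv.injective.eq_iff, hab, map_smul]
  constructor
  · rintro rfl
    rw [smul_smul, hs, one_smul]
  · intro h
    rw [← h, smul_smul, hs, one_smul]

/-- The reflection changes the sign of one coordinate. Conjugation by it leaves the product of signs
unchanged and alters translations only by signs and multiples of 4; the residues 0 and 2 are
insensitive to both. -/
theorem exists_mirror : ∃ j ∈ Im3m, (∀ x ∈ baseEdge, j x = x) ∧
    (∀ k ∈ Pn3m, (j.symm.trans k).trans j ∈ Pn3m) ∧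
    ∀ v, j.symm.linearIsometryEquiv v = mirrorZ v := by
  obtain ⟨j, J⟩ := exists_isSignedPerm 1 ![1, 1, -1] ![0, 0, -4]
  have hjj : ∀ x, j (j x) = x := fun x => coord_injective (funext fun i => by
    rw [J, J]
    fin_cases i <;> simp)
  have hsymm : j.symm = j := by
    ext1 x
    rw [AffineIsometryEquiv.symm_apply_eq, hjj]
  have hmap : ∀ c ∈ bcc, j c ∈ bcc := fun c hc =>
    J.map_bcc ![0, 0, -2] (by decide) (by decide) hc
  have hj : j ∈ Im3m := by
    refine Set.Subset.antisymm ?_ fun x hx => ⟨j x, hmap x hx, hjj x⟩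
    rintro _ ⟨c, hc, rfl⟩
    exact hmap c hc
  refine ⟨j, hj, ?_, ?_, ?_⟩
  · intro x hx
    obtain ⟨r, -, rfl⟩ := (mem_baseEdge_iff x).1 hx
    apply coord_injective
    funext i
    rw [J, coord_smul_e1]
    fin_cases i <;> simp
    norm_num
  · intro k hk
    rw [mem_Pn3m_iff] at *
    obtain ⟨σ, ε, t, K, ht⟩ := hk
    rw [hsymm]
    refine ⟨_, _, _, (J.trans K).trans J, fun i => ?_⟩
    have e : ∏ i, (![1, 1, -1] : Fin 3 → ℤˣ) i * (ε ((1 : Equiv.Perm (Fin 3)) i) *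
        (![1, 1, -1] : Fin 3 → ℤˣ) (σ ((1 : Equiv.Perm (Fin 3)) i))) = ∏ i, ε i := by
      simp only [Equiv.Perm.coe_one, id_eq, Finset.prod_mul_distrib]
      rw [Equiv.prod_comp σ (![1, 1, -1] : Fin 3 → ℤˣ), mul_left_comm, ← Finset.prod_mul_distrib]
      simp [Fin.prod_univ_three]
    rw [e]
    have h1 := ht i
    have h2 : ∀ l, (![0, 0, -4] : Fin 3 → ℤ) l = 0 ∨ (![0, 0, -4] : Fin 3 → ℤ) l = -4 := by decide
    simp only [Equiv.Perm.coe_one, id_eq]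
    rcases h2 i with h | h <;> rcases h2 (σ i) with h' | h' <;>
    rcases Int.units_eq_one_or (ε i) with a | a <;>
    rcases Int.units_eq_one_or ((![1, 1, -1] : Fin 3 → ℤˣ) i) with b | b <;>
    simp only [h, h', a, b] <;> split_ifs at h1 ⊢ <;> simp <;> omega
  · intro v
    rw [hsymm]
    apply lcoord_injective
    funext i
    rw [J.lcoord]
    fin_cases i <;> simp [lcoord, mirrorZ]

end E2Tiling

/-! ### The great circles in the scaled cubic coordinates -/

theorem lcoord_mirrorZ (v : E3) : lcoord (mirrorZ v) = ![lcoord v 0, lcoord v 1, -lcoord v 2] := by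
  funext i; fin_cases i <;> simp [lcoord, mirrorZ]

theorem mem_gAbCd_iff {a : E3} : a ∈ gAbCd ↔ ‖a‖ = 1 ∧ lcoord a 0 = 0 := by
  have h : a ∈ gAbCd ↔ ‖a‖ = 1 ∧ inner ℝ axisU a = 0 := Iff.rfl
  rw [h, inner_axisU, mul_eq_zero_iff_left (by positivity)]

theorem mem_gAcBd_iff {a : E3} : a ∈ gAcBd ↔ ‖a‖ = 1 ∧ lcoord a 2 = -lcoord a 1 := by
  have h : a ∈ gAcBd ↔ ‖a‖ = 1 ∧ inner ℝ axisP a = 0 := Iff.rfl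
  rw [h, inner_axisP]
  exact and_congr_right fun _ => ⟨fun h => by linarith, fun h => by rw [h]; ring⟩

theorem mem_gAdBc_iff {a : E3} : a ∈ gAdBc ↔ ‖a‖ = 1 ∧ lcoord a 2 = lcoord a 1 := by
  have h : a ∈ gAdBc ↔ ‖a‖ = 1 ∧ inner ℝ axisQ a = 0 := Iff.rfl
  rw [h, inner_axisQ]
  exact and_congr_right fun _ => ⟨fun h => by linarith, fun h => by rw [h]; ring⟩

theorem mem_gQuad_iff {a : E3} : a ∈ gQuad ↔ ‖a‖ = 1 ∧ lcoord a 2 = 0 := by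
  have h : inner ℝ !₂[0, 0, 1] a = a 2 := by simp [PiLp.inner_apply, Fin.sum_univ_three]
  have h2 : √2 ≠ 0 := by positivity
  rw [gQuad, greatCircle, Set.mem_ofPred_eq, h]
  simp [lcoord]

theorem mem_gHex1_iff {a : E3} :
    a ∈ gHex1 ↔ ‖a‖ = 1 ∧ lcoord a 0 - lcoord a 1 + lcoord a 2 = 0 := by
  have h : inner ℝ !₂[0, 2 / √6, √2 / √6] a = (√6)⁻¹ * (2 * a 1 + √2 * a 2) := by
    simp [PiLp.inner_apply, Fin.sum_univ_three]; ring
  rw [gHex1, greatCircle, Set.mem_ofPred_eq, h, mul_eq_zero_iff_left (by positivity)]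
  simp only [lcoord, Matrix.cons_val]
  exact and_congr_right fun _ => ⟨fun h => by linarith, fun h => by linarith⟩

theorem mem_gHex2_iff {a : E3} :
    a ∈ gHex2 ↔ ‖a‖ = 1 ∧ lcoord a 0 - lcoord a 1 - lcoord a 2 = 0 := by
  have h : inner ℝ !₂[0, 2 / √6, -(√2 / √6)] a = (√6)⁻¹ * (2 * a 1 - √2 * a 2) := by
    simp [PiLp.inner_apply, Fin.sum_univ_three]; ring
  rw [gHex2, greatCircle, Set.mem_ofPred_eq, h, mul_eq_zero_iff_left (by positivity)]
  simp only [lcoord, Matrix.cons_val]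
  exact and_congr_right fun _ => ⟨fun h => by linarith, fun h => by linarith⟩

theorem E2Tiling.isSoft_iff_mem {M : E2Tiling} {a : E3} (hM : M.HasSecondOrderPn3mSymmetry)
    (ha : M.HalfTangent baseEdge 0 a) : M.IsSoft ↔ a ∈ gAbCd ∪ gAcBd ∪ gAdBc := by
  have h1 := ha.norm_eq_one isEdge_baseEdge isNode_zero zero_mem_baseEdge
  rw [isSoft_iff hM ha, ← or_assoc]
  refine or_congr (or_congr ?_ ?_) ?_ <;>
    exact (and_iff_right h1).symm

theorem E2Tiling.hasSecondOrderPlanarFaces_iff_mem {M : E2Tiling} {a : E3}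
    (hM : M.HasSecondOrderPn3mSymmetry) (ha : M.HalfTangent baseEdge 0 a) :
    M.HasSecondOrderPlanarFaces ↔ a ∈ gQuad ∪ gHex1 ∪ gHex2 := by
  have h1 := ha.norm_eq_one isEdge_baseEdge isNode_zero zero_mem_baseEdge
  rw [hasSecondOrderPlanarFaces_iff hM ha, ← or_assoc, Set.mem_union, Set.mem_union, mem_gQuad_iff,
    mem_gHex1_iff, mem_gHex2_iff]
  simp only [h1, true_and, latticeForm, Fin.sum_univ_three, Matrix.cons_val]
  refine or_congr (or_congr ?_ ?_) ?_ <;> push_cast <;> ring_nf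

/-! ### Their points of intersection -/

/-- A unit vector in the direction of a vector `b` of length one is `b` or `-b`. -/
theorem eq_or_eq_neg_of_lcoord {a b : E3} (ha : ‖a‖ = 1) (hb : ‖b‖ = 1) {r : ℝ}
    (h : ∀ i, lcoord a i = r * lcoord b i) : a = b ∨ a = -b := by
  have e : a = r • b := lcoord_injective (funext fun i => by rw [h, lcoord_smul])
  rw [e, norm_smul, hb, mul_one, Real.norm_eq_abs, abs_eq zero_le_one] at ha
  rcases ha with rfl | rfl
  · exact Or.inl (by rw [e, one_smul])
  · exact Or.inr (by rw [e, neg_one_smul])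

theorem norm_mirrorZ (v : E3) : ‖mirrorZ v‖ = ‖v‖ := by
  rw [← sq_eq_sq₀ (norm_nonneg _) (norm_nonneg _), ← real_inner_self_eq_norm_sq,
    ← real_inner_self_eq_norm_sq, inner_eq_lcoord, inner_eq_lcoord, lcoord_mirrorZ]
  simp [Fin.sum_univ_three]

/-- The vectors that the intersection points are compared with. -/
def IsVecUpToMirror (n : CellName) (a : E3) : Prop :=
  a = n.vec ∨ a = -n.vec ∨ a = mirrorZ n.vec ∨ a = -mirrorZ n.vec

theorem IsVecUpToMirror.of_lcoord {n : CellName} {a : E3} (ha : ‖a‖ = 1) {r : ℝ}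
    (h : ∀ i, lcoord a i = r * lcoord n.vec i) : IsVecUpToMirror n a :=
  (eq_or_eq_neg_of_lcoord ha (norm_vec n) h).elim Or.inl fun h => Or.inr (Or.inl h)

theorem IsVecUpToMirror.of_lcoord_mirrorZ {n : CellName} {a : E3} (ha : ‖a‖ = 1) {r : ℝ}
    (h : ∀ i, lcoord a i = r * lcoord (mirrorZ n.vec) i) : IsVecUpToMirror n a :=
  (eq_or_eq_neg_of_lcoord ha (by rw [norm_mirrorZ, norm_vec]) h).elim
    (fun h => Or.inr (Or.inr (Or.inl h))) fun h => Or.inr (Or.inr (Or.inr h))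

theorem forall_fin_three {p : Fin 3 → Prop} (h0 : p 0) (h1 : p 1) (h2 : p 2) : ∀ i, p i := by
  intro i; fin_cases i <;> assumption

/-- Two distinct planes through 0 meet in a line, so in each of the nine cases a is a multiple of a
known unit vector, hence that vector or its negative. -/
theorem exists_of_mem_inter {a : E3}
    (h : a ∈ (gAbCd ∪ gAcBd ∪ gAdBc) ∩ (gQuad ∪ gHex1 ∪ gHex2)) : ∃ n, IsVecUpToMirror n a := by
  have t2 : √2 ≠ 0 := by positivity
  have t3 : √3 ≠ 0 := by positivity
  simp only [Set.mem_inter_iff, Set.mem_union, mem_gAbCd_iff, mem_gAcBd_iff, mem_gAdBc_iff,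
    mem_gQuad_iff, mem_gHex1_iff, mem_gHex2_iff] at h
  rcases h with ⟨(⟨ha, h⟩ | ⟨-, h⟩) | ⟨-, h⟩, (⟨ha, h'⟩ | ⟨ha, h'⟩) | ⟨ha, h'⟩⟩
  · refine ⟨.g2, .of_lcoord ha (r := lcoord a 1 / √2) (forall_fin_three ?_ ?_ ?_)⟩ <;>
      simp [lcoord_g2, h, h', t2]
  · refine ⟨.h2, .of_lcoord ha (r := lcoord a 1) (forall_fin_three ?_ ?_ ?_)⟩ <;>
      simp [lcoord_h2] <;> linarith
  · refine ⟨.h2, .of_lcoord_mirrorZ ha (r := lcoord a 1) (forall_fin_three ?_ ?_ ?_)⟩ <;>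
      simp [lcoord_mirrorZ, lcoord_h2] <;> linarith
  · refine ⟨.f2, .of_lcoord ha (r := lcoord a 0 / √2) (forall_fin_three ?_ ?_ ?_)⟩ <;>
      simp [lcoord_f2, t2] <;> linarith
  · refine ⟨.i2, .of_lcoord_mirrorZ ha (r := √3 * lcoord a 1) (forall_fin_three ?_ ?_ ?_)⟩ <;>
      simp only [lcoord_mirrorZ, lcoord_i2, Matrix.cons_val]
    · linear_combination h' - h - 2 / 3 * lcoord a 1 * sqrt_three_sq
    · linear_combination -(1 / 3) * lcoord a 1 * sqrt_three_sq
    · linear_combination h + 1 / 3 * lcoord a 1 * sqrt_three_sq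
  · refine ⟨.h2, .of_lcoord_mirrorZ ha (r := lcoord a 1) (forall_fin_three ?_ ?_ ?_)⟩ <;>
      simp [lcoord_mirrorZ, lcoord_h2] <;> linarith
  · refine ⟨.f2, .of_lcoord ha (r := lcoord a 0 / √2) (forall_fin_three ?_ ?_ ?_)⟩ <;>
      simp [lcoord_f2, t2] <;> linarith
  · refine ⟨.h2, .of_lcoord ha (r := lcoord a 1) (forall_fin_three ?_ ?_ ?_)⟩ <;>
      simp [lcoord_h2] <;> linarith
  · refine ⟨.i2, .of_lcoord ha (r := √3 * lcoord a 1) (forall_fin_three ?_ ?_ ?_)⟩ <;>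
      simp only [lcoord_i2, Matrix.cons_val]
    · linear_combination h' + h - 2 / 3 * lcoord a 1 * sqrt_three_sq
    · linear_combination -(1 / 3) * lcoord a 1 * sqrt_three_sq
    · linear_combination h - 1 / 3 * lcoord a 1 * sqrt_three_sq

theorem f2_vec_mem : CellName.f2.vec ∈ gAcBd ∩ gAdBc ∩ gQuad := by
  simp [mem_gAcBd_iff, mem_gAdBc_iff, mem_gQuad_iff, norm_vec, lcoord_f2]

theorem g2_vec_mem : CellName.g2.vec ∈ gAbCd ∩ gQuad := by
  simp [mem_gAbCd_iff, mem_gQuad_iff, norm_vec, lcoord_g2]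

theorem h2_vec_mem : CellName.h2.vec ∈ gAbCd ∩ gAdBc ∩ gHex1 := by
  simp [mem_gAbCd_iff, mem_gAdBc_iff, mem_gHex1_iff, norm_vec, lcoord_h2]

theorem i2_vec_mem : CellName.i2.vec ∈ gAdBc ∩ gHex2 := by
  simp only [Set.mem_inter_iff, mem_gAdBc_iff, mem_gHex2_iff, norm_vec, lcoord_i2,
    Matrix.cons_val, true_and]
  ring

theorem neg_mem_greatCircle {n a : E3} (h : a ∈ greatCircle n) : -a ∈ greatCircle n :=
  ⟨by rw [norm_neg, h.1], by rw [inner_neg_right, h.2, neg_zero]⟩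

theorem neg_mem_inter {a : E3} (h : a ∈ (gAbCd ∪ gAcBd ∪ gAdBc) ∩ (gQuad ∪ gHex1 ∪ gHex2)) :
    -a ∈ (gAbCd ∪ gAcBd ∪ gAdBc) ∩ (gQuad ∪ gHex1 ∪ gHex2) :=
  h.imp (Or.imp (Or.imp neg_mem_greatCircle neg_mem_greatCircle) neg_mem_greatCircle)
    (Or.imp (Or.imp neg_mem_greatCircle neg_mem_greatCircle) neg_mem_greatCircle)

theorem mirrorZ_mem_inter {a : E3} (h : a ∈ (gAbCd ∪ gAcBd ∪ gAdBc) ∩ (gQuad ∪ gHex1 ∪ gHex2)) :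
    mirrorZ a ∈ (gAbCd ∪ gAcBd ∪ gAdBc) ∩ (gQuad ∪ gHex1 ∪ gHex2) := by
  simp only [Set.mem_inter_iff, Set.mem_union, mem_gAbCd_iff, mem_gAcBd_iff, mem_gAdBc_iff,
    mem_gQuad_iff, mem_gHex1_iff, mem_gHex2_iff, norm_mirrorZ, lcoord_mirrorZ, Matrix.cons_val,
    neg_inj, neg_eq_zero, sub_neg_eq_add, ← sub_eq_add_neg] at h ⊢
  rw [neg_eq_iff_eq_neg]
  tauto

theorem vec_mem_inter (n : CellName) :
    n.vec ∈ (gAbCd ∪ gAcBd ∪ gAdBc) ∩ (gQuad ∪ gHex1 ∪ gHex2) :=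
  match n with
  | .f2 => ⟨Or.inr f2_vec_mem.1.2, Or.inl (Or.inl f2_vec_mem.2)⟩
  | .g2 => ⟨Or.inl (Or.inl g2_vec_mem.1), Or.inl (Or.inl g2_vec_mem.2)⟩
  | .h2 => ⟨Or.inr h2_vec_mem.1.2, Or.inl (Or.inr h2_vec_mem.2)⟩
  | .i2 => ⟨Or.inr i2_vec_mem.1, Or.inr i2_vec_mem.2⟩

theorem mem_inter_iff {a : E3} :
    a ∈ (gAbCd ∪ gAcBd ∪ gAdBc) ∩ (gQuad ∪ gHex1 ∪ gHex2) ↔ ∃ n, IsVecUpToMirror n a := by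
  refine ⟨exists_of_mem_inter, ?_⟩
  rintro ⟨n, rfl | rfl | rfl | rfl⟩
  · exact vec_mem_inter n
  · exact neg_mem_inter (vec_mem_inter n)
  · exact mirrorZ_mem_inter (vec_mem_inter n)
  · exact neg_mem_inter (mirrorZ_mem_inter (vec_mem_inter n))

/-! ### The classification -/

namespace E2Tiling

variable {M : E2Tiling} {s : ℝ}

theorem sameHalfTangents_refl (M : E2Tiling) : SameHalfTangents 1 M M :=
  E2Tiling.secondOrderSetoid.refl M

theorem sameHalfTangents_tiling (hM : M.HasSecondOrderPn3mSymmetry) {n : CellName}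
    (hs : s * s = 1) (h : M.HalfTangent baseEdge 0 (s • n.vec)) :
    SameHalfTangents s M n.tiling :=
  sameHalfTangents_of_conj (j := AffineIsometryEquiv.refl ℝ E3) hM n.secondOrder h n.halfTangent
    (Pn3m_subset_Im3m Pn3m.refl_mem) (fun _ _ => rfl) (fun _ hk => hk) hs rfl

theorem sameHalfTangents_tiling_mirrorZ (hM : M.HasSecondOrderPn3mSymmetry) {n : CellName}
    (hs : s * s = 1) (h : M.HalfTangent baseEdge 0 (s • mirrorZ n.vec)) :
    SameHalfTangents s M n.tiling := by
  obtain ⟨j, hj, h1, h2, h3⟩ := exists_mirror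
  exact sameHalfTangents_of_conj hM n.secondOrder h n.halfTangent hj h1 h2 hs (by rw [h3])

theorem exists_sameHalfTangents (hM : M.HasSecondOrderPn3mSymmetry) (hsoft : M.IsSoft)
    (hplan : M.HasSecondOrderPlanarFaces) : ∃ (n : CellName) (s : ℝ), (s = 1 ∨ s = -1) ∧
      SameHalfTangents s M n.tiling := by
  obtain ⟨-, a, -, ha⟩ := M.exists_arc isEdge_baseEdge isNode_zero zero_mem_baseEdge
  obtain ⟨n, rfl | rfl | rfl | rfl⟩ := exists_of_mem_inter
    ⟨(isSoft_iff_mem hM ha).1 hsoft, (hasSecondOrderPlanarFaces_iff_mem hM ha).1 hplan⟩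
  · exact ⟨n, 1, Or.inl rfl, sameHalfTangents_tiling hM (by norm_num) (by rwa [one_smul])⟩
  · exact ⟨n, -1, Or.inr rfl, sameHalfTangents_tiling hM (by norm_num) (by rwa [neg_one_smul])⟩
  · exact ⟨n, 1, Or.inl rfl, sameHalfTangents_tiling_mirrorZ hM (by norm_num) (by rwa [one_smul])⟩
  · exact ⟨n, -1, Or.inr rfl,
      sameHalfTangents_tiling_mirrorZ hM (by norm_num) (by rwa [neg_one_smul])⟩

/-- A sign -1 would reverse the sign of the cosine with the edge, which is positive for M and for
all four model tilings. -/
theorem eq_one_of_leavesForward (hM : M.HasSecondOrderPn3mSymmetry) (hf : M.LeavesForward)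
    {n : CellName} (hs : s = 1 ∨ s = -1) (h : SameHalfTangents s M n.tiling) : s = 1 := by
  obtain ⟨-, a, -, ha⟩ := M.exists_arc isEdge_baseEdge isNode_zero zero_mem_baseEdge
  have h1 := h.apply_zero n.secondOrder ha n.halfTangent
  have h2 := (leavesForward_iff hM ha).1 hf
  have h3 := n.vec_pos
  rcases hs with rfl | rfl
  · rfl
  · linarith

end E2Tiling

/-- The second-order class with the given name. -/
noncomputable def CellName.secondOrderClass (n : CellName) : SecondOrderClass :=
  Quotient.mk _ n.tiling

namespace CellName

theorem secondOrderClass_injective : Function.Injective secondOrderClass := fun _ _ h =>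
  (E2Tiling.cellName_unique (one_mul 1) (one_mul 1)
    (E2Tiling.sameHalfTangents_refl _) (Quotient.exact h))

theorem mk_mem_range {M : E2Tiling} (hM : M.HasSecondOrderPn3mSymmetry) (hsoft : M.IsSoft)
    (hplan : M.HasSecondOrderPlanarFaces) (hf : M.LeavesForward) :
    (Quotient.mk _ M : SecondOrderClass) ∈ Set.range secondOrderClass := by
  obtain ⟨n, s, hs, h⟩ := E2Tiling.exists_sameHalfTangents hM hsoft hplan
  obtain rfl := E2Tiling.eq_one_of_leavesForward hM hf hs h
  exact ⟨n, (Quotient.sound h).symm⟩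

/-- The sign need not be the same in two comparisons: `cellName_unique` allows independent signs, so
one tiling cannot match two names even after reversal. -/
theorem existsUnique {M : E2Tiling} (hM : M.HasSecondOrderPn3mSymmetry) (hsoft : M.IsSoft)
    (hplan : M.HasSecondOrderPlanarFaces) :
    ∃! n : CellName, ∃ N : E2Tiling, Quotient.mk _ N = n.secondOrderClass ∧
      (E2Tiling.SameHalfTangents 1 M N ∨ E2Tiling.SameHalfTangents (-1) M N) := by
  obtain ⟨n, s, hs, h⟩ := E2Tiling.exists_sameHalfTangents hM hsoft hplan
  have hss : s * s = 1 := by rcases hs with rfl | rfl <;> norm_num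
  refine ⟨n, ⟨n.tiling, rfl, by rcases hs with rfl | rfl <;> simp [h]⟩, ?_⟩
  rintro m ⟨N, hN, h' | h'⟩
  · exact E2Tiling.cellName_unique (by norm_num) hss (h'.trans (Quotient.exact hN)) h
  · exact E2Tiling.cellName_unique (by norm_num) hss (h'.trans (Quotient.exact hN)) h

theorem range_secondOrderClass :
    {q : SecondOrderClass | ∃ M : E2Tiling, Quotient.mk _ M = q ∧ M.LeavesForward ∧
      M.HasPn3mSymmetry ∧ M.IsSoft ∧ M.HasPlanarFaces} = Set.range secondOrderClass := by
  ext q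
  constructor
  · rintro ⟨M, rfl, hf, hM, hsoft, hplan⟩
    exact mk_mem_range hM.secondOrder hsoft hplan.secondOrder hf
  · rintro ⟨n, rfl⟩
    exact ⟨n.tiling, rfl, n.leavesForward, n.hasPn3mSymmetry, n.isSoft, n.hasPlanarFaces⟩

theorem natCard : Nat.card CellName = 4 := by
  let e : CellName ≃ Fin 4 :=
    { toFun := fun | f2 => 0 | g2 => 1 | h2 => 2 | i2 => 3
      invFun := ![f2, g2, h2, i2]
      left_inv := fun n => by cases n <;> rfl
      right_inv := fun i => by fin_cases i <;> rfl }
  rw [Nat.card_congr e, Nat.card_eq_fintype_card, Fintype.card_fin]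

end CellName

theorem theorem2 :
    ∃ K : CellName → SecondOrderClass,
      -- exactly four second-order classes, which are (f2), (g2), (h2), (i2)
      Function.Injective K ∧
      {q : SecondOrderClass | ∃ M : E2Tiling, Quotient.mk _ M = q ∧ M.LeavesForward ∧
        M.HasPn3mSymmetry ∧ M.IsSoft ∧ M.HasPlanarFaces} = Set.range K ∧
      (Set.range K).ncard = 4 ∧
      (∀ n : CellName, ∃ M : E2Tiling, Quotient.mk _ M = K n ∧ M.LeavesForward ∧
        M.HasPn3mSymmetry ∧ M.IsSoft ∧ M.HasPlanarFaces ∧ M.HalfTangent baseEdge 0 n.vec) ∧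
      -- (f2) and (h2) are standard, (g2) and (i2) are not
      (∀ (n : CellName) (M : E2Tiling), Quotient.mk _ M = K n →
        (M.IsStandard ↔ n = CellName.f2 ∨ n = CellName.h2)) ∧
      -- without the condition of acute angles, and with symmetry and planarity to second order only
      (∀ M : E2Tiling, M.HasSecondOrderPn3mSymmetry → M.IsSoft → M.HasSecondOrderPlanarFaces →
        (∃! n : CellName, ∃ N : E2Tiling, Quotient.mk _ N = K n ∧
          (E2Tiling.SameHalfTangents 1 M N ∨ E2Tiling.SameHalfTangents (-1) M N)) ∧
        (M.LeavesForward → Quotient.mk _ M ∈ Set.range K)) ∧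
      -- the classes are the intersection points of the great circles
      (∀ (M : E2Tiling) (a : E3), M.HasSecondOrderPn3mSymmetry → M.HalfTangent baseEdge 0 a →
        (M.IsSoft ↔ a ∈ gAbCd ∪ gAcBd ∪ gAdBc) ∧
        (M.HasSecondOrderPlanarFaces ↔ a ∈ gQuad ∪ gHex1 ∪ gHex2)) ∧
      (∀ a : E3, a ∈ (gAbCd ∪ gAcBd ∪ gAdBc) ∩ (gQuad ∪ gHex1 ∪ gHex2) ↔
        ∃ n : CellName, a = n.vec ∨ a = -n.vec ∨ a = mirrorZ n.vec ∨ a = -mirrorZ n.vec) ∧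
      CellName.f2.vec ∈ gAcBd ∩ gAdBc ∩ gQuad ∧
      CellName.g2.vec ∈ gAbCd ∩ gQuad ∧
      CellName.h2.vec ∈ gAbCd ∩ gAdBc ∩ gHex1 ∧
      CellName.i2.vec ∈ gAdBc ∩ gHex2 := by
  refine ⟨CellName.secondOrderClass, CellName.secondOrderClass_injective,
    CellName.range_secondOrderClass, ?_, ?_, ?_, ?_, ?_, fun _ => mem_inter_iff, f2_vec_mem,
    g2_vec_mem, h2_vec_mem, i2_vec_mem⟩
  · rw [← Set.image_univ, Set.ncard_image_of_injective _ CellName.secondOrderClass_injective,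
      Set.ncard_univ, CellName.natCard]
  · exact fun n => ⟨n.tiling, rfl, n.leavesForward, n.hasPn3mSymmetry, n.isSoft, n.hasPlanarFaces,
      n.halfTangent⟩
  · intro n M h
    have h : E2Tiling.SameHalfTangents 1 M n.tiling := Quotient.exact h
    rw [h.isStandard_iff (one_mul 1), n.isStandard_iff]
  · exact fun M hM hsoft hplan => ⟨CellName.existsUnique hM hsoft hplan,
      CellName.mk_mem_range hM hsoft hplan⟩
  · exact fun M a hM ha => ⟨E2Tiling.isSoft_iff_mem hM ha,
      E2Tiling.hasSecondOrderPlanarFaces_iff_mem hM ha⟩
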